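/- Let $V$ be a finite-dimensional real vector space, $\mathfrak k$ a compact simple real Lie algebra, $R=\mathbb R[[V^*]]$ the ring of formal power series on $V$ (with the product topology) and $\mathfrak g = R\otimes\mathfrak k$ the topological Lie algebra of formal power series with values in $\mathfrak k$, with bracket $[f\otimes X,g\otimes Y]=fg\otimes[X,Y]$. Let $\boldsymbol v$ be a formal vector field on $V$ vanishing at the origin, let $\sigma\in\mathfrak g$, and let $\mathfrak g^\sharp=\mathfrak g\rtimes_D\mathbb R\boldsymbol d$ be the semidirect product (with the product topology) defined by the derivation $D=-\mathcal L_{\boldsymbol v}+\mathrm{ad}_\sigma$, so that $[\boldsymbol d,\xi]=D\xi$ for $\xi\in\mathfrak g$. Write $\boldsymbol v=\boldsymbol v_{\mathrm l}+\boldsymbol v_{\mathrm{ho}}$, where $\boldsymbol v_{\mathrm l}\in\mathfrak{gl}(V)$ is the linearization of $\boldsymbol v$ at $0$ and $\boldsymbol v_{\mathrm{ho}}$ vanishes at $0$ to second order, and let $\boldsymbol v_{\mathrm l}=\boldsymbol v_{\mathrm{l,s}}+\boldsymbol v_{\mathrm{l,n}}$ be the Jordan decomposition over $\mathbb C$ into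 commuting semisimple and nilpotent parts. Let $V_{\mathrm c}\subseteq V$ be the intersection with $V$ of the span in $V_{\mathbb C}$ of all generalized eigenspaces of $\boldsymbol v_{\mathrm l}$ for eigenvalues with zero real part, and let $V_{\mathrm c}^\perp\subseteq V^*$ be its annihilator. For a complex pre-Hilbert space $\mathcal D$, let $\mathfrak u(\mathcal D)$ be the real Lie algebra of linear operators $X:\mathcal D\to\mathcal D$ with $\langle X\varphi,\psi\rangle=-\langle\varphi,X\psi\rangle$ for all $\varphi,\psi\in\mathcal D$, and $\mathfrak{pu}(\mathcal D)=\mathfrak u(\mathcal D)/i\mathbb R I$. A continuous projective unitary representation of a topological Lie algebra $\mathfrak h$ on $\mathcal D$ is a Lie algebra homomorphism $\overline\pi:\mathfrak h\to\mathfrak{pu}(\mathcal D)$ such that for every ray $[\psi]$ the map $\xi\mapsto\overline\pi(\xi)[\psi]\in T_{[\psi]}\mathrm P(\mathcal D)=\mathcal D/\mathbb C\psi$ is continuous. It is of generalized positive energy at $\xi\in\mathfrak h$ if there are a continuous $2$-cocycle $\omega$ on $\mathfrak h$, a homomorphism $\pi:\mathbb R\oplus_\omega\mathfrak h\to\mathfrak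 u(\mathcal D)$ lifting $\overline\pi$, with $\pi(1,0)=iI$ and with $\zeta\mapsto\pi(\zeta)\psi$ continuous for all $\psi\in\mathcal D$, an element $\hat\xi\in\mathbb R\oplus_\omega\mathfrak h$ over $\xi$, a $1$-connected locally convex Lie group $H$ (smooth in the sense of Michal-Bastiani) with Lie algebra $\mathbb R\oplus_\omega\mathfrak h$, and a dense linear subspace $\mathcal D_0\subseteq\mathcal D$ such that $\inf_{h\in H}\langle\psi,-i\pi(\mathrm{Ad}_h\hat\xi)\psi\rangle>-\infty$ for all $\psi\in\mathcal D_0$. Theorem. Let $\mathfrak t\subseteq\mathfrak k$ be a maximal abelian subalgebra. Assume that $\sigma\in R\otimes\mathfrak t$ and that $[\boldsymbol v_{\mathrm{l,s}},\boldsymbol v_{\mathrm{ho}}]=0$ as formal vector fields. Let $\overline\pi$ be a continuous projective unitary representation of $\mathfrak g^\sharp$ on a complex pre-Hilbert space $\mathcal D$ that is of generalized positive energy at $\boldsymbol d$. Then $RV_{\mathrm c}^\perp\otimes\mathfrak k\subseteq\ker\overline\pi$, where $RV_{\mathrm c}^\perp$ is the ideal of $R$ generated by $V_{\mathrm c}^\perp$.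 Consequently $\overline\pi|_{\mathfrak g}$ factors, through the restriction of formal power series from $V$ to $V_{\mathrm c}$, through a continuous projective unitary representation of $\mathbb R[[V_{\mathrm c}^*]]\otimes\mathfrak k$. In particular, if $V_{\mathrm c}=\{0\}$, then $\overline\pi|_{\mathfrak g}$ factors through the evaluation $\mathfrak g\to\mathfrak k$ at the origin. -/

import Mathlib

open Filter Topology TensorProduct

universe u v w

-- The commutator bracket on associative rings such as `ℝ` and `Module.End ℂ 𝓓`.
attribute [local instance] LieRing.ofAssociativeRing

noncomputable section

namespace JetGPE

/-! ### Calculus and Lie groups modelled on locally convex spaces -/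

section Calculus

/-- `x` is the velocity at time `0` of the curve `γ` in a topological vector space. -/
def HasVelocity {E : Type u} [AddCommGroup E] [Module ℝ E] [TopologicalSpace E]
    (γ : ℝ → E) (x : E) : Prop :=
  Tendsto (fun t : ℝ => t⁻¹ • (γ t - γ 0)) (𝓝[≠] 0) (𝓝 x)

/-- `f` is `C^n` on the open set `U` in the sense of Michal-Bastiani: `f` is continuous on `U` and,
for positive order, all directional derivatives `df (x, v)` with `x ∈ U` exist and the map `df` is
`C^(n-1)` on `U × E`. -/
def BastianiC : (n : ℕ) → {E : Type u} → [AddCommGroup E] → [Module ℝ E] → [TopologicalSpace E] →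
    {F : Type v} → [AddCommGroup F] → [Module ℝ F] → [TopologicalSpace F] →
    (f : E → F) → (U : Set E) → Prop
  | 0, _, _, _, _, _, _, _, _, f, U => ContinuousOn f U
  | n + 1, E, _, _, _, F, _, _, _, f, U => ContinuousOn f U ∧
      ∃ df : E × E → F, (∀ x ∈ U, ∀ y : E, HasVelocity (fun t : ℝ => f (x + t • y)) (df (x, y))) ∧
        BastianiC n df (U ×ˢ Set.univ)

/-- Smoothness in the sense of Michal-Bastiani. -/
def BastianiSmooth {E : Type u} [AddCommGroup E] [Module ℝ E] [TopologicalSpace E]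
    {F : Type v} [AddCommGroup F] [Module ℝ F] [TopologicalSpace F] (f : E → F) (U : Set E) : Prop :=
  ∀ n : ℕ, BastianiC n f U

variable (E : Type u) [AddCommGroup E] [Module ℝ E] [TopologicalSpace E]
variable (H : Type w) [Group H] [TopologicalSpace H] [ChartedSpace E H]

/-- `H` is a (Hausdorff) Lie group modelled on the locally convex space `E`: the changes of charts,
the multiplication and the inversion are smooth in the charts of the atlas. -/
structure IsLocallyConvexLieGroup : Prop where
  t2 : T2Space H
  topologicalGroup : IsTopologicalGroup H
  smooth_transition : ∀ e ∈ atlas E H, ∀ e' ∈ atlas E H,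
    BastianiSmooth (fun x : E => e' (e.symm x)) {x | x ∈ e.target ∧ e.symm x ∈ e'.source}
  smooth_mul : ∀ e₁ ∈ atlas E H, ∀ e₂ ∈ atlas E H, ∀ e₃ ∈ atlas E H,
    BastianiSmooth (fun p : E × E => e₃ (e₁.symm p.1 * e₂.symm p.2))
      {p | p.1 ∈ e₁.target ∧ p.2 ∈ e₂.target ∧ e₁.symm p.1 * e₂.symm p.2 ∈ e₃.source}
  smooth_inv : ∀ e₁ ∈ atlas E H, ∀ e₂ ∈ atlas E H,
    BastianiSmooth (fun x : E => e₂ ((e₁.symm x)⁻¹))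
      {x | x ∈ e₁.target ∧ (e₁.symm x)⁻¹ ∈ e₂.source}

variable {E H}

/-- The curve through the identity of `H` that is the straight line in direction `x` in the
preferred chart at the identity. This chart identifies the tangent space at the identity with `E`. -/
def lineCurve (H : Type w) [Group H] [TopologicalSpace H] [ChartedSpace E H] (x : E) (t : ℝ) : H :=
  (chartAt E (1 : H)).symm (chartAt E (1 : H) 1 + t • x)

/-- `Ad` is the adjoint action of `H` on its tangent space `E` at the identity:
`Ad g x` is the derivative at `t = 0` of `g γ(t) g⁻¹`, where `γ` is a curve with `γ(0) = 1` and
`γ'(0) = x`. -/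
def IsAdjointAction (Ad : H → E → E) : Prop :=
  ∀ (g : H) (x : E),
    HasVelocity (fun t : ℝ => chartAt E (1 : H) (g * lineCurve H x t * g⁻¹)) (Ad g x)

end Calculus

section LieAlgebraOf

variable {𝔥 : Type u} [LieRing 𝔥] [LieAlgebra ℝ 𝔥] [TopologicalSpace 𝔥]
variable {H : Type w} [Group H] [TopologicalSpace H] [ChartedSpace 𝔥 H]

/-- For a Lie group `H` modelled on (the locally convex space underlying) `𝔥`, with adjoint action
`Ad`, the Lie bracket of `H` on the tangent space at the identity, which is the derivative of `Ad`
at the identity, is the bracket of `𝔥`. -/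
def HasLieAlgebra (Ad : H → 𝔥 → 𝔥) : Prop :=
  ∀ x y : 𝔥, HasVelocity (fun t : ℝ => Ad (lineCurve H x t) y) ⁅x, y⁆

end LieAlgebraOf

/-! ### Unitary and projective unitary representations of Lie algebras -/

section Unitary

variable (𝓓 : Type v) [NormedAddCommGroup 𝓓] [InnerProductSpace ℂ 𝓓]

/-- The real Lie algebra `𝔲(𝓓)` of linear operators `X : 𝓓 → 𝓓` such that the adjoint of `X` is
defined on `𝓓` and equals `-X` there. -/
def skewOps : LieSubalgebra ℝ (Module.End ℂ 𝓓) where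
  carrier := {X | ∀ φ ψ : 𝓓, inner ℂ (X φ) ψ = - inner ℂ φ (X ψ)}
  add_mem' := by
    intro X Y hX hY φ ψ
    simp only [Set.mem_ofPred_eq] at hX hY
    simp [hX, hY, add_comm]
  zero_mem' := by intro φ ψ; simp
  smul_mem' := by
    intro r X hX φ ψ
    simp only [Set.mem_ofPred_eq] at hX
    simp only [LinearMap.smul_apply]
    rw [← Complex.coe_smul, ← Complex.coe_smul, inner_smul_left, inner_smul_right, hX]
    simp
  lie_mem' := by
    intro X Y hX hY φ ψ
    change ∀ φ ψ : 𝓓, inner ℂ (X φ) ψ = - inner ℂ φ (X ψ) at hX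
    change ∀ φ ψ : 𝓓, inner ℂ (Y φ) ψ = - inner ℂ φ (Y ψ) at hY
    simp [LieRing.of_associative_ring_bracket, hX, hY]

/-- The ideal `iℝ·I` of `𝔲(𝓓)`. -/
def imaginaryScalars : LieIdeal ℝ (skewOps 𝓓) where
  carrier := {X | ∃ r : ℝ, (X : Module.End ℂ 𝓓) = ((r : ℂ) * Complex.I) • 1}
  add_mem' := by
    rintro X Y ⟨r, hr⟩ ⟨s, hs⟩
    exact ⟨r + s, by simp [hr, hs, add_mul, add_smul]⟩
  zero_mem' := ⟨0, by simp⟩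
  smul_mem' := by
    rintro t X ⟨r, hr⟩
    refine ⟨t * r, ?_⟩
    change t • (X : Module.End ℂ 𝓓) = _
    rw [hr, ← Complex.coe_smul, smul_smul]
    simp [mul_assoc]
  lie_mem := by
    rintro X Y ⟨r, hr⟩
    refine ⟨0, ?_⟩
    simp only [LieSubalgebra.coe_bracket, hr, LieRing.of_associative_ring_bracket]
    simp

/-- `𝔭𝔲(𝓓) = 𝔲(𝓓) / iℝ·I`. -/
abbrev projSkewOps : Type v := skewOps 𝓓 ⧸ imaginaryScalars 𝓓

variable {𝓓}

/-- The infinitesimal action of `𝔭𝔲(𝓓)` at the ray through `ψ`, with values in the tangent space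
`𝓓 / ℂψ` of the projective space: the class of `X` is sent to the class of `X ψ`. -/
def rayAction (ψ : 𝓓) : projSkewOps 𝓓 →ₗ[ℝ] 𝓓 ⧸ (ℂ ∙ ψ) :=
  (imaginaryScalars 𝓓).toSubmodule.liftQ
    { toFun := fun X => (ℂ ∙ ψ).mkQ ((X : Module.End ℂ 𝓓) ψ)
      map_add' := by intro X Y; simp
      map_smul' := by intro r X; rfl }
    (by
      rintro X ⟨r, hr⟩
      change (ℂ ∙ ψ).mkQ ((X : Module.End ℂ 𝓓) ψ) = 0
      rw [hr, Submodule.mkQ_apply, Submodule.Quotient.mk_eq_zero]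
      exact Submodule.smul_mem _ _ (Submodule.mem_span_singleton_self ψ))

variable {𝔥 : Type u} [LieRing 𝔥] [LieAlgebra ℝ 𝔥] [TopologicalSpace 𝔥]

/-- Continuity of a unitary representation: all maps `ξ ↦ π(ξ)ψ` are continuous. -/
def IsContinuousRep (π : 𝔥 →ₗ⁅ℝ⁆ skewOps 𝓓) : Prop :=
  ∀ ψ : 𝓓, Continuous fun ξ : 𝔥 => (π ξ : Module.End ℂ 𝓓) ψ

/-- Continuity of a projective unitary representation: for every ray `[ψ]`, the map
`ξ ↦ π(ξ)[ψ]` to the tangent space of the projective space at `[ψ]` is continuous. -/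
def IsContinuousProjRep (π : 𝔥 →ₗ⁅ℝ⁆ projSkewOps 𝓓) : Prop :=
  ∀ ψ : 𝓓, ψ ≠ 0 → Continuous fun ξ : 𝔥 => rayAction ψ (π ξ)

/-- `π` is of generalized positive energy at `ξ`: there are a `1`-connected Lie group `H` with Lie
algebra `𝔥` and a dense subspace `𝓓₀` such that `⟨ψ, -i π(Ad_g ξ) ψ⟩` (a real number) is bounded
below in `g ∈ H` for every `ψ ∈ 𝓓₀`. -/
def IsGPE (π : 𝔥 →ₗ⁅ℝ⁆ skewOps 𝓓) (ξ : 𝔥) : Prop :=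
  ∃ (H : Type w) (_ : Group H) (_ : TopologicalSpace H) (_ : ChartedSpace 𝔥 H)
    (Ad : H → 𝔥 → 𝔥) (𝓓₀ : Submodule ℂ 𝓓),
    IsLocallyConvexLieGroup 𝔥 H ∧ SimplyConnectedSpace H ∧
    IsAdjointAction Ad ∧ HasLieAlgebra Ad ∧ Dense (𝓓₀ : Set 𝓓) ∧
    ∀ ψ ∈ 𝓓₀, BddBelow (Set.range fun g : H =>
      (inner ℂ ψ ((-Complex.I) • (π (Ad g ξ) : Module.End ℂ 𝓓) ψ)).re)

/-- Scalar `2`-cocycles of the Lie algebra `𝔥`. -/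
abbrev ScalarCocycle (𝔥 : Type u) [LieRing 𝔥] [LieAlgebra ℝ 𝔥] :=
  LieModule.Cohomology.twoCocycle ℝ 𝔥 (TrivialLieModule ℝ 𝔥 ℝ)

/-- Joint continuity of a scalar `2`-cocycle. -/
def IsContinuousCocycle (ω : ScalarCocycle 𝔥) : Prop :=
  Continuous fun p : 𝔥 × 𝔥 => TrivialLieModule.equiv ℝ 𝔥 ℝ (ω.1 p.1 p.2)

/-- The element `(ξ, z)` of the central extension of `𝔥` by `ℝ` defined by `ω`. -/
def centralMk (ω : ScalarCocycle 𝔥) (ξ : 𝔥) (z : ℝ) : LieAlgebra.ofTwoCocycle ω :=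
  LieAlgebra.ofProd ω (ξ, (TrivialLieModule.equiv ℝ 𝔥 ℝ).symm z)

/-- The central extension carries the product topology of `𝔥 × ℝ`. -/
instance centralTopology (ω : ScalarCocycle 𝔥) : TopologicalSpace (LieAlgebra.ofTwoCocycle ω) :=
  TopologicalSpace.induced
    (fun x => (x.carrier.1, TrivialLieModule.equiv ℝ 𝔥 ℝ x.carrier.2)) inferInstance

/-- `π` is a lift of the projective unitary representation `πbar` to the continuous central
extension of `𝔥` by `ℝ` defined by `ω`: a continuous unitary representation that sends the central
generator to `i·I` and covers `πbar`. -/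
structure IsLift (πbar : 𝔥 →ₗ⁅ℝ⁆ projSkewOps 𝓓) (ω : ScalarCocycle 𝔥)
    (π : LieAlgebra.ofTwoCocycle ω →ₗ⁅ℝ⁆ skewOps 𝓓) : Prop where
  continuous_cocycle : IsContinuousCocycle ω
  continuous_rep : IsContinuousRep π
  central : (π (centralMk ω 0 1) : Module.End ℂ 𝓓) = Complex.I • 1
  covers : ∀ (ξ : 𝔥) (z : ℝ), LieSubmodule.Quotient.mk (π (centralMk ω ξ z)) = πbar ξ

/-- A projective unitary representation is of generalized positive energy at `ξ` if a lift of it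
is of generalized positive energy at some element over `ξ`. -/
def IsProjGPE (πbar : 𝔥 →ₗ⁅ℝ⁆ projSkewOps 𝓓) (ξ : 𝔥) : Prop :=
  ∃ (ω : ScalarCocycle 𝔥) (π : LieAlgebra.ofTwoCocycle ω →ₗ⁅ℝ⁆ skewOps 𝓓) (z : ℝ),
    IsLift πbar ω π ∧ IsGPE.{u, v, w} π (centralMk ω ξ z)

end Unitary

/-! ### Jets and formal vector fields -/

section Jets

variable {ι : Type*} {V : Type*} [AddCommGroup V] [Module ℝ V]

/-- The Lie algebra `R ⊗ 𝔨` of formal power series with coefficients in `𝔨`, where `R` is the ring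
of formal power series in coordinates indexed by `ι`. -/
abbrev JetAlg (ι : Type*) (𝔨 : Type*) [LieRing 𝔨] [LieAlgebra ℝ 𝔨] : Type _ :=
  MvPowerSeries ι ℝ ⊗[ℝ] 𝔨

variable {𝔨 : Type*} [LieRing 𝔨] [LieAlgebra ℝ 𝔨]

/-- The coefficient in `𝔨` of `ξ ∈ R ⊗ 𝔨` at the monomial with exponent `n`. -/
def jetCoeff (n : ι →₀ ℕ) : JetAlg ι 𝔨 →ₗ[ℝ] 𝔨 :=
  (TensorProduct.lid ℝ 𝔨).toLinearMap ∘ₗ LinearMap.rTensor 𝔨 (MvPowerSeries.coeff (R := ℝ) n)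

/-- The product topology on `R ⊗ 𝔨`: the topology of convergence of all coefficients. -/
instance jetTopology [TopologicalSpace 𝔨] : TopologicalSpace (JetAlg ι 𝔨) :=
  TopologicalSpace.induced (fun ξ (n : ι →₀ ℕ) => jetCoeff n ξ) inferInstance

/-- The evaluation `R ⊗ 𝔨 → 𝔨` at the origin. -/
def jetEval : JetAlg ι 𝔨 →ₗ⁅ℝ⁆ 𝔨 :=
  { (jetCoeff 0 : JetAlg ι 𝔨 →ₗ[ℝ] 𝔨) with
    map_lie' := by
      intro x y
      induction x using TensorProduct.induction_on with
      | zero => simp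
      | add x₁ x₂ h₁ h₂ => simp_all [add_lie]
      | tmul f X =>
        induction y using TensorProduct.induction_on with
        | zero => simp
        | add y₁ y₂ h₁ h₂ => simp_all [lie_add]
        | tmul g Y => simp [jetCoeff, smul_smul, mul_comm] }

/-- The linear function `φ ∈ V*` as a formal power series in the coordinates given by `b`. -/
def linearSeries [Fintype ι] (b : Module.Basis ι ℝ V) :
    Module.Dual ℝ V →ₗ[ℝ] MvPowerSeries ι ℝ where
  toFun φ := ∑ i, φ (b i) • MvPowerSeries.X i
  map_add' := by intro φ ψ; simp [add_smul, Finset.sum_add_distrib]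
  map_smul' := by intro r φ; simp [mul_smul, Finset.smul_sum]

/-- The ideal `R W^⊥` of `R` generated by the annihilator in `V*` of a subspace `W` of `V`. -/
def annihilatorIdeal [Fintype ι] (b : Module.Basis ι ℝ V) (W : Submodule ℝ V) :
    Ideal (MvPowerSeries ι ℝ) :=
  Ideal.span (linearSeries b '' (W.dualAnnihilator : Set (Module.Dual ℝ V)))

/-- The restriction of the `i`-th coordinate of `V` to the subspace `W`, as a formal power series
on `W`. -/
def restrictedCoordinate {κ : Type*} [Fintype κ] (b : Module.Basis ι ℝ V) {W : Submodule ℝ V}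
    (c : Module.Basis κ ℝ W) (i : ι) : MvPowerSeries κ ℝ :=
  linearSeries c (b.coord i ∘ₗ W.subtype)

lemma hasSubst_restrictedCoordinate {κ : Type*} [Fintype ι] [Fintype κ] (b : Module.Basis ι ℝ V)
    {W : Submodule ℝ V} (c : Module.Basis κ ℝ W) :
    MvPowerSeries.HasSubst (restrictedCoordinate b c) :=
  MvPowerSeries.hasSubst_of_constantCoeff_zero fun i => by
    simp [restrictedCoordinate, linearSeries]

/-- Restriction of formal power series from `V` to the subspace `W`. -/
def restrictSeries {κ : Type*} [Fintype ι] [Fintype κ] (b : Module.Basis ι ℝ V)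
    {W : Submodule ℝ V} (c : Module.Basis κ ℝ W) : MvPowerSeries ι ℝ →ₐ[ℝ] MvPowerSeries κ ℝ :=
  MvPowerSeries.substAlgHom (hasSubst_restrictedCoordinate b c)

/-- Restriction `ℝ⟦V*⟧ ⊗ 𝔨 → ℝ⟦W*⟧ ⊗ 𝔨` of `𝔨`-valued formal power series. -/
def restrictJet {κ : Type*} [Fintype ι] [Fintype κ] (b : Module.Basis ι ℝ V)
    {W : Submodule ℝ V} (c : Module.Basis κ ℝ W) (𝔨 : Type*) [LieRing 𝔨] [LieAlgebra ℝ 𝔨] :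
    JetAlg ι 𝔨 →ₗ⁅ℝ⁆ JetAlg κ 𝔨 :=
  LieAlgebra.ExtendScalars.map (restrictSeries b c) LieHom.id

/-- The Lie derivative `L_v = ∑ i, v i ∂_i` on `R` along the formal vector field with components
`v i`. -/
def lieDer [Fintype ι] (v : ι → MvPowerSeries ι ℝ) :
    Derivation ℝ (MvPowerSeries ι ℝ) (MvPowerSeries ι ℝ) :=
  ∑ i, v i • MvPowerSeries.pderiv ℝ i

/-- The linear vector field on `V` defined by the endomorphism `A`. -/
def linearField [Fintype ι] [DecidableEq ι] (b : Module.Basis ι ℝ V) (A : Module.End ℝ V) :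
    ι → MvPowerSeries ι ℝ :=
  fun i => ∑ j, LinearMap.toMatrix b b A i j • MvPowerSeries.X j

/-- The linearization at the origin of a formal vector field. -/
def linearPart [Fintype ι] [DecidableEq ι] (b : Module.Basis ι ℝ V) (v : ι → MvPowerSeries ι ℝ) :
    Module.End ℝ V :=
  Matrix.toLin b b
    (Matrix.of fun i j => MvPowerSeries.coeff (R := ℝ) (Finsupp.single j 1) (v i))

/-- The higher order part of a formal vector field vanishing at the origin. -/
def higherOrderPart [Fintype ι] [DecidableEq ι] (b : Module.Basis ι ℝ V)
    (v : ι → MvPowerSeries ι ℝ) : ι → MvPowerSeries ι ℝ :=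
  v - linearField b (linearPart b v)

/-- `A = S + N` is the Jordan decomposition over `ℂ` of the endomorphism `A` (the two parts of a
real endomorphism are real). -/
structure IsJordanDecomposition (A S N : Module.End ℝ V) : Prop where
  eq_add : A = S + N
  commute : Commute S N
  semisimple : Module.End.IsSemisimple (S.baseChange ℂ : Module.End ℂ (ℂ ⊗[ℝ] V))
  nilpotent : IsNilpotent N

/-- The span in `V_ℂ` of the generalized eigenspaces of `A` for the eigenvalues with zero real
part. -/
def complexCenterSpace (A : Module.End ℝ V) : Submodule ℂ (ℂ ⊗[ℝ] V) :=
  ⨆ μ ∈ {μ : ℂ | μ.re = 0},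
    Module.End.maxGenEigenspace (A.baseChange ℂ : Module.End ℂ (ℂ ⊗[ℝ] V)) μ

/-- The center subspace of `A`, the intersection of `V` with its complex version. -/
def centerSpace (A : Module.End ℝ V) : Submodule ℝ V :=
  ((complexCenterSpace A).restrictScalars ℝ).comap (TensorProduct.mk ℝ ℂ V 1)

/-- The derivation `-L_v + ad_σ` of `R ⊗ 𝔨`. -/
def jetDerivation [Fintype ι] (v : ι → MvPowerSeries ι ℝ) (σ : JetAlg ι 𝔨) :
    LieDerivation ℝ (JetAlg ι 𝔨) (JetAlg ι 𝔨) :=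
  - Lie.Derivation.ofDerivation 𝔨 (lieDer v) + LieDerivation.ad ℝ (JetAlg ι 𝔨) σ

/-- The action of the one-dimensional Lie algebra `ℝ` generated by a derivation. -/
def oneParamAction {𝔤 : Type*} [LieRing 𝔤] [LieAlgebra ℝ 𝔤] (D : LieDerivation ℝ 𝔤 𝔤) :
    ℝ →ₗ⁅ℝ⁆ LieDerivation ℝ 𝔤 𝔤 :=
  { LinearMap.toSpanSingleton ℝ (LieDerivation ℝ 𝔤 𝔤) D with
    map_lie' := by
      intro s t
      simp [LieRing.of_associative_ring_bracket, mul_comm] }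

/-- A semidirect sum of topological Lie algebras carries the product topology. -/
instance semidirectTopology {𝔤 𝔭 : Type*} [LieRing 𝔤] [LieAlgebra ℝ 𝔤] [LieRing 𝔭] [LieAlgebra ℝ 𝔭]
    [TopologicalSpace 𝔤] [TopologicalSpace 𝔭] (D : 𝔭 →ₗ⁅ℝ⁆ LieDerivation ℝ 𝔤 𝔤) :
    TopologicalSpace (LieAlgebra.SemiDirectSum 𝔤 𝔭 D) :=
  TopologicalSpace.induced (fun x => (x.left, x.right)) inferInstance

/-- The Lie algebra `(R ⊗ 𝔨) ⋊_D ℝ` with `D = -L_v + ad_σ`. -/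
abbrev JetSharp [Fintype ι] (v : ι → MvPowerSeries ι ℝ) (σ : JetAlg ι 𝔨) : Type _ :=
  LieAlgebra.SemiDirectSum (JetAlg ι 𝔨) ℝ (oneParamAction (jetDerivation v σ))

/-- The inclusion of `R ⊗ 𝔨` in `(R ⊗ 𝔨) ⋊_D ℝ`. -/
def jetIncl [Fintype ι] (v : ι → MvPowerSeries ι ℝ) (σ : JetAlg ι 𝔨) :
    JetAlg ι 𝔨 →ₗ⁅ℝ⁆ JetSharp v σ :=
  LieAlgebra.SemiDirectSum.inl (oneParamAction (jetDerivation v σ))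

/-- The generator `d = (0, 1)` of `(R ⊗ 𝔨) ⋊_D ℝ`. -/
def jetGenerator [Fintype ι] (v : ι → MvPowerSeries ι ℝ) (σ : JetAlg ι 𝔨) : JetSharp v σ :=
  LieAlgebra.SemiDirectSum.inr (oneParamAction (jetDerivation v σ)) 1

/-- A compact simple real Lie algebra: finite-dimensional, simple, with negative definite Killing
form. -/
structure IsCompactSimple (𝔨 : Type*) [LieRing 𝔨] [LieAlgebra ℝ 𝔨] : Prop where
  finite : Module.Finite ℝ 𝔨
  simple : LieAlgebra.IsSimple ℝ 𝔨
  killing_neg : ∀ X : 𝔨, X ≠ 0 → killingForm ℝ 𝔨 X X < 0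

end Jets

end JetGPE

end

/-! Suppose `⁅x, ⁅x, y⁆⁆ = 0`. Formally `Ad (exp (t x)) y = y + t ⁅x, y⁆`, so an expectation value
that is bounded below on the adjoint orbit of `y` is affine in `t ∈ ℝ` and bounded below, hence
constant: the expectation of `⁅x, y⁆` is zero (`functional_lie_eq_zero`). As this happens on a dense
subspace, polarization gives `π ⁅x, y⁆ = 0` (`IsGPE.map_lie_eq_zero`). The group `H` need not have
an exponential map; `exp (t x)` is replaced by the powers `γ(t/k) ^ k` of a line `γ` in a chart.
Their limit is controlled in finite dimension, because a continuous functional on the central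
extension factors through a finite-dimensional Lie quotient (`hasFiniteFactor_central`): continuous
functionals and cocycles see only finitely many coefficients of a jet.

Apply this to `x = g ⊗ H` with `0 ≠ H ∈ 𝔱` and to `y` over `d`. Since `σ` commutes with `g ⊗ H`, the
bracket `⁅x, y⁆` is `L_v g ⊗ H` up to a central term, and `⁅x, ⁅x, y⁆⁆` is the central element `β(g,
L_v g)`, where `β(f, g) = ω(f ⊗ H, g ⊗ H)`. So `L_v g ⊗ H` is in the kernel as soon as `β(g, L_v g)
= 0`.

The cocycle identity makes `L_v` skew for `β`, so `β` pairs generalized weights of `L_v` trivially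
unless their sum is zero. A linear function in `V_c^⊥` is a sum of one part with weights of positive
real part and one with weights of negative real part. On each of them `L_v` is invertible modulo
high order and `β` is isotropic, so each part is some `L_v g` with `β(g, L_v g) = 0`, up to high
order (`exists_lieDer_approximation`). The weights can be computed from the semisimple part `S`,
because `L_v - L_S` commutes with `L_S` and is nilpotent modulo every order.

Continuity removes the error term, simplicity of `𝔨` passes from `φ ⊗ H` to the whole ideal
(`mem_kernelIdeal_of_tmul`, `kernelIdeal`), and the factorization is obtained by pulling series back
along a projection of `V` onto `V_c`. -/

namespace JetGPE

/-! ### Curves in weakly topologized spaces -/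

section Velocity

variable {E : Type*} [AddCommGroup E] [Module ℝ E] [TopologicalSpace E]
variable {F : Type*} [AddCommGroup F] [Module ℝ F] [TopologicalSpace F]

/-- The topology of `E` is induced by the continuous linear functionals. -/
def HasWeakTopology (E : Type*) [AddCommGroup E] [Module ℝ E] [TopologicalSpace E] : Prop :=
  IsInducing fun (x : E) (L : E →L[ℝ] ℝ) => L x

/-- Testing limits on functionals lets the scalar mean value theorem do the work in the chain rule
below. -/
lemma HasWeakTopology.tendsto (hE : HasWeakTopology E) {α : Type*} {l : Filter α} {c : α → E}
    {x : E} (h : ∀ L : E →L[ℝ] ℝ, Tendsto (fun a => L (c a)) l (𝓝 (L x))) : Tendsto c l (𝓝 x) := by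
  rw [hE.tendsto_nhds_iff, tendsto_pi_nhds]
  exact h

lemma HasVelocity.congr {γ γ' : ℝ → E} {x : E} (h : HasVelocity γ x) (he : γ =ᶠ[𝓝 0] γ') :
    HasVelocity γ' x := by
  refine Tendsto.congr' ?_ h
  have h0 : γ 0 = γ' 0 := he.self_of_nhds
  filter_upwards [he.filter_mono nhdsWithin_le_nhds] with t ht
  rw [ht, h0]

lemma HasVelocity.unique [T2Space E] {γ : ℝ → E} {x y : E} (hx : HasVelocity γ x)
    (hy : HasVelocity γ y) : x = y :=
  tendsto_nhds_unique hx hy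

lemma hasVelocity_const (x : E) : HasVelocity (fun _ : ℝ => x) 0 := by
  simpa [HasVelocity] using tendsto_const_nhds

lemma hasVelocity_line [ContinuousAdd E] (x y : E) :
    HasVelocity (fun t : ℝ => x + t • y) y := by
  refine Tendsto.congr' ?_ tendsto_const_nhds
  filter_upwards [self_mem_nhdsWithin] with t ht
  have ht : t ≠ 0 := ht
  simp [smul_smul, ht]

lemma HasVelocity.prodMk {γ : ℝ → E} {γ' : ℝ → F} {x : E} {y : F} (hx : HasVelocity γ x)
    (hy : HasVelocity γ' y) : HasVelocity (fun t => (γ t, γ' t)) (x, y) := by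
  refine Tendsto.congr ?_ (hx.prodMk_nhds hy)
  intro t
  rfl

lemma HasVelocity.continuousAt [IsTopologicalAddGroup E] [ContinuousSMul ℝ E] {γ : ℝ → E} {x : E}
    (h : HasVelocity γ x) : ContinuousAt γ 0 := by
  rw [continuousAt_iff_punctured_nhds]
  have h1 : Tendsto (fun t : ℝ => t • (t⁻¹ • (γ t - γ 0)) + γ 0) (𝓝[≠] 0)
      (𝓝 ((0 : ℝ) • x + γ 0)) :=
    ((tendsto_nhdsWithin_of_tendsto_nhds tendsto_id).smul h).add tendsto_const_nhds
  rw [zero_smul, zero_add] at h1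
  refine h1.congr' ?_
  filter_upwards [self_mem_nhdsWithin] with t ht
  have ht : t ≠ 0 := ht
  simp [smul_smul, ht]

lemma HasVelocity.hasDerivAt {γ : ℝ → E} {x : E} (h : HasVelocity γ x)
    {G : Type*} [NormedAddCommGroup G] [NormedSpace ℝ G] (L : E →L[ℝ] G) :
    HasDerivAt (fun t => L (γ t)) (L x) 0 := by
  rw [hasDerivAt_iff_tendsto_slope]
  refine Tendsto.congr ?_ ((L.continuous.tendsto x).comp h)
  intro t
  simp [slope, vsub_eq_sub]

/-- `df` is a continuous directional derivative of `f` on `U`. -/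
structure IsDirDeriv (f : E → F) (df : E × E → F) (U : Set E) : Prop where
  velocity : ∀ x ∈ U, ∀ y : E, HasVelocity (fun t : ℝ => f (x + t • y)) (df (x, y))
  continuousOn : ContinuousOn df (U ×ˢ Set.univ)

/-- Two derivatives suffice: `Ad` is a first derivative of the multiplication, and its derivative in
the group variable is a second one. -/
lemma BastianiSmooth.exists_isDirDeriv {E : Type u} [AddCommGroup E] [Module ℝ E]
    [TopologicalSpace E] {F : Type v} [AddCommGroup F] [Module ℝ F] [TopologicalSpace F]
    {f : E → F} {U : Set E} (h : BastianiSmooth f U) :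
    ∃ (df : E × E → F) (ddf : (E × E) × E × E → F),
      IsDirDeriv f df U ∧ IsDirDeriv df ddf (U ×ˢ Set.univ) := by
  obtain ⟨-, df, h1, h2, ddf, h3, h4⟩ := h 2
  exact ⟨df, ddf, ⟨h1, h2⟩, ⟨h3, h4⟩⟩

lemma BastianiSmooth.continuousOn {E : Type u} [AddCommGroup E] [Module ℝ E]
    [TopologicalSpace E] {F : Type v} [AddCommGroup F] [Module ℝ F] [TopologicalSpace F]
    {f : E → F} {U : Set E} (h : BastianiSmooth f U) : ContinuousOn f U := h 0

/-- The chain rule along curves. -/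
theorem IsDirDeriv.comp_hasVelocity [IsTopologicalAddGroup E] [ContinuousSMul ℝ E]
    (hF : HasWeakTopology F) {f : E → F} {df : E × E → F} {U : Set E} (hf : IsDirDeriv f df U)
    (hU : IsOpen U) {c : ℝ → E} {w : E} (hc : HasVelocity c w) (h0 : c 0 ∈ U) :
    HasVelocity (fun t => f (c t)) (df (c 0, w)) := by
  refine hF.tendsto fun L => ?_
  intro N hN
  change ∀ᶠ t : ℝ in 𝓝[≠] 0, L (t⁻¹ • (f (c t) - f (c 0))) ∈ N
  set wt : ℝ → E := fun t => t⁻¹ • (c t - c 0) with hwt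
  have hdf : ContinuousAt (fun p : E × E => L (df p)) (c 0, w) :=
    L.continuous.continuousAt.comp
      (hf.continuousOn.continuousAt ((hU.prod isOpen_univ).mem_nhds ⟨h0, trivial⟩))
  -- Joint continuity at `(0, w)` gives a box, `|s| < δ` and direction in `Q`, on which `L (df ·)`
  -- stays in `N` and the segment stays in `U`.
  have hm : Continuous fun p : ℝ × E => (c 0 + p.1 • p.2, p.2) := by fun_prop
  have hm0 : (c 0 + (0 : ℝ) • w, w) = (c 0, w) := by simp
  have h1 : ∀ᶠ p : ℝ × E in 𝓝 (0, w), L (df (c 0 + p.1 • p.2, p.2)) ∈ N := by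
    have := hm.tendsto (0, w)
    simp only [hm0] at this
    exact this.eventually (hdf.eventually_mem hN)
  have h2 : ∀ᶠ p : ℝ × E in 𝓝 (0, w), c 0 + p.1 • p.2 ∈ U := by
    have := (continuous_fst.comp hm).tendsto (0, w)
    exact this.eventually_mem (hU.mem_nhds (by simpa using h0))
  obtain ⟨P, hP, Q, hQ, hPQ⟩ := eventually_prod_iff.mp
    (by simpa only [nhds_prod_eq] using h1.and h2)
  obtain ⟨δ, hδ, hδP⟩ := Metric.eventually_nhds_iff.mp hP
  have hsmall : ∀ᶠ t : ℝ in 𝓝[≠] 0, dist t 0 < δ :=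
    (Metric.eventually_nhds_iff.mpr ⟨δ, hδ, fun _ h => h⟩).filter_mono nhdsWithin_le_nhds
  filter_upwards [hsmall, hc.eventually hQ, self_mem_nhdsWithin] with t ht hQt ht0
  have ht0 : t ≠ 0 := ht0
  have hct : c t = c 0 + t • wt t := by simp [hwt, smul_smul, ht0]
  have key : ∀ r ∈ Set.Icc (0 : ℝ) 1, HasDerivAt (fun r : ℝ => L (f (c 0 + (r * t) • wt t)))
      (t * L (df (c 0 + (r * t) • wt t, wt t))) r := by
    intro r hr
    have hrt : dist (r * t) 0 < δ := by
      rw [dist_zero_right] at ht ⊢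
      rw [norm_mul, Real.norm_of_nonneg hr.1]
      nlinarith [norm_nonneg t, hr.2]
    have hrU := (hPQ (hδP hrt) hQt).2
    have := (hf.velocity _ hrU (wt t)).hasDerivAt L
    have h3 : HasDerivAt (fun ρ : ℝ => (ρ - r) * t) t r := by
      simpa using ((hasDerivAt_id r).sub_const r).mul_const t
    have h4 := HasDerivAt.scomp (h := fun ρ : ℝ => (ρ - r) * t) r (by simpa using this) h3
    refine h4.congr_of_eventuallyEq (Eventually.of_forall fun ρ => ?_)
    simp only [Function.comp_apply]
    congr 2
    rw [add_assoc, ← add_smul]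
    congr 2
    ring
  -- Mean value theorem on the segment from `c 0` to `c t`: the difference quotient is a value of `L
  -- ∘ df` inside the box.
  obtain ⟨r, hr, hreq⟩ := exists_hasDerivAt_eq_slope
    (fun r : ℝ => L (f (c 0 + (r * t) • wt t))) _ zero_lt_one
    (fun r hr => (key r hr).continuousAt.continuousWithinAt)
    (fun r hr => key r (Set.Ioo_subset_Icc_self hr))
  have hrt : dist (r * t) 0 < δ := by
    rw [dist_zero_right] at ht ⊢
    rw [norm_mul, Real.norm_of_nonneg hr.1.le]
    nlinarith [norm_nonneg t, hr.2]
  have hN' := (hPQ (hδP hrt) hQt).1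
  simp only [one_mul, ← hct, zero_mul, zero_smul, add_zero, sub_zero, div_one] at hreq
  rw [map_smul, map_sub, ← hreq, smul_eq_mul, ← mul_assoc, inv_mul_cancel₀ ht0, one_mul]
  exact hN'

end Velocity

/-! ### The adjoint action in charts -/

section AdjointAction

section Charts

variable {E : Type u} [TopologicalSpace E] {H : Type w} [Group H] [TopologicalSpace H]

/-- The multiplication in charts. -/
def mulChart (e₁ e₂ e₃ : OpenPartialHomeomorph H E) (p : E × E) : E :=
  e₃ (e₁.symm p.1 * e₂.symm p.2)

/-- The domain of the multiplication in charts. -/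
def mulDom (e₁ e₂ e₃ : OpenPartialHomeomorph H E) : Set (E × E) :=
  {p | p.1 ∈ e₁.target ∧ p.2 ∈ e₂.target ∧ e₁.symm p.1 * e₂.symm p.2 ∈ e₃.source}

/-- The inversion in a chart. -/
def invChart (e : OpenPartialHomeomorph H E) (x : E) : E := e (e.symm x)⁻¹

/-- The domain of the inversion in a chart. -/
def invDom (e : OpenPartialHomeomorph H E) : Set E :=
  {x | x ∈ e.target ∧ (e.symm x)⁻¹ ∈ e.source}

lemma isOpen_mulDom [IsTopologicalGroup H] (e₁ e₂ e₃ : OpenPartialHomeomorph H E) :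
    IsOpen (mulDom e₁ e₂ e₃) := by
  have hc : ContinuousOn (fun p : E × E => e₁.symm p.1 * e₂.symm p.2) (e₁.target ×ˢ e₂.target) :=
    (e₁.continuousOn_symm.comp continuousOn_fst fun p hp => hp.1).mul
      (e₂.continuousOn_symm.comp continuousOn_snd fun p hp => hp.2)
  have := hc.isOpen_inter_preimage (e₁.open_target.prod e₂.open_target) e₃.open_source
  convert this using 1
  ext p
  simp [mulDom, and_assoc]

lemma isOpen_invDom [IsTopologicalGroup H] (e : OpenPartialHomeomorph H E) :
    IsOpen (invDom e) :=
  (e.continuousOn_symm.inv).isOpen_inter_preimage e.open_target e.open_source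

lemma eventually_mem_of_chart [ChartedSpace E H] {c : ℝ → E} (hc : ContinuousAt c 0)
    (h0 : c 0 = chartAt E (1 : H) 1) {s : Set H} (hs : s ∈ 𝓝 (1 : H)) :
    ∀ᶠ t in 𝓝 0, (chartAt E (1 : H)).symm (c t) ∈ s := by
  have h1 : ContinuousAt (chartAt E (1 : H)).symm (c 0) := by
    rw [h0]
    exact (chartAt E (1 : H)).continuousAt_symm (mem_chart_target E 1)
  have h2 := h1.comp hc
  refine h2.eventually_mem ?_
  simpa [h0, mem_chart_source] using hs

end Charts

variable {E : Type u} [AddCommGroup E] [Module ℝ E] [TopologicalSpace E]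
variable {H : Type w} [Group H] [TopologicalSpace H] [ChartedSpace E H]

lemma lineCurve_zero (x : E) : lineCurve H x 0 = 1 := by
  simp [lineCurve]

variable [IsTopologicalAddGroup E] [ContinuousSMul ℝ E]
variable (hE : HasWeakTopology E) (hH : IsLocallyConvexLieGroup E H)
variable {Ad : H → E → E} (hAd : IsAdjointAction Ad)

include hE hH in
-- Conjugation is left multiplication by `g` followed by right multiplication by `g⁻¹`. The charts
-- `e₁`, `e₂` are arbitrary, so that they can be chosen at `g`, or kept fixed at the identity while
-- `g` varies near it.
lemma hasVelocity_conj_aux {e₁ e₂ : OpenPartialHomeomorph H E} {g : H} (hg₁ : g ∈ e₁.source)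
    (hg₂ : g⁻¹ ∈ e₂.source) {dm₁ dm₂ : (E × E) × E × E → E}
    (h₁ : IsDirDeriv (mulChart e₁ (chartAt E (1 : H)) e₁) dm₁ (mulDom e₁ (chartAt E (1 : H)) e₁))
    (h₂ : IsDirDeriv (mulChart e₁ e₂ (chartAt E (1 : H))) dm₂ (mulDom e₁ e₂ (chartAt E (1 : H))))
    {c : ℝ → E} {w : E} (hc : HasVelocity c w) (h0 : c 0 = chartAt E (1 : H) 1) :
    HasVelocity (fun t => chartAt E (1 : H) (g * (chartAt E (1 : H)).symm (c t) * g⁻¹))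
      (dm₂ ((e₁ g, e₂ g⁻¹), (dm₁ ((e₁ g, chartAt E (1 : H) 1), (0, w)), 0))) := by
  have := hH.topologicalGroup
  set φ := chartAt E (1 : H)
  have hφ : (1 : H) ∈ φ.source := mem_chart_source E 1
  have ha := h₁.comp_hasVelocity hE (isOpen_mulDom _ _ _) ((hasVelocity_const (e₁ g)).prodMk hc)
    (by simp [mulDom, h0, hφ, hg₁])
  have ha0 : mulChart e₁ φ e₁ (e₁ g, c 0) = e₁ g := by simp [mulChart, h0, hφ, hg₁]
  have hb := h₂.comp_hasVelocity hE (isOpen_mulDom _ _ _)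
    (ha.prodMk (hasVelocity_const (e₂ g⁻¹))) (by simp [ha0, mulDom, hφ, hg₁, hg₂])
  rw [ha0, h0] at hb
  refine hb.congr ?_
  have hs : (fun k => g * k) ⁻¹' e₁.source ∈ 𝓝 (1 : H) :=
    (continuous_const_mul g).continuousAt.preimage_mem_nhds
      (e₁.open_source.mem_nhds (by simpa using hg₁))
  filter_upwards [eventually_mem_of_chart hc.continuousAt h0 hs] with t ht
  have ht : g * φ.symm (c t) ∈ e₁.source := ht
  simp [mulChart, hg₁, hg₂, ht]

variable [T2Space E]

include hE hH hAd in
/-- Conjugation by `g` acts on velocities at the identity by `Ad g`. -/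
lemma hasVelocity_conj (g : H) {c : ℝ → E} {w : E} (hc : HasVelocity c w)
    (h0 : c 0 = chartAt E (1 : H) 1) :
    HasVelocity (fun t => chartAt E (1 : H) (g * (chartAt E (1 : H)).symm (c t) * g⁻¹))
      (Ad g w) := by
  obtain ⟨dm₁, -, h₁, -⟩ := BastianiSmooth.exists_isDirDeriv
    (hH.smooth_mul _ (chart_mem_atlas E g) _ (chart_mem_atlas E 1) _ (chart_mem_atlas E g))
  obtain ⟨dm₂, -, h₂, -⟩ := BastianiSmooth.exists_isDirDeriv
    (hH.smooth_mul _ (chart_mem_atlas E g) _ (chart_mem_atlas E g⁻¹) _ (chart_mem_atlas E 1))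
  have key := fun {c : ℝ → E} {w : E} => hasVelocity_conj_aux hE hH (c := c) (w := w)
    (mem_chart_source E g) (mem_chart_source E g⁻¹) h₁ h₂
  -- The formula depends on the curve only through `w`, so comparison with the straight line
  -- identifies it as `Ad g w`.
  have h := (key (hasVelocity_line (chartAt E (1 : H) 1) w) (by simp)).unique (hAd g w)
  rw [← h]
  exact key hc h0

include hE hH hAd in
lemma adjointAction_mul (g k : H) (y : E) : Ad (g * k) y = Ad g (Ad k y) := by
  have := hH.topologicalGroup
  have h0 : chartAt E (1 : H) (k * lineCurve H y 0 * k⁻¹) = chartAt E (1 : H) 1 := by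
    simp [lineCurve_zero]
  have h := hasVelocity_conj hE hH hAd g (hAd k y) h0
  refine (hAd (g * k) y).unique (h.congr ?_)
  have hs : (fun q => k * q * k⁻¹) ⁻¹' (chartAt E (1 : H)).source ∈ 𝓝 (1 : H) := by
    have hcont : Continuous fun q : H => k * q * k⁻¹ := by fun_prop
    exact hcont.continuousAt.preimage_mem_nhds
      ((chartAt E (1 : H)).open_source.mem_nhds (by simp))
  have hl := (hasVelocity_line (chartAt E (1 : H) 1) y).continuousAt
  filter_upwards [eventually_mem_of_chart hl (by simp) hs] with t ht
  have ht : k * lineCurve H y t * k⁻¹ ∈ (chartAt E (1 : H)).source := ht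
  simp only [(chartAt E (1 : H)).left_inv ht]
  simp only [mul_assoc, mul_inv_rev]

include hE hH hAd in
-- `G` is the derivative in `g` of the formula in `hasVelocity_conj_aux`, with all charts at the
-- identity. It depends on `u` only through its velocity, which extends `HasLieAlgebra` from
-- straight lines to arbitrary curves.
lemma exists_hasVelocity_adjointAction (y : E) :
    ∃ G : E → E, ∀ (u : ℝ → E) (w : E), HasVelocity u w → u 0 = chartAt E (1 : H) 1 →
      HasVelocity (fun t => Ad ((chartAt E (1 : H)).symm (u t)) y) (G w) := by
  have := hH.topologicalGroup
  obtain ⟨dm, ddm, hm, hdm⟩ := BastianiSmooth.exists_isDirDeriv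
    (hH.smooth_mul _ (chart_mem_atlas E 1) _ (chart_mem_atlas E 1) _ (chart_mem_atlas E 1))
  obtain ⟨di, -, hi, -⟩ := BastianiSmooth.exists_isDirDeriv
    (hH.smooth_inv _ (chart_mem_atlas E 1) _ (chart_mem_atlas E 1))
  set φ := chartAt E (1 : H)
  have hφ : (1 : H) ∈ φ.source := mem_chart_source E 1
  refine ⟨fun w => ddm (((φ 1, φ 1), (dm ((φ 1, φ 1), (0, y)), 0)),
    ((w, di (φ 1, w)), (ddm (((φ 1, φ 1), (0, y)), ((w, 0), (0, 0))), 0))), ?_⟩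
  intro u w hu h0
  have hO : IsOpen (mulDom φ φ φ ×ˢ (Set.univ : Set (E × E))) :=
    (isOpen_mulDom φ φ φ).prod isOpen_univ
  have h1 : HasVelocity (fun t => dm ((u t, φ 1), (0, y))) _ := hdm.comp_hasVelocity hE hO
    ((hu.prodMk (hasVelocity_const (φ 1))).prodMk (hasVelocity_const ((0 : E), y)))
    (by simp [h0, hφ])
  have h2 : HasVelocity (fun t => invChart φ (u t)) _ := hi.comp_hasVelocity hE (isOpen_invDom φ)
    hu (by simp [h0, hφ])
  have hi0 : invChart φ (u 0) = φ 1 := by simp [invChart, h0, hφ]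
  have h3 := hdm.comp_hasVelocity hE hO
    ((hu.prodMk h2).prodMk (h1.prodMk (hasVelocity_const (0 : E))))
    (by simp [h0, hφ, show invChart φ (φ 1) = φ 1 by simp [invChart, hφ]])
  rw [hi0, h0] at h3
  refine h3.congr ?_
  have hs : (fun k : H => k⁻¹) ⁻¹' φ.source ∈ 𝓝 (1 : H) :=
    continuous_inv.continuousAt.preimage_mem_nhds (φ.open_source.mem_nhds (by simpa using hφ))
  have ht0 : ∀ᶠ t in 𝓝 0, u t ∈ φ.target :=
    hu.continuousAt.eventually_mem (φ.open_target.mem_nhds (by simp [h0, hφ]))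
  filter_upwards [eventually_mem_of_chart hu.continuousAt h0 hs, ht0] with t ht ht'
  have ht : (φ.symm (u t))⁻¹ ∈ φ.source := ht
  have := hasVelocity_conj_aux hE hH (φ.map_target ht') ht hm hm
    (hasVelocity_line (φ 1) y) (by simp [φ])
  simpa [φ.right_inv ht', invChart] using this.unique (hAd (φ.symm (u t)) y)

end AdjointAction

section LieAlgebraOf

variable {E : Type u} [LieRing E] [LieAlgebra ℝ E] [TopologicalSpace E]
variable {H : Type w} [Group H] [TopologicalSpace H] [ChartedSpace E H]
variable [IsTopologicalAddGroup E] [ContinuousSMul ℝ E] [T2Space E]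
variable (hE : HasWeakTopology E) (hH : IsLocallyConvexLieGroup E H)
variable {Ad : H → E → E} (hAd : IsAdjointAction Ad) (hLie : HasLieAlgebra Ad)

include hE hH hAd hLie

lemma hasVelocity_adjointAction (y : E) {u : ℝ → E} {w : E} (hu : HasVelocity u w)
    (h0 : u 0 = chartAt E (1 : H) 1) :
    HasVelocity (fun t => Ad ((chartAt E (1 : H)).symm (u t)) y) ⁅w, y⁆ := by
  obtain ⟨G, hG⟩ := exists_hasVelocity_adjointAction hE hH hAd y
  have h : G w = ⁅w, y⁆ :=
    (hG _ w (hasVelocity_line (chartAt E (1 : H) 1) w) (by simp)).unique (hLie w y)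
  rw [← h]
  exact hG u w hu h0

/-- The adjoint action along a straight line `γ` in the chart solves the linear differential
equation defined by the logarithmic derivative `δ` of `γ`. -/
theorem exists_logarithmicDerivative (x : E) :
    ∃ δ : ℝ → E, ContinuousAt δ 0 ∧ δ 0 = x ∧ ∀ᶠ s in 𝓝 (0 : ℝ), ∀ y : E,
      HasVelocity (fun r => Ad (lineCurve H x (s + r)) y) ⁅δ s, Ad (lineCurve H x s) y⁆ := by
  have := hH.topologicalGroup
  obtain ⟨dm, -, hm, -⟩ := BastianiSmooth.exists_isDirDeriv
    (hH.smooth_mul _ (chart_mem_atlas E 1) _ (chart_mem_atlas E 1) _ (chart_mem_atlas E 1))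
  have hi : ContinuousOn (invChart (chartAt E (1 : H))) (invDom (chartAt E (1 : H))) :=
    BastianiSmooth.continuousOn (hH.smooth_inv _ (chart_mem_atlas E 1) _ (chart_mem_atlas E 1))
  set φ := chartAt E (1 : H) with hφdef
  have hφ : (1 : H) ∈ φ.source := mem_chart_source E 1
  have hl : Continuous fun s : ℝ => φ 1 + s • x := by fun_prop
  have hi0 : ContinuousAt (fun s : ℝ => invChart φ (φ 1 + s • x)) 0 := by
    refine ContinuousAt.comp (g := invChart φ) ?_ hl.continuousAt
    exact hi.continuousAt ((isOpen_invDom φ).mem_nhds (by simp [invDom, hφ]))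
  -- With `γ = lineCurve H x`, `δ s` is the velocity at `r = 0` of `γ(s + r) γ(s)⁻¹`, the
  -- multiplication being differentiated in its first argument.
  refine ⟨fun s => dm ((φ 1 + s • x, invChart φ (φ 1 + s • x)), (x, 0)), ?_, ?_, ?_⟩
  · have h1 : ContinuousAt (fun s : ℝ => ((φ 1 + s • x, invChart φ (φ 1 + s • x)), (x, (0 : E))))
        0 := (hl.continuousAt.prodMk hi0).prodMk continuousAt_const
    refine ContinuousAt.comp (g := dm) ?_ h1
    refine hm.continuousOn.continuousAt (((isOpen_mulDom φ φ φ).prod isOpen_univ).mem_nhds ?_)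
    simp [mulDom, invChart, hφ]
  · have h1 := hm.velocity (φ 1, φ 1) (by simp [hφ]) (x, 0)
    have h2 : HasVelocity (fun t : ℝ => φ 1 + t • x) x := hasVelocity_line _ _
    have h3 : invChart φ (φ 1 + (0 : ℝ) • x) = φ 1 := by simp [invChart, hφ]
    simp only [zero_smul, add_zero] at h3 ⊢
    rw [h3]
    refine h1.unique (h2.congr ?_)
    have ht0 : ∀ᶠ t : ℝ in 𝓝 0, φ 1 + t • x ∈ φ.target :=
      hl.continuousAt.eventually_mem (φ.open_target.mem_nhds (by simp [hφ]))
    filter_upwards [ht0] with t ht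
    simp [hφ, ht]
  · have hs1 : ∀ᶠ s : ℝ in 𝓝 0, φ 1 + s • x ∈ invDom φ :=
      hl.continuousAt.eventually_mem ((isOpen_invDom φ).mem_nhds (by simp [invDom, hφ]))
    filter_upwards [hs1] with s hs y
    have hp0 : (φ 1 + s • x, invChart φ (φ 1 + s • x)) ∈ mulDom φ φ φ := by
      simp [mulDom, invChart, hs.1, hs.2, hφ]
    have hu : HasVelocity (fun r : ℝ => mulChart φ φ φ
        ((φ 1 + s • x, invChart φ (φ 1 + s • x)) + r • ((x, 0) : E × E))) _ :=
      hm.velocity _ hp0 (x, 0)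
    -- Here `Ad (γ(s + r)) = Ad (γ(s + r) γ(s)⁻¹) ∘ Ad (γ(s))`, and the first factor runs along a
    -- curve through the identity.
    refine (hasVelocity_adjointAction hE hH hAd hLie (Ad (lineCurve H x s) y) hu ?_).congr ?_
    · simp [mulChart, invChart, hs.2, ← hφdef]
    · have hO := (isOpen_mulDom φ φ φ).mem_nhds hp0
      have hcont : Continuous fun r : ℝ =>
          (φ 1 + s • x, invChart φ (φ 1 + s • x)) + r • ((x, 0) : E × E) := by fun_prop
      have hev := hcont.continuousAt.eventually_mem (x := 0) (by simpa using hO)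
      filter_upwards [hev] with r hr
      rw [← adjointAction_mul hE hH hAd]
      congr 1
      have hr2 := hr.2.2
      simp only [Prod.smul_mk, smul_zero, Prod.mk_add_mk, add_zero] at hr2
      simp only [mulChart, Prod.smul_mk, smul_zero, Prod.mk_add_mk, add_zero]
      rw [← hφdef, φ.left_inv hr2]
      simp [invChart, hs.2, lineCurve, add_smul, add_assoc, ← hφdef]

end LieAlgebraOf

/-! ### Linear functionals that are bounded below on adjoint orbits -/

section EulerScheme

variable {E F : Type*} [NormedAddCommGroup F] [NormedSpace ℝ F]

/-- The Euler scheme of a linear vector field `B`, started at a point annihilated by `B ^ 2`. -/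
lemma norm_iterate_sub_le {p : E → F} {A : E → E} {B : F →L[ℝ] F} {ε s C L : ℝ} (hε : 0 ≤ ε)
    (hs : 0 ≤ s) (hL : ‖B‖ + ε ≤ L) (hA : ∀ y, ‖p (A y) - p y - s • B (p y)‖ ≤ ε * s * ‖p y‖)
    {y : E} (hy : B (B (p y)) = 0) (k : ℕ) (hC : ‖p y‖ + k * s * ‖B (p y)‖ ≤ C) :
    ‖p (A^[k] y) - (p y + (k * s) • B (p y))‖ ≤ ε * C * (k * s) * (1 + s * L) ^ k := by
  induction k with
  | zero => simp
  | succ k ih =>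
    have hB : 0 ≤ ‖B (p y)‖ := norm_nonneg _
    have hC' : ‖p y‖ + k * s * ‖B (p y)‖ ≤ C := by
      push_cast at hC
      nlinarith [mul_nonneg hs hB]
    have hC0 : 0 ≤ C := le_trans (by positivity) hC'
    have hL0 : 0 ≤ L := le_trans (by positivity) hL
    specialize ih hC'
    rw [Function.iterate_succ_apply']
    set z := A^[k] y
    set e := p z - (p y + (k * s) • B (p y)) with he
    have hz : ‖p z‖ ≤ ‖e‖ + C := by
      have h1 : p z = e + (p y + (k * s) • B (p y)) := by rw [he]; abel
      rw [h1]
      refine (norm_add_le _ _).trans (add_le_add le_rfl ((norm_add_le _ _).trans ?_))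
      rw [norm_smul, Real.norm_of_nonneg (by positivity)]
      exact hC'
    -- As `B (B (p y)) = 0`, an Euler step maps the line `p y + τ • B (p y)` exactly into itself.
    -- The new error is the one-step error plus `(1 + s B) e`.
    have hsplit : p (A z) - (p y + ((k + 1 : ℕ) * s) • B (p y)) =
        (p (A z) - p z - s • B (p z)) + (e + s • B e) := by
      simp only [he, map_sub, map_add, map_smul, hy, smul_zero, add_zero, smul_sub]
      push_cast
      module
    have h1 : ‖e + s • B e‖ ≤ ‖e‖ + s * (‖B‖ * ‖e‖) := by
      refine (norm_add_le _ _).trans (add_le_add le_rfl ?_)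
      rw [norm_smul, Real.norm_of_nonneg hs]
      exact mul_le_mul_of_nonneg_left (B.le_opNorm e) hs
    have h2 : ‖p (A z) - p z - s • B (p z)‖ ≤ ε * s * (‖e‖ + C) :=
      (hA z).trans (mul_le_mul_of_nonneg_left hz (by positivity))
    have h3 : ‖p (A z) - (p y + ((k + 1 : ℕ) * s) • B (p y))‖ ≤
        (1 + s * L) * ‖e‖ + ε * s * C := by
      rw [hsplit]
      refine (norm_add_le _ _).trans ?_
      have : s * (‖B‖ + ε) * ‖e‖ ≤ s * L * ‖e‖ := by gcongr
      nlinarith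
    have h4 : (1 : ℝ) ≤ (1 + s * L) ^ (k + 1) := one_le_pow₀ (by nlinarith [mul_nonneg hs hL0])
    have h5 : 0 ≤ ε * s * C := by positivity
    calc _ ≤ (1 + s * L) * ‖e‖ + ε * s * C := h3
      _ ≤ (1 + s * L) * (ε * C * (k * s) * (1 + s * L) ^ k) + ε * s * C * (1 + s * L) ^ (k + 1) := by
        refine add_le_add (mul_le_mul_of_nonneg_left ih (by positivity)) ?_
        exact le_mul_of_one_le_right h5 h4
      _ = ε * C * ((k + 1 : ℕ) * s) * (1 + s * L) ^ (k + 1) := by push_cast; ring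

/-- Taking `k` steps of length `t / k`, the total error is at most `ε C t exp (t L)`, uniformly in
`k`. So `l` at the end of the exact flow, `p y + t • B (p y)`, inherits the lower bound as `ε` tends
to zero. -/
lemma le_of_forall_le_iterate {p : E → F} {A : ℝ → E → E} {B : F →L[ℝ] F}
    (hA : ∀ ε > 0, ∃ s₀ > 0, ∀ s, 0 ≤ s → s ≤ s₀ → ∀ y,
      ‖p (A s y) - p y - s • B (p y)‖ ≤ ε * s * ‖p y‖)
    {y : E} (hy : B (B (p y)) = 0) (l : F →L[ℝ] ℝ) {m : ℝ} (hm : ∀ s k, m ≤ l (p ((A s)^[k] y)))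
    {t : ℝ} (ht : 0 ≤ t) : m ≤ l (p y) + t * l (B (p y)) := by
  set C := ‖p y‖ + t * ‖B (p y)‖ with hC
  have hC0 : 0 ≤ C := by positivity
  set L := ‖B‖ + 1 with hL
  have hL0 : 0 ≤ L := by positivity
  set M := ‖l‖ * (C * t * Real.exp (t * L))
  have key : ∀ ε : ℝ, 0 < ε → ε ≤ 1 → m ≤ l (p y) + t * l (B (p y)) + ε * M := by
    intro ε hε hε1
    obtain ⟨s₀, hs₀, hs⟩ := hA ε hε
    obtain ⟨k, hk⟩ := exists_nat_gt (t / s₀)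
    have hk0 : (0 : ℝ) < k := lt_of_le_of_lt (by positivity) hk
    have hks : (k : ℝ) * (t / k) = t := by field_simp
    have h1 := norm_iterate_sub_le (A := A (t / k)) hε.le (by positivity) (L := L) (by linarith)
      (hs (t / k) (by positivity) (by
        rw [div_lt_iff₀ hs₀] at hk
        rw [div_le_iff₀ hk0]
        linarith)) hy k (C := C) (by rw [hks])
    rw [hks] at h1
    have h2 : (1 + t / k * L) ^ k ≤ Real.exp (t * L) := by
      have : 1 + t / k * L ≤ Real.exp (t / k * L) := by
        rw [add_comm]
        exact Real.add_one_le_exp _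
      refine (pow_le_pow_left₀ (by positivity) this k).trans ?_
      rw [← Real.exp_nat_mul, ← mul_assoc, hks]
    have h3 := l.le_opNorm (p ((A (t / k))^[k] y) - (p y + t • B (p y)))
    have h4 : ‖l‖ * ‖p ((A (t / k))^[k] y) - (p y + t • B (p y))‖ ≤ ε * M := by
      calc _ ≤ ‖l‖ * (ε * C * t * (1 + t / k * L) ^ k) := by gcongr
        _ ≤ ‖l‖ * (ε * C * t * Real.exp (t * L)) := by gcongr
        _ = _ := by simp only [M]; ring
    have h5 := (le_abs_self _).trans (h3.trans h4)
    rw [map_sub, map_add, map_smul, smul_eq_mul] at h5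
    linarith [hm (t / k) k]
  have hM : 0 ≤ M := by positivity
  refine le_of_forall_pos_le_add fun η hη => ?_
  have h := key (min 1 (η / (M + 1))) (by positivity) (min_le_left _ _)
  have : min 1 (η / (M + 1)) * M ≤ η := by
    calc _ ≤ η / (M + 1) * M := by gcongr; exact min_le_right _ _
      _ = η * (M / (M + 1)) := by ring
      _ ≤ η * 1 := by gcongr; rw [div_le_one (by positivity)]; linarith
      _ = η := mul_one η
  linarith

end EulerScheme

section Orbit

variable {E : Type u} [LieRing E] [LieAlgebra ℝ E] [TopologicalSpace E]
variable {H : Type w} [Group H] [TopologicalSpace H] [ChartedSpace E H]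
variable [IsTopologicalAddGroup E] [ContinuousSMul ℝ E] [T2Space E]
variable (hE : HasWeakTopology E) (hH : IsLocallyConvexLieGroup E H)
variable {Ad : H → E → E} (hAd : IsAdjointAction Ad) (hLie : HasLieAlgebra Ad)
variable {F : Type*} [NormedAddCommGroup F] [NormedSpace ℝ F]
variable (p : E →L[ℝ] F) (B : F →L[ℝ] F →L[ℝ] F) (hB : ∀ x y, p ⁅x, y⁆ = B (p x) (p y))

include hE hH hAd hLie

lemma adjointAction_one (y : E) : Ad 1 y = y := by
  have h := hasVelocity_adjointAction hE hH hAd hLie y (hasVelocity_const (chartAt E (1 : H) 1)) rfl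
  have h1 : HasVelocity (fun t : ℝ => chartAt E (1 : H) 1 + t • y) (Ad 1 y) := by
    refine (hAd 1 y).congr ?_
    have hc : Continuous fun t : ℝ => chartAt E (1 : H) 1 + t • y := by fun_prop
    have ht0 : ∀ᶠ t : ℝ in 𝓝 0, chartAt E (1 : H) 1 + t • y ∈ (chartAt E (1 : H)).target :=
      hc.continuousAt.eventually_mem ((chartAt E (1 : H)).open_target.mem_nhds (by simp))
    filter_upwards [ht0] with t ht
    simp [lineCurve, ht]
  exact h1.unique (hasVelocity_line _ _)

include hB

/-- The curve `z(r) = p (Ad (γ(r)) y)` solves `z' = B (p (δ r)) z` with `δ r` close to `x`, and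
Grönwall's inequality bounds its deviation from the first order expansion. The bound is relative to
`‖p y‖`, with `s₀` independent of `y`, as iteration requires. -/
lemma exists_norm_adjointAction_sub_le (x : E) {ε : ℝ} (hε : 0 < ε) :
    ∃ s₀ > 0, ∀ s, 0 ≤ s → s ≤ s₀ → ∀ y,
      ‖p (Ad (lineCurve H x s) y) - p y - s • B (p x) (p y)‖ ≤ ε * s * ‖p y‖ := by
  obtain ⟨δ, hδ, hδ0, hvel⟩ := exists_logarithmicDerivative hE hH hAd hLie x
  set K := ‖B (p x)‖ + 1 with hK
  have hK0 : 0 < K := by positivity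
  set η := min (ε / 6) 1 with hη
  have hη0 : 0 < η := by positivity
  have hBδ : ∀ᶠ s in 𝓝 (0 : ℝ), ‖B (p (δ s)) - B (p x)‖ < η := by
    have : ContinuousAt (fun s => B (p (δ s))) 0 :=
      (B.continuous.comp p.continuous).continuousAt.comp hδ
    rw [← hδ0]
    simpa [dist_eq_norm] using Metric.continuousAt_iff'.mp this η hη0
  obtain ⟨s₁, hs₁, hs₁'⟩ := Metric.eventually_nhds_iff.mp (hvel.and hBδ)
  -- `s₁ / 2` keeps `δ` close to `x`, `1 / K` gives `exp (K s) - 1 ≤ 2 K s`, and `ε / (6 K ^ 2)`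
  -- absorbs the second order term.
  refine ⟨min (s₁ / 2) (min (1 / K) (ε / (6 * K ^ 2))), by positivity, fun s hs0 hs y => ?_⟩
  have hsa := hs.trans (min_le_left _ _)
  have hsb := (hs.trans (min_le_right _ _)).trans (min_le_left _ _)
  have hsc := (hs.trans (min_le_right _ _)).trans (min_le_right _ _)
  have hin : ∀ r ∈ Set.Icc 0 s, dist r 0 < s₁ := by
    intro r hr
    rw [Real.dist_eq, sub_zero, abs_of_nonneg hr.1]
    linarith [hr.2]
  set z : ℝ → F := fun r => p (Ad (lineCurve H x r) y) with hz
  have hzd : ∀ r ∈ Set.Icc 0 s, HasDerivAt z (B (p (δ r)) (z r)) r := by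
    intro r hr
    have h1 := ((hs₁' (hin r hr)).1 y).hasDerivAt p
    rw [hB] at h1
    have h2 := HasDerivAt.scomp (h := fun ρ : ℝ => ρ - r) r (by simpa using h1)
      ((hasDerivAt_id r).sub_const r)
    simp only [one_smul] at h2
    refine h2.congr_of_eventuallyEq (Eventually.of_forall fun ρ => ?_)
    simp [hz]
  have hz0 : z 0 = p y := by
    simp [hz, lineCurve_zero, adjointAction_one hE hH hAd hLie y]
  set W : ℝ → F := fun r => z r - p y - r • B (p x) (p y) with hW
  have hWd : ∀ r ∈ Set.Icc 0 s, HasDerivAt W (B (p (δ r)) (z r) - B (p x) (p y)) r := by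
    intro r hr
    have := ((hzd r hr).sub_const (p y)).sub ((hasDerivAt_id r).smul_const (B (p x) (p y)))
    rw [one_smul] at this
    exact this
  have hbound : ∀ r ∈ Set.Ico 0 s,
      ‖B (p (δ r)) (z r) - B (p x) (p y)‖ ≤ K * ‖W r‖ + ε / 3 * ‖p y‖ := by
    intro r hr
    have hr' := Set.Ico_subset_Icc_self hr
    have hclose := (hs₁' (hin r hr')).2.le
    have hnorm : ‖B (p (δ r))‖ ≤ K := by
      have h := norm_add_le (B (p (δ r)) - B (p x)) (B (p x))
      rw [sub_add_cancel] at h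
      have : η ≤ 1 := min_le_right _ _
      linarith
    have hsplit : B (p (δ r)) (z r) - B (p x) (p y) =
        B (p (δ r)) (W r) + ((B (p (δ r)) - B (p x)) (p y) +
          r • B (p (δ r)) (B (p x) (p y))) := by
      simp only [hW, map_sub, map_smul, sub_apply]
      abel
    have hr2 : r ≤ ε / (6 * K ^ 2) := hr.2.le.trans hsc
    have t1 : ‖B (p (δ r)) (W r)‖ ≤ K * ‖W r‖ :=
      (B (p (δ r))).le_of_opNorm_le hnorm _
    have t2 : ‖(B (p (δ r)) - B (p x)) (p y)‖ ≤ ε / 6 * ‖p y‖ :=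
      ContinuousLinearMap.le_of_opNorm_le _ (hclose.trans (min_le_left _ _)) _
    have t3 : ‖r • B (p (δ r)) (B (p x) (p y))‖ ≤ ε / 6 * ‖p y‖ := by
      rw [norm_smul, Real.norm_of_nonneg hr.1]
      have h1 : ‖B (p (δ r)) (B (p x) (p y))‖ ≤ K * (K * ‖p y‖) := by
        refine ((B (p (δ r))).le_of_opNorm_le hnorm _).trans ?_
        refine mul_le_mul_of_nonneg_left ?_ hK0.le
        exact (B (p x)).le_of_opNorm_le (by linarith) _
      calc _ ≤ ε / (6 * K ^ 2) * (K * (K * ‖p y‖)) := mul_le_mul hr2 h1 (norm_nonneg _) (by positivity)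
        _ = _ := by field_simp
    rw [hsplit]
    refine (norm_add_le _ _).trans ?_
    linarith [norm_add_le ((B (p (δ r)) - B (p x)) (p y)) (r • B (p (δ r)) (B (p x) (p y)))]
  have hg := norm_le_gronwallBound_of_norm_deriv_right_le (δ := 0)
    (fun r hr => (hWd r hr).continuousAt.continuousWithinAt)
    (fun r hr => (hWd r (Set.Ico_subset_Icc_self hr)).hasDerivWithinAt)
    (by simp [hW, hz0]) hbound s ⟨hs0, le_rfl⟩
  rw [gronwallBound_of_K_ne_0 hK0.ne'] at hg
  simp only [sub_zero, zero_mul, zero_add] at hg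
  have hKs : |K * s| ≤ 1 := by
    rw [abs_of_nonneg (by positivity)]
    calc K * s ≤ K * (1 / K) := by gcongr
      _ = 1 := by field_simp
  have hexp := (le_abs_self _).trans (Real.abs_exp_sub_one_le hKs)
  rw [abs_of_nonneg (by positivity)] at hexp
  refine hg.trans ?_
  calc _ ≤ ε / 3 * ‖p y‖ / K * (2 * (K * s)) := by gcongr
    _ = 2 / 3 * (ε * s * ‖p y‖) := by field_simp
    _ ≤ ε * s * ‖p y‖ := by linarith [show 0 ≤ ε * s * ‖p y‖ by positivity]

/-- The iterates of `Ad (γ(s))` are `Ad (γ(s) ^ k)`, so the Euler scheme never leaves the adjoint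
orbit. -/
lemma le_add_smul_of_forall_le {x y : E} (hxy : ⁅x, ⁅x, y⁆⁆ = 0) (l : F →L[ℝ] ℝ) {m : ℝ}
    (hm : ∀ g : H, m ≤ l (p (Ad g y))) {t : ℝ} (ht : 0 ≤ t) : m ≤ l (p y) + t * l (p ⁅x, y⁆) := by
  rw [hB]
  refine le_of_forall_le_iterate (p := p) (A := fun s => Ad (lineCurve H x s))
    (fun ε hε => exists_norm_adjointAction_sub_le hE hH hAd hLie p B hB x hε)
    (by rw [← hB, ← hB, hxy, map_zero]) l ?_ ht
  intro s k
  have : ∀ k : ℕ, (Ad (lineCurve H x s))^[k] y = Ad (lineCurve H x s ^ k) y := by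
    intro k
    induction k with
    | zero => simp [adjointAction_one hE hH hAd hLie]
    | succ k ih =>
      rw [Function.iterate_succ_apply', ih, pow_succ', adjointAction_mul hE hH hAd]
  rw [this]
  exact hm _

/-- If a linear functional is bounded below on the adjoint orbit of `y`, then it vanishes at `⁅x, y⁆`
for every `x` such that `⁅x, ⁅x, y⁆⁆ = 0`. -/
theorem functional_lie_eq_zero {x y : E} (hxy : ⁅x, ⁅x, y⁆⁆ = 0) (l : F →L[ℝ] ℝ) {m : ℝ}
    (hm : ∀ g : H, m ≤ l (p (Ad g y))) : l (p ⁅x, y⁆) = 0 := by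
  have h1 := fun (t : ℝ) (ht : 0 ≤ t) =>
    le_add_smul_of_forall_le hE hH hAd hLie p B hB hxy l hm ht
  -- Replacing `x` by `-x` covers negative times.
  have h2 := fun (t : ℝ) (ht : 0 ≤ t) =>
    le_add_smul_of_forall_le hE hH hAd hLie p B hB (x := -x)
      (by rw [neg_lie, neg_lie, lie_neg, neg_neg, hxy]) l hm ht
  simp only [neg_lie, map_neg, mul_neg] at h2
  set a := l (p y)
  set c := l (p ⁅x, y⁆)
  by_contra hc
  have hc2 : 0 < c ^ 2 := by positivity
  have hma : m ≤ a := by simpa using h1 0 le_rfl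
  -- At this time the affine function, taken in its decreasing direction, has the value `m - 1`.
  have hT : 0 ≤ (a - m + 1) / |c| := by
    have : 0 ≤ a - m + 1 := by linarith
    positivity
  have e : (a - m + 1) / |c| * |c| = a - m + 1 := div_mul_cancel₀ _ (abs_ne_zero.mpr hc)
  rcases abs_cases c with ⟨h, -⟩ | ⟨h, -⟩
  · have := h2 _ hT
    rw [h] at this e
    linarith
  · have := h1 _ hT
    rw [h] at this e
    linarith

end Orbit

/-! ### Weak topologies -/

section WeakTopology

variable {E : Type*} [AddCommGroup E] [Module ℝ E] [TopologicalSpace E]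
variable {F : Type*} [AddCommGroup F] [Module ℝ F] [TopologicalSpace F]

lemma continuous_evaluations : Continuous fun (x : E) (L : E →L[ℝ] ℝ) => L x :=
  continuous_pi fun L => L.continuous

lemma HasWeakTopology.of_isInducing (hF : HasWeakTopology F) (q : E →ₗ[ℝ] F) (hq : IsInducing q) :
    HasWeakTopology E := by
  let R : ((E →L[ℝ] ℝ) → ℝ) → (F →L[ℝ] ℝ) → ℝ := fun a L => a (L.comp ⟨q, hq.continuous⟩)
  have hR : Continuous R := continuous_pi fun L => continuous_apply _
  exact IsInducing.of_comp continuous_evaluations hR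
    (show IsInducing (R ∘ _) from (show IsInducing _ from hF).comp hq)

lemma hasWeakTopology_real : HasWeakTopology ℝ :=
  IsInducing.of_comp continuous_evaluations (continuous_apply (ContinuousLinearMap.id ℝ ℝ))
    IsInducing.id

lemma HasWeakTopology.prod (hE : HasWeakTopology E) (hF : HasWeakTopology F) :
    HasWeakTopology (E × F) := by
  let R : ((E × F →L[ℝ] ℝ) → ℝ) → ((E →L[ℝ] ℝ) → ℝ) × ((F →L[ℝ] ℝ) → ℝ) := fun a =>
    (fun L => a (L.comp (ContinuousLinearMap.fst ℝ E F)),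
      fun L => a (L.comp (ContinuousLinearMap.snd ℝ E F)))
  have hR : Continuous R := (continuous_pi fun L => continuous_apply _).prodMk
    (continuous_pi fun L => continuous_apply _)
  exact IsInducing.of_comp continuous_evaluations hR (IsInducing.prodMap hE hF)

lemma HasWeakTopology.pi {ι : Type*} {E : ι → Type*} [∀ i, AddCommGroup (E i)]
    [∀ i, Module ℝ (E i)] [∀ i, TopologicalSpace (E i)] (hE : ∀ i, HasWeakTopology (E i)) :
    HasWeakTopology (∀ i, E i) := by
  let R : (((∀ i, E i) →L[ℝ] ℝ) → ℝ) → ∀ i, (E i →L[ℝ] ℝ) → ℝ := fun a i L =>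
    a (L.comp (ContinuousLinearMap.proj i))
  have hR : Continuous R := continuous_pi fun i => continuous_pi fun L => continuous_apply _
  exact IsInducing.of_comp continuous_evaluations hR (IsInducing.piMap hE)

lemma hasWeakTopology_of_finite [T2Space E] [IsTopologicalAddGroup E] [ContinuousSMul ℝ E]
    [Module.Finite ℝ E] : HasWeakTopology E := by
  let e : E ≃L[ℝ] (Fin (Module.finrank ℝ E) → ℝ) :=
    ContinuousLinearEquiv.ofFinrankEq (by simp)
  exact (HasWeakTopology.pi fun _ => hasWeakTopology_real).of_isInducing e.toLinearMap
    e.toHomeomorph.isInducing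

end WeakTopology

/-! ### Descent of brackets and functionals to finite-dimensional quotients. -/

section FiniteFactor

variable {E : Type*} [LieRing E] [LieAlgebra ℝ E] [TopologicalSpace E]
variable {F : Type*} [NormedAddCommGroup F] [NormedSpace ℝ F]

lemma exists_quasiInverse {K V W : Type*} [Field K] [AddCommGroup V] [Module K V] [AddCommGroup W]
    [Module K W] (p : V →ₗ[K] W) : ∃ s : W →ₗ[K] V, ∀ x, p (s (p x)) = p x := by
  obtain ⟨s₀, hs₀⟩ := p.rangeRestrict.exists_rightInverse_of_surjective p.range_rangeRestrict
  obtain ⟨s, hs⟩ := s₀.exists_extend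
  refine ⟨s, fun x => ?_⟩
  have h1 : s (p x) = s₀ (p.rangeRestrict x) := LinearMap.congr_fun hs (p.rangeRestrict x)
  rw [h1]
  exact congrArg Subtype.val (LinearMap.congr_fun hs₀ (p.rangeRestrict x))

/-- Since the kernel of `p` is an ideal, the bracket descends to the range of `p`. A quasi-inverse
extends it bilinearly to all of `F`, where continuity is automatic; it need not be a Lie bracket off
the range. -/
lemma exists_bracket_factor [FiniteDimensional ℝ F] (p : E →L[ℝ] F)
    (hp : ∀ x y : E, p x = 0 → p ⁅x, y⁆ = 0) :
    ∃ B : F →L[ℝ] F →L[ℝ] F, ∀ x y : E, p ⁅x, y⁆ = B (p x) (p y) := by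
  obtain ⟨s, hs⟩ := exists_quasiInverse p.toLinearMap
  have hs : ∀ x, p (s (p x)) = p x := hs
  let b : F →ₗ[ℝ] F →ₗ[ℝ] F := LinearMap.mk₂ ℝ (fun u w => p ⁅s u, s w⁆) (by simp) (by simp)
    (by simp) (by simp)
  refine ⟨LinearMap.toContinuousLinearMap
    (LinearMap.toContinuousLinearMap.toLinearMap ∘ₗ b), fun x y => ?_⟩
  change p ⁅x, y⁆ = p ⁅s (p x), s (p y)⁆
  have hp' : ∀ x y : E, p y = 0 → p ⁅x, y⁆ = 0 := by
    intro x y h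
    rw [← lie_skew, map_neg, hp y x h, neg_zero]
  have h1 := hp (x - s (p x)) y (by simp [hs])
  have h2 := hp' (s (p x)) (y - s (p y)) (by simp [hs])
  rw [sub_lie, map_sub, sub_eq_zero] at h1
  rw [lie_sub, map_sub, sub_eq_zero] at h2
  rw [h1, h2]

lemma exists_functional_factor [FiniteDimensional ℝ F] (p : E →L[ℝ] F) (l : E →L[ℝ] ℝ)
    (hl : ∀ x, p x = 0 → l x = 0) : ∃ l' : F →L[ℝ] ℝ, ∀ x, l x = l' (p x) := by
  obtain ⟨s, hs⟩ := exists_quasiInverse p.toLinearMap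
  have hs : ∀ x, p (s (p x)) = p x := hs
  refine ⟨LinearMap.toContinuousLinearMap (l.toLinearMap ∘ₗ s), fun x => ?_⟩
  change l x = l (s (p x))
  have := hl (x - s (p x)) (by simp [hs])
  rwa [map_sub, sub_eq_zero] at this

end FiniteFactor

/-- The functional `l` vanishes on the kernel of a continuous linear map to a finite-dimensional
space whose kernel is an ideal. -/
def HasFiniteFactor {E : Type*} [LieRing E] [LieAlgebra ℝ E] [TopologicalSpace E]
    (l : E →L[ℝ] ℝ) : Prop :=
  ∃ (d : ℕ) (p : E →L[ℝ] (Fin d → ℝ)), (∀ x y : E, p x = 0 → p ⁅x, y⁆ = 0) ∧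
    ∀ x, p x = 0 → l x = 0

section Orbit

variable {E : Type u} [LieRing E] [LieAlgebra ℝ E] [TopologicalSpace E]
variable {H : Type w} [Group H] [TopologicalSpace H] [ChartedSpace E H]
variable [IsTopologicalAddGroup E] [ContinuousSMul ℝ E] [T2Space E]

lemma HasFiniteFactor.apply_lie_eq_zero (hE : HasWeakTopology E)
    (hH : IsLocallyConvexLieGroup E H) {Ad : H → E → E} (hAd : IsAdjointAction Ad)
    (hLie : HasLieAlgebra Ad) {l : E →L[ℝ] ℝ} (hl : HasFiniteFactor l) {x y : E}
    (hxy : ⁅x, ⁅x, y⁆⁆ = 0) (hb : BddBelow (Set.range fun g : H => l (Ad g y))) :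
    l ⁅x, y⁆ = 0 := by
  obtain ⟨d, p, hp, hpl⟩ := hl
  obtain ⟨B, hB⟩ := exists_bracket_factor p hp
  obtain ⟨l', hl'⟩ := exists_functional_factor p l hpl
  obtain ⟨m, hm⟩ := hb
  rw [hl']
  refine functional_lie_eq_zero hE hH hAd hLie p B hB hxy l' (m := m) fun g => ?_
  rw [← hl']
  exact hm ⟨g, rfl⟩

end Orbit

/-! ### From expectation values to operators. -/

section Unitary

variable {𝓓 : Type v} [NormedAddCommGroup 𝓓] [InnerProductSpace ℂ 𝓓]

/-- A skew operator with vanishing expectation values on a dense subspace vanishes. -/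
lemma skewOps_eq_zero (X : skewOps 𝓓) {𝓓₀ : Submodule ℂ 𝓓} (hd : Dense (𝓓₀ : Set 𝓓))
    (h : ∀ ψ ∈ 𝓓₀, inner ℂ ψ ((X : Module.End ℂ 𝓓) ψ) = 0) : X = 0 := by
  have hX : ∀ φ ψ : 𝓓, inner ℂ ((X : Module.End ℂ 𝓓) φ) ψ =
    - inner ℂ φ ((X : Module.End ℂ 𝓓) ψ) := X.2
  set T : Module.End ℂ 𝓓 := (X : Module.End ℂ 𝓓)
  -- Complex polarization, with the vectors `φ + ψ` and `φ + iψ`.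
  have h0 : ∀ φ ∈ 𝓓₀, ∀ ψ ∈ 𝓓₀, inner ℂ φ (T ψ) = 0 := by
    intro φ hφ ψ hψ
    have h1 := h (φ + ψ) (add_mem hφ hψ)
    have h2 := h (φ + Complex.I • ψ) (add_mem hφ (𝓓₀.smul_mem _ hψ))
    simp only [map_add, map_smul, inner_add_left, inner_add_right, inner_smul_left,
      inner_smul_right, h φ hφ, h ψ hψ, Complex.conj_I] at h1 h2
    linear_combination (1 / 2) * h1 - Complex.I / 2 * h2 +
      (inner ℂ φ (T ψ) / 2 - inner ℂ ψ (T φ) / 2) * Complex.I_sq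
  have h1 : ∀ φ : 𝓓, ∀ ψ ∈ 𝓓₀, inner ℂ φ (T ψ) = 0 := by
    intro φ ψ hψ
    have hc : IsClosed {φ : 𝓓 | inner ℂ φ (T ψ) = 0} :=
      isClosed_eq (by fun_prop) continuous_const
    exact hc.closure_subset_iff.mpr (fun φ hφ => h0 φ hφ ψ hψ) (hd φ)
  have h2 : ∀ ψ ∈ 𝓓₀, T ψ = 0 := fun ψ hψ => inner_self_eq_zero.mp (h1 _ ψ hψ)
  apply Subtype.ext
  ext φ
  change T φ = 0
  -- `T` may be unbounded, so its vanishing on `𝓓₀` is carried to `φ` by skewness and density, not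
  -- by continuity of `T`.
  have hc : IsClosed {ψ : 𝓓 | inner ℂ (T φ) ψ = 0} :=
    isClosed_eq (by fun_prop) continuous_const
  have h3 : inner ℂ (T φ) (T φ) = 0 :=
    hc.closure_subset_iff.mpr (fun ψ hψ => by simp [hX, h2 ψ hψ]) (hd (T φ))
  exact inner_self_eq_zero.mp h3

variable {𝔥 : Type u} [LieRing 𝔥] [LieAlgebra ℝ 𝔥] [TopologicalSpace 𝔥]

/-- The expectation value of `-i π(ξ)` in the state `ψ`. -/
noncomputable def expectation (π : 𝔥 →ₗ⁅ℝ⁆ skewOps 𝓓) (hπ : IsContinuousRep π) (ψ : 𝓓) :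
    𝔥 →L[ℝ] ℝ where
  toFun ξ := (inner ℂ ψ ((-Complex.I) • (π ξ : Module.End ℂ 𝓓) ψ)).re
  map_add' ξ η := by simp [inner_neg_right]
  map_smul' r ξ := by
    have : ((π (r • ξ) : skewOps 𝓓) : Module.End ℂ 𝓓) ψ =
        (r : ℂ) • (π ξ : Module.End ℂ 𝓓) ψ := by
      rw [map_smul]; rfl
    rw [this, smul_comm, inner_smul_right]
    simp
  cont := by
    have := hπ ψ
    fun_prop

/-- By skewness the inner product is purely imaginary, so taking the real part after multiplication
by `-i` loses nothing. -/
lemma expectation_eq_zero_iff {π : 𝔥 →ₗ⁅ℝ⁆ skewOps 𝓓} {hπ : IsContinuousRep π} {ψ : 𝓓} {ξ : 𝔥} :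
    expectation π hπ ψ ξ = 0 ↔ inner ℂ ψ ((π ξ : Module.End ℂ 𝓓) ψ) = 0 := by
  have h1 : inner ℂ ((π ξ : Module.End ℂ 𝓓) ψ) ψ = - inner ℂ ψ ((π ξ : Module.End ℂ 𝓓) ψ) :=
    (π ξ).2 ψ ψ
  rw [← inner_conj_symm] at h1
  have h2 := congrArg Complex.re h1
  rw [Complex.conj_re, Complex.neg_re] at h2
  have h3 : (inner ℂ ψ ((π ξ : Module.End ℂ 𝓓) ψ)).re = 0 := by linarith
  have h4 : expectation π hπ ψ ξ = (inner ℂ ψ ((π ξ : Module.End ℂ 𝓓) ψ)).im := by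
    change (inner ℂ ψ ((-Complex.I) • (π ξ : Module.End ℂ 𝓓) ψ)).re = _
    rw [inner_smul_right]
    simp
  rw [h4, Complex.ext_iff]
  simp [h3]

/-- In a representation of generalized positive energy at `y`, an operator `π(⁅x, y⁆)` with
`⁅x, ⁅x, y⁆⁆ = 0` vanishes. -/
theorem IsGPE.map_lie_eq_zero [IsTopologicalAddGroup 𝔥] [ContinuousSMul ℝ 𝔥] [T2Space 𝔥]
    (hw : HasWeakTopology 𝔥) (hf : ∀ l : 𝔥 →L[ℝ] ℝ, HasFiniteFactor l)
    {π : 𝔥 →ₗ⁅ℝ⁆ skewOps 𝓓} (hπ : IsContinuousRep π) {x y : 𝔥} (h : IsGPE.{u, v, w} π y)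
    (hxy : ⁅x, ⁅x, y⁆⁆ = 0) : π ⁅x, y⁆ = 0 := by
  obtain ⟨H, _, _, _, Ad, 𝓓₀, hH, -, hAd, hLie, hd, hb⟩ := h
  refine skewOps_eq_zero _ hd fun ψ hψ => ?_
  rw [← expectation_eq_zero_iff (hπ := hπ)]
  exact (hf _).apply_lie_eq_zero hw hH hAd hLie hxy (hb ψ hψ)

end Unitary

/-! ### The order filtration -/

section OrderFiltration

variable {ι : Type*}

/-- The ideal of power series without terms of degree less than `k`. -/
def orderIdeal (ι : Type*) (k : ℕ) : Ideal (MvPowerSeries ι ℝ) where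
  carrier := {f | (k : ℕ∞) ≤ f.order}
  add_mem' {f g} hf hg := (le_min hf hg).trans (MvPowerSeries.min_order_le_add)
  zero_mem' := by simp
  smul_mem' f g hg := (le_trans hg le_add_self).trans MvPowerSeries.le_order_mul

lemma mem_orderIdeal_iff_le {k : ℕ} {f : MvPowerSeries ι ℝ} :
    f ∈ orderIdeal ι k ↔ (k : ℕ∞) ≤ f.order := Iff.rfl

lemma mem_orderIdeal_iff {k : ℕ} {f : MvPowerSeries ι ℝ} :
    f ∈ orderIdeal ι k ↔ ∀ d, d.degree < k → MvPowerSeries.coeff d f = 0 := by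
  refine ⟨fun h d hd => MvPowerSeries.coeff_of_lt_order ?_, fun h => MvPowerSeries.nat_le_order h⟩
  exact lt_of_lt_of_le (by exact_mod_cast hd) h

lemma mul_mem_orderIdeal {j k : ℕ} {f g : MvPowerSeries ι ℝ} (hf : f ∈ orderIdeal ι j)
    (hg : g ∈ orderIdeal ι k) : f * g ∈ orderIdeal ι (j + k) := by
  rw [mem_orderIdeal_iff_le] at *
  push_cast
  exact (add_le_add hf hg).trans MvPowerSeries.le_order_mul

lemma mem_orderIdeal_zero (f : MvPowerSeries ι ℝ) : f ∈ orderIdeal ι 0 := by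
  simp [mem_orderIdeal_iff]

lemma mem_orderIdeal_one {f : MvPowerSeries ι ℝ} :
    f ∈ orderIdeal ι 1 ↔ MvPowerSeries.constantCoeff f = 0 := by
  rw [mem_orderIdeal_iff_le, Nat.cast_one, MvPowerSeries.one_le_order_iff_constCoeff_eq_zero]

lemma smul_mem_orderIdeal {k : ℕ} (r : ℝ) {f : MvPowerSeries ι ℝ} (hf : f ∈ orderIdeal ι k) :
    r • f ∈ orderIdeal ι k :=
  ((orderIdeal ι k).restrictScalars ℝ).smul_mem r hf

lemma X_mem_orderIdeal (i : ι) : MvPowerSeries.X i ∈ orderIdeal ι 1 := by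
  simp [mem_orderIdeal_one]

lemma orderIdeal_anti {j k : ℕ} (h : j ≤ k) : orderIdeal ι k ≤ orderIdeal ι j :=
  fun f hf => le_trans (show (j : ℕ∞) ≤ k by exact_mod_cast h) (mem_orderIdeal_iff_le.mp hf)

lemma pderiv_mem_orderIdeal (i : ι) {k : ℕ} {f : MvPowerSeries ι ℝ} (hf : f ∈ orderIdeal ι (k + 1)) :
    MvPowerSeries.pderiv ℝ i f ∈ orderIdeal ι k := by
  rw [mem_orderIdeal_iff] at *
  intro d hd
  rw [MvPowerSeries.coeff_pderiv, hf, zero_mul]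
  simp only [map_add, Finsupp.degree_single]
  omega

lemma iterate_mem_orderIdeal {D : MvPowerSeries ι ℝ → MvPowerSeries ι ℝ}
    (hD : ∀ k, ∀ f ∈ orderIdeal ι k, D f ∈ orderIdeal ι k) (m : ℕ) {k : ℕ} {f : MvPowerSeries ι ℝ}
    (hf : f ∈ orderIdeal ι k) : D^[m] f ∈ orderIdeal ι k := by
  induction m with
  | zero => exact hf
  | succ m ih =>
    rw [Function.iterate_succ_apply']
    exact hD _ _ ih

/-- A derivation of order zero that raises the order of coordinates in finitely many steps raises
the order of all monomials of positive degree in finitely many steps. -/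
lemma iterate_derivation_mul_mem (D : Derivation ℝ (MvPowerSeries ι ℝ) (MvPowerSeries ι ℝ))
    (hD : ∀ k, ∀ f ∈ orderIdeal ι k, D f ∈ orderIdeal ι k) {i j : ℕ} (m : ℕ) :
    ∀ (r s : ℕ), r + s = m → ∀ f ∈ orderIdeal ι i, ∀ g ∈ orderIdeal ι j,
      D^[r] f ∈ orderIdeal ι (i + 1) → D^[s] g ∈ orderIdeal ι (j + 1) →
      D^[r + s] (f * g) ∈ orderIdeal ι (i + j + 1) := by
  have hadd : ∀ (m : ℕ) (f g : MvPowerSeries ι ℝ), D^[m] (f + g) = D^[m] f + D^[m] g := by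
    intro m f g
    exact iterate_map_add D m f g
  induction m with
  | zero =>
    intro r s hrs f _ g hg hr _
    obtain ⟨rfl, rfl⟩ : r = 0 ∧ s = 0 := by omega
    have := mul_mem_orderIdeal hr hg
    rwa [show i + 1 + j = i + j + 1 by ring] at this
  | succ m ih =>
    intro r s hrs f hf g hg hr hs
    rcases r with _ | r
    · refine iterate_mem_orderIdeal hD _ ?_
      have := mul_mem_orderIdeal hr hg
      rwa [show i + 1 + j = i + j + 1 by ring] at this
    rcases s with _ | s
    · refine iterate_mem_orderIdeal hD _ ?_
      have := mul_mem_orderIdeal hf hs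
      rwa [← add_assoc] at this
    -- One application of the Leibniz rule leaves `f * D g` and `D f * g`; in each of them one of
    -- the two step counts has dropped.
    · rw [show r + 1 + (s + 1) = (r + s + 1) + 1 by ring, Function.iterate_succ_apply,
        Derivation.leibniz, hadd]
      refine Ideal.add_mem _ ?_ ?_
      · rw [show r + s + 1 = (r + 1) + s by ring]
        exact ih (r + 1) s (by omega) f hf (D g) (hD _ _ hg) hr hs
      · rw [smul_eq_mul, mul_comm, show r + s + 1 = r + (s + 1) by ring]
        exact ih r (s + 1) (by omega) (D f) (hD _ _ hf) g hg hr hs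

/-- Each variable of the monomial costs `r` steps, and the extra step is for the constant `1`, which
`D` kills. -/
lemma iterate_derivation_monomial_mem (D : Derivation ℝ (MvPowerSeries ι ℝ) (MvPowerSeries ι ℝ))
    (hD : ∀ k, ∀ f ∈ orderIdeal ι k, D f ∈ orderIdeal ι k) {r : ℕ}
    (hr : ∀ i, D^[r] (MvPowerSeries.X i) ∈ orderIdeal ι 2) (k : ℕ) (d : ι →₀ ℕ)
    (hd : d.degree = k) :
    D^[k * r + 1] (MvPowerSeries.monomial d (1 : ℝ)) ∈ orderIdeal ι (k + 1) := by
  induction k generalizing d with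
  | zero =>
    obtain rfl : d = 0 := (Finsupp.degree_eq_zero_iff d).mp hd
    rw [zero_mul, zero_add, Function.iterate_one, MvPowerSeries.monomial_zero_one, D.map_one_eq_zero]
    exact zero_mem _
  | succ k ih =>
    have hd0 : d ≠ 0 := by
      rintro rfl
      simp at hd
    obtain ⟨i, hi⟩ := Finsupp.ne_iff.mp hd0
    have hle : Finsupp.single i 1 ≤ d := by
      rw [Finsupp.single_le_iff]
      exact Nat.one_le_iff_ne_zero.mpr hi
    set d' := d - Finsupp.single i 1
    have hdd : Finsupp.single i 1 + d' = d := add_tsub_cancel_of_le hle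
    have hd' : d'.degree = k := by
      rw [← hdd, map_add, Finsupp.degree_single] at hd
      omega
    have hmon : MvPowerSeries.monomial d (1 : ℝ) =
        MvPowerSeries.X i * MvPowerSeries.monomial d' (1 : ℝ) := by
      rw [MvPowerSeries.X, MvPowerSeries.monomial_mul_monomial, hdd, one_mul]
    have hmem : MvPowerSeries.monomial d' (1 : ℝ) ∈ orderIdeal ι k := by
      classical
      rw [mem_orderIdeal_iff]
      intro e he
      rw [MvPowerSeries.coeff_monomial, if_neg]
      rintro rfl
      omega
    have := iterate_derivation_mul_mem D hD _ r (k * r + 1) rfl _ (X_mem_orderIdeal i) _ hmem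
      (hr i) (ih d' hd')
    rw [hmon, show (k + 1) * r + 1 = r + (k * r + 1) by ring, show k + 1 + 1 = 1 + k + 1 by ring]
    exact this

lemma exists_sum_monomial_add [Finite ι] (k : ℕ) (f : MvPowerSeries ι ℝ) :
    ∃ g ∈ orderIdeal ι (k + 1),
      f = ∑ d ∈ (Finsupp.finite_of_degree_le (σ := ι) k).toFinset,
        MvPowerSeries.coeff d f • MvPowerSeries.monomial d (1 : ℝ) + g := by
  classical
  refine ⟨f - ∑ d ∈ (Finsupp.finite_of_degree_le (σ := ι) k).toFinset,
    MvPowerSeries.coeff d f • MvPowerSeries.monomial d (1 : ℝ), ?_, by abel⟩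
  rw [mem_orderIdeal_iff]
  intro e he
  rw [map_sub, map_sum, Finset.sum_eq_single e]
  · simp
  · intro d _ hde
    rw [map_smul, MvPowerSeries.coeff_monomial, if_neg hde.symm, smul_zero]
  · intro h
    exact absurd (by simpa using Nat.lt_succ_iff.mp he) h

/-- Once `D^[m] f` has order at least `k`, only its degree `k` part obstructs order `k + 1`. That
part is a finite sum of monomials, and `k * r + 1` further steps remove it, whatever `f` is. -/
lemma exists_iterate_derivation_mem [Finite ι]
    (D : Derivation ℝ (MvPowerSeries ι ℝ) (MvPowerSeries ι ℝ))
    (hD : ∀ k, ∀ f ∈ orderIdeal ι k, D f ∈ orderIdeal ι k) {r : ℕ}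
    (hr : ∀ i, D^[r] (MvPowerSeries.X i) ∈ orderIdeal ι 2) (k : ℕ) :
    ∃ m : ℕ, ∀ f, D^[m] f ∈ orderIdeal ι k := by
  induction k with
  | zero => exact ⟨0, mem_orderIdeal_zero⟩
  | succ k ih =>
    obtain ⟨m, hm⟩ := ih
    refine ⟨(k * r + 1) + m, fun f => ?_⟩
    rw [Function.iterate_add_apply]
    obtain ⟨g, hg, hfg⟩ := exists_sum_monomial_add k (D^[m] f)
    have hpow : ∀ m : ℕ, (D^[m] : MvPowerSeries ι ℝ → MvPowerSeries ι ℝ) =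
        ((D.toLinearMap : Module.End ℝ (MvPowerSeries ι ℝ)) ^ m :) := fun m =>
      (Module.End.coe_pow D.toLinearMap m).symm
    rw [hfg, hpow, map_add, map_sum]
    refine Ideal.add_mem _ (Ideal.sum_mem _ fun d hd => ?_) ?_
    · rw [map_smul, ← hpow]
      rcases lt_or_eq_of_le (show d.degree ≤ k by simpa using hd) with h | h
      · rw [mem_orderIdeal_iff.mp (hm f) d h, zero_smul]
        exact zero_mem _
      · exact smul_mem_orderIdeal _ (iterate_derivation_monomial_mem D hD hr k d h)
    · rw [← hpow]
      exact iterate_mem_orderIdeal hD _ hg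

variable [Fintype ι]

lemma lieDer_apply (v : ι → MvPowerSeries ι ℝ) (f : MvPowerSeries ι ℝ) :
    lieDer v f = ∑ i, v i * MvPowerSeries.pderiv ℝ i f := by
  rw [lieDer, ← Derivation.coeFnAddMonoidHom_apply, map_sum, Finset.sum_apply]
  rfl

lemma lieDer_X (v : ι → MvPowerSeries ι ℝ) (i : ι) : lieDer v (MvPowerSeries.X i) = v i := by
  classical
  rw [lieDer_apply, Finset.sum_eq_single i]
  · simp
  · intro j _ hj
    rw [MvPowerSeries.pderiv_X_of_ne hj.symm, mul_zero]
  · simp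

lemma lieDer_mem_orderIdeal {v : ι → MvPowerSeries ι ℝ} (hv : ∀ i, v i ∈ orderIdeal ι 1) {k : ℕ}
    {f : MvPowerSeries ι ℝ} (hf : f ∈ orderIdeal ι k) : lieDer v f ∈ orderIdeal ι k := by
  rw [lieDer_apply]
  refine Ideal.sum_mem _ fun i _ => ?_
  cases k with
  | zero => exact mem_orderIdeal_zero _
  | succ k =>
    rw [add_comm]
    exact mul_mem_orderIdeal (hv i) (pderiv_mem_orderIdeal i hf)

end OrderFiltration

/-! ### Linear and higher order parts of formal vector fields -/

section VectorFields

variable {ι : Type*} {V : Type*} [AddCommGroup V] [Module ℝ V]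

lemma pderiv_comm (i j : ι) (f : MvPowerSeries ι ℝ) :
    MvPowerSeries.pderiv ℝ i (MvPowerSeries.pderiv ℝ j f) =
      MvPowerSeries.pderiv ℝ j (MvPowerSeries.pderiv ℝ i f) := by
  classical
  ext d
  by_cases hij : i = j
  · rw [hij]
  · simp only [MvPowerSeries.coeff_pderiv, Finsupp.add_apply,
      Finsupp.single_eq_of_ne (Ne.symm hij), Finsupp.single_eq_of_ne hij, add_zero]
    rw [add_right_comm]
    ring

variable [Fintype ι]

lemma linearSeries_mem_orderIdeal (b : Module.Basis ι ℝ V) (φ : Module.Dual ℝ V) :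
    linearSeries b φ ∈ orderIdeal ι 1 :=
  Ideal.sum_mem _ fun i _ => smul_mem_orderIdeal _ (X_mem_orderIdeal i)

lemma linearSeries_coord (b : Module.Basis ι ℝ V) (i : ι) :
    linearSeries b (b.coord i) = MvPowerSeries.X i := by
  classical
  change ∑ j, b.coord i (b j) • MvPowerSeries.X j = _
  rw [Finset.sum_eq_single i]
  · simp
  · intro j _ hj
    simp [Finsupp.single_eq_of_ne hj.symm]
  · simp

lemma linearField_eq [DecidableEq ι] (b : Module.Basis ι ℝ V) (A : Module.End ℝ V) (i : ι) :
    linearField b A i = linearSeries b (b.coord i ∘ₗ A) := by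
  simp [linearField, linearSeries, LinearMap.toMatrix_apply]

lemma lieDer_add (u w : ι → MvPowerSeries ι ℝ) : lieDer (u + w) = lieDer u + lieDer w := by
  ext1 f
  simp [lieDer_apply, add_mul, Finset.sum_add_distrib]

lemma lieDer_linearSeries (b : Module.Basis ι ℝ V) (v : ι → MvPowerSeries ι ℝ)
    (φ : Module.Dual ℝ V) : lieDer v (linearSeries b φ) = ∑ i, φ (b i) • v i := by
  change lieDer v (∑ i, φ (b i) • MvPowerSeries.X i) = _
  simp [lieDer_X]

lemma lieDer_linearField_linearSeries [DecidableEq ι] (b : Module.Basis ι ℝ V)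
    (A : Module.End ℝ V) (φ : Module.Dual ℝ V) :
    lieDer (linearField b A) (linearSeries b φ) = linearSeries b (φ ∘ₗ A) := by
  rw [lieDer_linearSeries]
  simp only [linearField_eq, ← map_smul, ← map_sum]
  congr 1
  ext x
  have h := LinearMap.congr_fun (b.sum_dual_apply_smul_coord φ) (A x)
  rw [LinearMap.sum_apply] at h ⊢
  exact h

lemma lieDer_lie (u w : ι → MvPowerSeries ι ℝ) :
    ⁅lieDer u, lieDer w⁆ = lieDer fun i => lieDer u (w i) - lieDer w (u i) := by
  ext1 f
  rw [Derivation.commutator_apply, lieDer_apply w f, lieDer_apply u f, map_sum, map_sum,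
    lieDer_apply _ f]
  simp only [Derivation.leibniz, smul_eq_mul, Finset.sum_add_distrib, sub_mul,
    Finset.sum_sub_distrib]
  -- The second order terms of the commutator cancel by symmetry of mixed partial derivatives.
  have h : ∑ i, w i * lieDer u (MvPowerSeries.pderiv ℝ i f) =
      ∑ i, u i * lieDer w (MvPowerSeries.pderiv ℝ i f) := by
    simp only [lieDer_apply, Finset.mul_sum]
    rw [Finset.sum_comm]
    refine Finset.sum_congr rfl fun i _ => Finset.sum_congr rfl fun j _ => ?_
    rw [pderiv_comm]
    ring
  rw [h, add_sub_add_left_eq_sub]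
  simp only [mul_comm]

lemma lieDer_linearField_lie_eq_zero [DecidableEq ι] (b : Module.Basis ι ℝ V)
    {S N : Module.End ℝ V} (h : Commute S N) :
    ⁅lieDer (linearField b S), lieDer (linearField b N)⁆ = 0 := by
  rw [lieDer_lie]
  ext1 f
  rw [lieDer_apply, Derivation.zero_apply]
  refine Finset.sum_eq_zero fun i _ => ?_
  have h2 : N ∘ₗ S = S ∘ₗ N := h.symm.eq
  rw [linearField_eq, linearField_eq, lieDer_linearField_linearSeries,
    lieDer_linearField_linearSeries, LinearMap.comp_assoc, LinearMap.comp_assoc, h2, sub_self,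
    zero_mul]

lemma linearField_add [DecidableEq ι] (b : Module.Basis ι ℝ V) (S N : Module.End ℝ V) :
    linearField b (S + N) = linearField b S + linearField b N := by
  ext1 i
  simp only [Pi.add_apply, linearField_eq, LinearMap.comp_add, map_add]

lemma higherOrderPart_mem_orderIdeal [DecidableEq ι] (b : Module.Basis ι ℝ V)
    {v : ι → MvPowerSeries ι ℝ} (hv : ∀ i, MvPowerSeries.constantCoeff (v i) = 0) (i : ι) :
    higherOrderPart b v i ∈ orderIdeal ι 2 := by
  classical
  rw [mem_orderIdeal_iff]
  intro d hd
  simp only [higherOrderPart, Pi.sub_apply, linearField, linearPart, LinearMap.toMatrix_toLin,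
    Matrix.of_apply, map_sub, map_sum, map_smul, MvPowerSeries.coeff_X, smul_eq_mul]
  rcases Nat.lt_succ_iff_lt_or_eq.mp hd with h | h
  · obtain rfl : d = 0 := (Finsupp.degree_eq_zero_iff d).mp (by omega)
    simp [hv, Finsupp.single_eq_zero, eq_comm (a := (0 : ι →₀ ℕ))]
  · obtain ⟨j, rfl⟩ : d ∈ Set.range fun a : ι => Finsupp.single a 1 := by
      rw [Finsupp.range_single_one]
      exact h
    simp [Finsupp.single_left_inj]

/-- The formal vector field `v` vanishing at the origin, whose linear part has the Jordan
decomposition `S + N`, acts as `S` up to a derivation that is nilpotent modulo any order. -/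
lemma exists_nilpotent_difference [DecidableEq ι] (b : Module.Basis ι ℝ V)
    {v : ι → MvPowerSeries ι ℝ} (hv : ∀ i, MvPowerSeries.constantCoeff (v i) = 0)
    {S N : Module.End ℝ V} (hSN : IsJordanDecomposition (linearPart b v) S N) (k : ℕ) :
    ∃ m : ℕ, ∀ f, (lieDer v - lieDer (linearField b S))^[m] f ∈ orderIdeal ι k := by
  have hd : lieDer v - lieDer (linearField b S) =
      lieDer (linearField b N + higherOrderPart b v) := by
    rw [sub_eq_iff_eq_add, ← lieDer_add, add_right_comm, add_comm (linearField b N),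
      ← linearField_add, ← hSN.eq_add, higherOrderPart]
    congr 1
    abel
  rw [hd]
  have hho := higherOrderPart_mem_orderIdeal b hv
  have hD : ∀ k, ∀ f ∈ orderIdeal ι k, lieDer (linearField b N + higherOrderPart b v) f ∈
      orderIdeal ι k := by
    intro k f hf
    refine lieDer_mem_orderIdeal (fun i => Ideal.add_mem _ ?_ (orderIdeal_anti one_le_two (hho i)))
      hf
    rw [linearField_eq]
    exact linearSeries_mem_orderIdeal _ _
  obtain ⟨r, hr⟩ := hSN.nilpotent
  refine exists_iterate_derivation_mem _ hD (r := r) (fun i => ?_) k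
  -- Modulo order two the difference acts on linear functions as the transpose of the nilpotent `N`;
  -- the higher order part only contributes terms of order two.
  have key : ∀ (m : ℕ) (φ : Module.Dual ℝ V),
      (lieDer (linearField b N + higherOrderPart b v))^[m] (linearSeries b φ) -
        linearSeries b (φ ∘ₗ (N ^ m)) ∈ orderIdeal ι 2 := by
    intro m
    induction m with
    | zero => simp [Module.End.one_eq_id]
    | succ m ih =>
      intro φ
      rw [Function.iterate_succ_apply']
      have h1 := hD _ _ (ih φ)
      rw [map_sub] at h1
      have h2 : lieDer (linearField b N + higherOrderPart b v)
          (linearSeries b (φ ∘ₗ (N ^ m))) - linearSeries b (φ ∘ₗ (N ^ (m + 1))) ∈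
          orderIdeal ι 2 := by
        rw [lieDer_add, Derivation.add_apply, lieDer_linearField_linearSeries,
          LinearMap.comp_assoc, pow_succ]
        rw [← Module.End.mul_eq_comp, add_sub_cancel_left, lieDer_linearSeries]
        exact Ideal.sum_mem _ fun i _ => smul_mem_orderIdeal _ (hho i)
      simpa using Ideal.add_mem _ h1 h2
  have := key r (b.coord i)
  rwa [hr, LinearMap.comp_zero, map_zero, sub_zero, linearSeries_coord] at this

/-- `L_S` commutes with `L_S`, with `L_N` since `S` and `N` commute, and with the higher order part
by `hcomm`; this is how the normal form hypothesis enters the argument. -/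
lemma commute_lieDer [DecidableEq ι] (b : Module.Basis ι ℝ V)
    {v : ι → MvPowerSeries ι ℝ} {S N : Module.End ℝ V}
    (hSN : IsJordanDecomposition (linearPart b v) S N)
    (hcomm : ⁅lieDer (linearField b S), lieDer (higherOrderPart b v)⁆ = 0) :
    Commute (lieDer (linearField b S)).toLinearMap (lieDer v).toLinearMap := by
  have hd : lieDer v = lieDer (linearField b S) + lieDer (linearField b N) +
      lieDer (higherOrderPart b v) := by
    rw [← lieDer_add, ← lieDer_add, ← linearField_add, ← hSN.eq_add, higherOrderPart]
    congr 1
    abel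
  ext1 f
  have h1 := Derivation.congr_fun hcomm f
  have h2 := Derivation.congr_fun (lieDer_linearField_lie_eq_zero b hSN.commute) f
  rw [Derivation.commutator_apply, Derivation.zero_apply] at h1 h2
  change lieDer (linearField b S) (lieDer v f) = lieDer v (lieDer (linearField b S) f)
  simp only [hd, Derivation.add_apply, map_add]
  linear_combination h1 + h2

end VectorFields

/-! ### Weight vectors of a commuting pair of operators -/

section Weights

open Polynomial

variable {M : Type*} [AddCommGroup M] [Module ℝ M]

/-- For monomials this is the geometric sum identity. It shows that `q(T)` is nilpotent on the
kernel of `q(S)` whenever `T - S` is nilpotent. -/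
lemma exists_aeval_sub_eq_mul {T S : Module.End ℝ M} (h : Commute T S) (q : ℝ[X]) :
    ∃ U : Module.End ℝ M, Commute U T ∧ Commute U S ∧ aeval T q = aeval S q + (T - S) * U := by
  induction q using Polynomial.induction_on' with
  | add p q hp hq =>
    obtain ⟨U, h1, h2, h3⟩ := hp
    obtain ⟨U', h1', h2', h3'⟩ := hq
    refine ⟨U + U', h1.add_left h1', h2.add_left h2', ?_⟩
    rw [map_add, map_add, h3, h3', mul_add]
    abel
  | monomial n a =>
    refine ⟨a • ∑ i ∈ Finset.range n, T ^ i * S ^ (n - 1 - i), ?_, ?_, ?_⟩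
    · exact Commute.smul_left (Commute.sum_left _ _ _ fun i _ =>
        ((Commute.refl T).pow_left _).mul_left (h.symm.pow_left _)) a
    · exact Commute.smul_left (Commute.sum_left _ _ _ fun i _ =>
        (h.pow_left _).mul_left ((Commute.refl S).pow_left _)) a
    · rw [mul_smul_comm, h.mul_geom_sum₂, aeval_monomial, aeval_monomial,
        ← Algebra.smul_def, ← Algebra.smul_def, smul_sub]
      abel

lemma add_pow_apply_of_apply_eq_zero {X Y : Module.End ℝ M} (h : Commute X Y) {x : M}
    (hx : X x = 0) (m : ℕ) : ((X + Y) ^ m) x = (Y ^ m) x := by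
  induction m with
  | zero => rfl
  | succ m ih =>
    have h1 : X ((Y ^ m) x) = 0 := by
      rw [← Module.End.mul_apply, (h.pow_right m).eq, Module.End.mul_apply, hx, map_zero]
    rw [pow_succ', Module.End.mul_apply, ih, LinearMap.add_apply, h1, zero_add, pow_succ',
      Module.End.mul_apply]

lemma aeval_apply_mem {T : Module.End ℝ M} {W : Submodule ℝ M} (hW : ∀ x ∈ W, T x ∈ W) (q : ℝ[X])
    {x : M} (hx : x ∈ W) : aeval T q x ∈ W := by
  have hpow : ∀ n : ℕ, (T ^ n) x ∈ W := by
    intro n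
    induction n with
    | zero => exact hx
    | succ n ih =>
      rw [pow_succ', Module.End.mul_apply]
      exact hW _ ih
  rw [aeval_eq_sum_range, LinearMap.sum_apply]
  exact W.sum_mem fun i _ => W.smul_mem _ (hpow i)

lemma apply_aeval_of_skew {T : Module.End ℝ M} {β : M →ₗ[ℝ] M →ₗ[ℝ] ℝ}
    (hβ : ∀ x y, β (T x) y = - β x (T y)) (q : ℝ[X]) (x y : M) :
    β (aeval T q x) y = β x (aeval T (q.comp (-X)) y) := by
  have hpow : ∀ (n : ℕ) (x y : M), β ((T ^ n) x) y = β x (((-T) ^ n) y) := by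
    intro n
    induction n with
    | zero => intro x y; rfl
    | succ n ih =>
      intro x y
      rw [pow_succ', Module.End.mul_apply, hβ, ← map_neg, ih, pow_succ, Module.End.mul_apply,
        LinearMap.neg_apply, map_neg, map_neg]
  rw [aeval_comp, map_neg, aeval_X, aeval_eq_sum_range, aeval_eq_sum_range]
  simp [LinearMap.sum_apply, hpow]

/-- If `x` is annihilated modulo `W` by a polynomial `q(T)` such that `q` and `q(-X)` are coprime,
then `x` is modulo `W` the image under `T` of a vector `y` with `β(y, T y) = 0`. -/
lemma exists_sub_apply_mem {T : Module.End ℝ M} {W : Submodule ℝ M} (hW : ∀ x ∈ W, T x ∈ W)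
    {β : M →ₗ[ℝ] M →ₗ[ℝ] ℝ} (hβ : ∀ x y, β (T x) y = - β x (T y))
    (hβl : ∀ x ∈ W, ∀ y, β x y = 0) (hβr : ∀ x, ∀ y ∈ W, β x y = 0) {q : ℝ[X]}
    (hq : IsCoprime q (q.comp (-X))) {x : M} (hx : aeval T q x ∈ W) :
    ∃ y, x - T y ∈ W ∧ β y (T y) = 0 := by
  -- Zero is its own reflection, so it cannot be a root of `q`. Hence `a X + c q = 1` for some `a`,
  -- `c`, and `y = a(T) x` inverts `T` modulo `W`.
  have hq0 : q.eval 0 ≠ 0 := by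
    obtain ⟨u, w, h⟩ := hq
    intro h0
    have := congrArg (eval 0) h
    simp [eval_comp, h0] at this
  have hX : IsCoprime X q := by
    rw [irreducible_X.coprime_iff_not_dvd, X_dvd_iff, coeff_zero_eq_eval_zero]
    exact hq0
  obtain ⟨a, c, hac⟩ := hX
  have hy : ∀ p : ℝ[X], aeval T q (aeval T p x) ∈ W := by
    intro p
    rw [← Module.End.mul_apply, ← map_mul, mul_comm, map_mul, Module.End.mul_apply]
    exact aeval_apply_mem hW p hx
  refine ⟨aeval T a x, ?_, ?_⟩
  · have h1 : x - T (aeval T a x) = aeval T c (aeval T q x) := by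
      have := congrArg (fun p => aeval T p x) hac
      simp only [map_add, map_mul, aeval_X, map_one, LinearMap.add_apply, Module.End.mul_apply,
        Module.End.one_apply] at this
      have h2 : aeval T a (T x) = T (aeval T a x) := by
        have h3 : aeval T (a * X) = aeval T (X * a) := by rw [mul_comm]
        simpa using LinearMap.congr_fun h3 x
      rw [← h2, sub_eq_iff_eq_add, add_comm]
      exact this.symm
    rw [h1]
    exact aeval_apply_mem hW c hx
  -- Write `u q + w q(-X) = 1` and apply it to `z = T y`. The first term lies in `W`; in the second,
  -- skewness moves `q(-T)` to the left slot as `q(T) y ∈ W`.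
  · obtain ⟨u, w, huw⟩ := hq
    have h2 : T (aeval T a x) = aeval T (X * a) x := by simp
    rw [h2]
    set y := aeval T a x with hydef
    set z := aeval T (X * a) x with hz
    have h1 := congrArg (fun p => aeval T p z) huw
    simp only [map_add, map_mul, map_one, LinearMap.add_apply, Module.End.mul_apply,
      Module.End.one_apply] at h1
    have h3 : aeval T w (aeval T (q.comp (-X)) z) = aeval T (q.comp (-X)) (aeval T w z) := by
      rw [← Module.End.mul_apply, ← map_mul, mul_comm, map_mul, Module.End.mul_apply]
    rw [← h1, map_add, h3, ← apply_aeval_of_skew hβ, hβr _ _ (aeval_apply_mem hW u (hy _)),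
      hβl _ (hy a), add_zero]

end Weights

/-! ### The annihilator of the center space -/

section CenterSpace

open Polynomial Module.End

/-- Two complex roots of an irreducible real polynomial are Galois conjugate, hence equal or complex
conjugate. -/
lemma re_eq_of_irreducible {p : ℝ[X]} (hp : Irreducible p) {z w : ℂ} (hz : aeval z p = 0)
    (hw : aeval w p = 0) : z.re = w.re := by
  have : IsAlgClosure ℝ ℂ := ⟨inferInstance, inferInstance⟩
  have : Normal ℝ ℂ := IsAlgClosure.normal ℝ ℂ
  have h : IsConjRoot ℝ z w := by
    rw [isConjRoot_def, ← minpoly.eq_of_irreducible hp hz, ← minpoly.eq_of_irreducible hp hw]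
  obtain ⟨σ, rfl⟩ := isConjRoot_iff_exists_algEquiv.mp h
  rcases Complex.real_algHom_eq_id_or_conj (σ : ℂ →ₐ[ℝ] ℂ) with h | h
  · have : σ w = w := DFunLike.congr_fun h w
    rw [this]
  · have : σ w = (starRingEnd ℂ) w := DFunLike.congr_fun h w
    rw [this, Complex.conj_re]

/-- Separation of the roots of a real polynomial by the sign of their real part. -/
lemma exists_factorization_by_re (p : ℝ[X]) (hp : p ≠ 0) : ∃ q₀ q₁ q₂ : ℝ[X],
    p = q₀ * (q₁ * q₂) ∧ (∀ z : ℂ, aeval z q₀ = 0 → z.re = 0) ∧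
      (∀ z : ℂ, aeval z q₁ = 0 → 0 < z.re) ∧ (∀ z : ℂ, aeval z q₂ = 0 → z.re < 0) := by
  induction p using UniqueFactorizationMonoid.induction_on_prime with
  | h₁ => exact absurd rfl hp
  | h₂ p hu =>
    have h : ∀ z : ℂ, aeval z p ≠ 0 := fun z => (hu.map (aeval z)).ne_zero
    exact ⟨p, 1, 1, by simp, fun z hz => absurd hz (h z), by simp, by simp⟩
  | h₃ a p ha hp' ih =>
    obtain ⟨q₀, q₁, q₂, rfl, h0, h1, h2⟩ := ih ha
    have hirr := hp'.irreducible
    have hdeg : (p.map (algebraMap ℝ ℂ)).degree ≠ 0 := by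
      rw [degree_map]
      exact fun h => hirr.not_isUnit (isUnit_iff_degree_eq_zero.mpr h)
    obtain ⟨z, hz⟩ := IsAlgClosed.exists_root _ hdeg
    have hz : aeval z p = 0 := by simpa [IsRoot, eval_map_algebraMap] using hz
    rcases lt_trichotomy z.re 0 with hre | hre | hre
    · refine ⟨q₀, q₁, p * q₂, by ring, h0, h1, fun w hw => ?_⟩
      rw [map_mul, mul_eq_zero] at hw
      exact hw.elim (fun hw => re_eq_of_irreducible hirr hw hz ▸ hre) (h2 w)
    · refine ⟨p * q₀, q₁, q₂, by ring, fun w hw => ?_, h1, h2⟩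
      rw [map_mul, mul_eq_zero] at hw
      exact hw.elim (fun hw => re_eq_of_irreducible hirr hw hz ▸ hre) (h0 w)
    · refine ⟨q₀, p * q₁, q₂, by ring, h0, fun w hw => ?_, h2⟩
      rw [map_mul, mul_eq_zero] at hw
      exact hw.elim (fun hw => (re_eq_of_irreducible hirr hw hz).symm ▸ hre) (h1 w)

lemma isCoprime_of_aeval {p q : ℝ[X]} (h : ∀ z : ℂ, aeval z p = 0 → aeval z q ≠ 0) :
    IsCoprime p q := by
  refine (isCoprime_iff_aeval_ne_zero_of_isAlgClosed ℝ ℂ p q).mpr ?_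
  exact fun z => or_iff_not_imp_left.mpr fun hz => h z (not_not.mp hz)

/-- A common root `z` would put both `z` and `-z` in the same open half plane. The number `s`
selects the half plane; it is used with the values `1` and `-1`. -/
lemma isCoprime_comp_neg_X {q : ℝ[X]} (s : ℝ) (h : ∀ z : ℂ, aeval z q = 0 → 0 < s * z.re) :
    IsCoprime q (q.comp (-X)) := by
  refine isCoprime_of_aeval fun z hz hz' => ?_
  have h1 := h z hz
  rw [aeval_comp, map_neg, aeval_X] at hz'
  have h2 := h (-z) hz'
  rw [Complex.neg_re] at h2
  linarith

/-- Primary decomposition: over `ℂ` the polynomial is a product of pairwise coprime powers of linear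
factors, and the kernel of a coprime product is the sum of the kernels. -/
lemma mem_iSup_maxGenEigenspace {M : Type*} [AddCommGroup M] [Module ℂ M] (F : Module.End ℂ M)
    {p : ℂ[X]} (hp : p ≠ 0) {Z : Set ℂ} (hZ : ∀ z, p.IsRoot z → z ∈ Z) {x : M}
    (hx : aeval F p x = 0) : x ∈ ⨆ μ ∈ Z, F.maxGenEigenspace μ := by
  classical
  have key : ∀ s : Finset ℂ, LinearMap.ker (aeval F (∏ a ∈ s, (X - C a) ^ p.roots.count a)) ≤
      ⨆ μ ∈ s, F.maxGenEigenspace μ := by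
    intro s
    induction s using Finset.induction_on with
    | empty => simp [Module.End.one_eq_id]
    | insert a s ha ih =>
      have hcop : IsCoprime ((X - C a) ^ p.roots.count a) (∏ b ∈ s, (X - C b) ^ p.roots.count b) :=
        IsCoprime.prod_right fun b hb =>
          (isCoprime_X_sub_C_of_isUnit_sub (sub_ne_zero.mpr fun h => ha (by rw [show a = b from h]; exact hb)).isUnit).pow
      rw [Finset.prod_insert ha, ← sup_ker_aeval_eq_ker_aeval_mul_of_coprime F hcop,
        Finset.iSup_insert]
      refine sup_le_sup (fun y hy => ?_) ih
      rw [mem_maxGenEigenspace]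
      refine ⟨p.roots.count a, ?_⟩
      simpa [Algebra.algebraMap_eq_smul_one] using hy
  have h1 : p = C p.leadingCoeff * ∏ a ∈ p.roots.toFinset, (X - C a) ^ p.roots.count a := by
    rw [← Finset.prod_multiset_map_count]
    exact (IsAlgClosed.splits p).eq_prod_roots
  have h2 : x ∈ LinearMap.ker (aeval F (∏ a ∈ p.roots.toFinset, (X - C a) ^ p.roots.count a)) := by
    rw [h1, map_mul, aeval_C, Module.End.mul_apply, Module.algebraMap_end_apply] at hx
    exact (smul_eq_zero.mp hx).resolve_left (leadingCoeff_ne_zero.mpr hp)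
  refine (key _).trans ?_ h2
  refine iSup₂_le fun μ hμ => le_iSup₂_of_le μ (hZ μ ?_) le_rfl
  rw [Multiset.mem_toFinset] at hμ
  exact isRoot_of_mem_roots hμ

lemma add_pow_apply_eq_zero {R M : Type*} [CommRing R] [AddCommGroup M] [Module R M]
    {X Y : Module.End R M} (h : Commute X Y) (n : ℕ) : ∀ (s r : ℕ) (x : M), s + r = n →
      (X ^ s) x = 0 → (Y ^ r) x = 0 → ((X + Y) ^ n) x = 0 := by
  induction n with
  | zero =>
    intro s r x hsr hX _
    obtain rfl : s = 0 := by omega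
    simpa using hX
  | succ n ih =>
    intro s r x hsr hX hY
    rcases s with _ | s
    · rw [show x = 0 by simpa using hX, map_zero]
    rcases r with _ | r
    · rw [show x = 0 by simpa using hY, map_zero]
    rw [pow_succ, Module.End.mul_apply, LinearMap.add_apply, map_add]
    have h1 : (Y ^ (r + 1)) (X x) = 0 := by
      rw [← Module.End.mul_apply, ← (h.pow_right _).eq, Module.End.mul_apply, hY, map_zero]
    have h2 : (X ^ (s + 1)) (Y x) = 0 := by
      rw [← Module.End.mul_apply, (h.pow_left _).eq, Module.End.mul_apply, hX, map_zero]
    rw [ih s (r + 1) (X x) (by omega) (by rwa [pow_succ, Module.End.mul_apply] at hX) h1,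
      ih (s + 1) r (Y x) (by omega) h2 (by rwa [pow_succ, Module.End.mul_apply] at hY), add_zero]

/-- The center space is defined through `A = S + N`, while the polynomials used below are evaluated
at `S`; this passes from one to the other. -/
lemma maxGenEigenspace_le_of_nilpotent {R M : Type*} [CommRing R] [AddCommGroup M] [Module R M]
    {S N : Module.End R M} (h : Commute S N) (hN : IsNilpotent N) (μ : R) :
    S.maxGenEigenspace μ ≤ (S + N).maxGenEigenspace μ := by
  intro x hx
  rw [mem_maxGenEigenspace] at *
  obtain ⟨s, hs⟩ := hx
  obtain ⟨r, hr⟩ := hN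
  refine ⟨s + r, ?_⟩
  rw [add_sub_right_comm]
  exact add_pow_apply_eq_zero (h.sub_left ((Commute.one_left N).smul_left μ)) _ s r x rfl hs
    (by simp [hr])

lemma commute_aeval {R A : Type*} [CommRing R] [Ring A] [Algebra R A] {x y : A} (h : Commute x y)
    (q : R[X]) : Commute x (aeval y q) := by
  rw [aeval_eq_sum_range]
  exact Commute.sum_right _ _ _ fun i _ => (h.pow_right i).smul_right _

variable {V : Type*} [AddCommGroup V] [Module ℝ V]

lemma aeval_baseChange_tmul (S : Module.End ℝ V) (q : ℝ[X]) (x : V) :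
    aeval (S.baseChange ℂ) (q.map (algebraMap ℝ ℂ)) ((1 : ℂ) ⊗ₜ[ℝ] x) =
      (1 : ℂ) ⊗ₜ[ℝ] (aeval S q x) := by
  have h := aeval_algHom_apply (Module.End.baseChangeHom ℝ ℂ V) S q
  rw [aeval_map_algebraMap]
  exact LinearMap.congr_fun h _

lemma mem_centerSpace {A S N : Module.End ℝ V} (h : IsJordanDecomposition A S N) {q : ℝ[X]}
    (hq0 : q ≠ 0) (hq : ∀ z : ℂ, aeval z q = 0 → z.re = 0) {x : V} (hx : aeval S q x = 0) :
    x ∈ centerSpace A := by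
  have hq' : q.map (algebraMap ℝ ℂ) ≠ 0 := by
    rwa [Ne, Polynomial.map_eq_zero]
  have h1 : (1 : ℂ) ⊗ₜ[ℝ] x ∈ ⨆ μ ∈ {μ : ℂ | μ.re = 0},
      maxGenEigenspace (S.baseChange ℂ : Module.End ℂ (ℂ ⊗[ℝ] V)) μ := by
    refine mem_iSup_maxGenEigenspace _ hq' (fun z hz => hq z ?_) (by
      rw [aeval_baseChange_tmul, hx, tmul_zero])
    simpa [IsRoot, eval_map_algebraMap] using hz
  refine (iSup₂_mono fun μ _ => ?_ : _ ≤ complexCenterSpace A) h1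
  have hA : A.baseChange ℂ = S.baseChange ℂ + N.baseChange ℂ := by
    rw [h.eq_add, LinearMap.baseChange_add]
  have hc : Commute (S.baseChange ℂ : Module.End ℂ (ℂ ⊗[ℝ] V)) (N.baseChange ℂ) :=
    h.commute.map (Module.End.baseChangeHom ℝ ℂ V)
  have hn : IsNilpotent (N.baseChange ℂ : Module.End ℂ (ℂ ⊗[ℝ] V)) :=
    h.nilpotent.map (Module.End.baseChangeHom ℝ ℂ V)
  rw [hA]
  exact maxGenEigenspace_le_of_nilpotent hc hn μ

/-- A linear functional that vanishes on the center space is a sum of two functionals annihilated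
by polynomials without roots in common with their reflections. -/
lemma exists_add_of_mem_dualAnnihilator [FiniteDimensional ℝ V] {A S N : Module.End ℝ V}
    (h : IsJordanDecomposition A S N) {φ : Module.Dual ℝ V}
    (hφ : φ ∈ (centerSpace A).dualAnnihilator) :
    ∃ (φ₁ φ₂ : Module.Dual ℝ V) (q₁ q₂ : ℝ[X]), φ = φ₁ + φ₂ ∧ IsCoprime q₁ (q₁.comp (-X)) ∧
      IsCoprime q₂ (q₂.comp (-X)) ∧ φ₁ ∘ₗ aeval S q₁ = 0 ∧ φ₂ ∘ₗ aeval S q₂ = 0 := by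
  have hS : minpoly ℝ S ≠ 0 := minpoly.ne_zero (Algebra.IsIntegral.isIntegral S)
  obtain ⟨q₀, q₁, q₂, hq, h0, h1, h2⟩ := exists_factorization_by_re _ hS
  have hq0 : q₀ ≠ 0 := by
    rintro rfl
    exact hS (by rw [hq, zero_mul])
  -- The range of `(q₁ q₂)(S)` is killed by `q₀(S)`, whose factor has only imaginary roots, so it
  -- lies in the center space, where `φ` vanishes.
  have hφ0 : φ ∘ₗ aeval S (q₁ * q₂) = 0 := by
    ext x
    refine (Submodule.mem_dualAnnihilator φ).mp hφ _ (mem_centerSpace h hq0 h0 ?_)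
    rw [← Module.End.mul_apply, ← map_mul, ← hq, minpoly.aeval, LinearMap.zero_apply]
  obtain ⟨a, c, hac⟩ : IsCoprime q₁ q₂ :=
    isCoprime_of_aeval fun z hz hz' => lt_asymm (h1 z hz) (h2 z hz')
  -- From `a q₁ + c q₂ = 1`, these two summands add up to `φ`, and `q₁(S)`, respectively `q₂(S)`,
  -- completes the annihilating factor `q₁ q₂`.
  refine ⟨φ ∘ₗ aeval S (c * q₂), φ ∘ₗ aeval S (a * q₁), q₁, q₂, ?_,
    isCoprime_comp_neg_X 1 (by simpa using h1), isCoprime_comp_neg_X (-1) (by simpa using h2),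
    ?_, ?_⟩
  · rw [← LinearMap.comp_add, ← map_add, add_comm, hac, map_one]
    rfl
  · rw [LinearMap.comp_assoc, ← Module.End.mul_eq_comp, ← map_mul,
      show c * q₂ * q₁ = (q₁ * q₂) * c by ring, map_mul, Module.End.mul_eq_comp,
      ← LinearMap.comp_assoc, hφ0, LinearMap.zero_comp]
  · rw [LinearMap.comp_assoc, ← Module.End.mul_eq_comp, ← map_mul,
      show a * q₁ * q₂ = (q₁ * q₂) * a by ring, map_mul, Module.End.mul_eq_comp,
      ← LinearMap.comp_assoc, hφ0, LinearMap.zero_comp]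

variable {ι : Type*} [Fintype ι] [DecidableEq ι]

lemma aeval_lieDer_linearSeries (b : Module.Basis ι ℝ V) (S : Module.End ℝ V) (q : ℝ[X])
    (φ : Module.Dual ℝ V) :
    aeval (lieDer (linearField b S)).toLinearMap q (linearSeries b φ) =
      linearSeries b (φ ∘ₗ aeval S q) := by
  have hpow : ∀ n : ℕ, ((lieDer (linearField b S)).toLinearMap ^ n) (linearSeries b φ) =
      linearSeries b (φ ∘ₗ (S ^ n)) := by
    intro n
    induction n with
    | zero => simp [Module.End.one_eq_id]
    | succ n ih =>
      rw [pow_succ', Module.End.mul_apply, ih]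
      change lieDer (linearField b S) _ = _
      rw [lieDer_linearField_linearSeries, LinearMap.comp_assoc, pow_succ, Module.End.mul_eq_comp]
  have h : φ ∘ₗ aeval S q = ∑ i ∈ Finset.range (q.natDegree + 1), q.coeff i • (φ ∘ₗ (S ^ i)) := by
    ext x
    simp [aeval_eq_sum_range, LinearMap.sum_apply]
  rw [h, aeval_eq_sum_range, LinearMap.sum_apply, map_sum]
  exact Finset.sum_congr rfl fun i _ => by rw [LinearMap.smul_apply, hpow, map_smul]

/-- A linear function that vanishes on the center space is, modulo any order, a sum of two
derivatives `L_v g` with `β(g, L_v g) = 0`, for an `L_v`-invariant form `β` that only depends on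
jets of finite order. -/
theorem exists_lieDer_approximation (b : Module.Basis ι ℝ V)
    {v : ι → MvPowerSeries ι ℝ} (hv : ∀ i, MvPowerSeries.constantCoeff (v i) = 0)
    {S N : Module.End ℝ V} (hSN : IsJordanDecomposition (linearPart b v) S N)
    (hcomm : ⁅lieDer (linearField b S), lieDer (higherOrderPart b v)⁆ = 0)
    {β : MvPowerSeries ι ℝ →ₗ[ℝ] MvPowerSeries ι ℝ →ₗ[ℝ] ℝ}
    (hβ : ∀ f g, β (lieDer v f) g = - β f (lieDer v g)) {m : ℕ}
    (hβl : ∀ f ∈ orderIdeal ι m, ∀ g, β f g = 0) (hβr : ∀ f, ∀ g ∈ orderIdeal ι m, β f g = 0)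
    {φ : Module.Dual ℝ V} (hφ : φ ∈ (centerSpace (linearPart b v)).dualAnnihilator) (k : ℕ) :
    ∃ g₁ g₂, linearSeries b φ - (lieDer v g₁ + lieDer v g₂) ∈ orderIdeal ι k ∧
      β g₁ (lieDer v g₁) = 0 ∧ β g₂ (lieDer v g₂) = 0 := by
  have : FiniteDimensional ℝ V := b.finiteDimensional_of_finite
  set T := (lieDer v).toLinearMap with hT
  set L := (lieDer (linearField b S)).toLinearMap with hL
  have hTL : Commute T L := (commute_lieDer b hSN hcomm).symm
  have hTW : ∀ k, ∀ f ∈ (orderIdeal ι k).restrictScalars ℝ,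
      T f ∈ (orderIdeal ι k).restrictScalars ℝ := fun k f hf =>
    lieDer_mem_orderIdeal (fun i => mem_orderIdeal_one.mpr (hv i)) hf
  have key : ∀ (ψ : Module.Dual ℝ V) (q : ℝ[X]), IsCoprime q (q.comp (-X)) →
      ψ ∘ₗ aeval S q = 0 → ∃ g, linearSeries b ψ - T g ∈ orderIdeal ι k ∧ β g (T g) = 0 := by
    intro ψ q hq hψ
    -- Order `k` is the required precision and order `m` puts the error in the radical of `β`, so
    -- the maximum serves both.
    obtain ⟨r, hr⟩ := exists_nilpotent_difference b hv hSN (max k m)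
    obtain ⟨U, hUT, hUL, hU⟩ := exists_aeval_sub_eq_mul hTL q
    have hUD : Commute (T - L) U := (hUT.sub_right hUL).symm
    have hDL : Commute (aeval L q) (T - L) := by
      have h1 : Commute T (aeval L q) := commute_aeval hTL q
      have h2 : Commute L (aeval L q) := commute_aeval (Commute.refl L) q
      exact (h1.sub_left h2).symm
    have hUq : Commute (aeval L q) U := (commute_aeval hUL q).symm
    have hcop : IsCoprime (q ^ r) ((q ^ r).comp (-X)) := by
      rw [pow_comp]
      exact hq.pow
    have hmem : aeval T (q ^ r) (linearSeries b ψ) ∈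
        (orderIdeal ι (max k m)).restrictScalars ℝ := by
      -- On the linear function, `q(L)` vanishes, so `q(T) ^ r` acts as `((T - L) U) ^ r = (T - L) ^
      -- r U ^ r`, which raises the order. This is why `q ^ r` replaces `q`.
      rw [map_pow, hU, add_pow_apply_of_apply_eq_zero (hDL.mul_right hUq)
        (by rw [hL, aeval_lieDer_linearSeries, hψ, map_zero]), hUD.mul_pow, Module.End.mul_apply,
        Module.End.pow_apply]
      exact hr _
    have hmax := orderIdeal_anti (ι := ι) (le_max_right k m)
    obtain ⟨g, hg, hg'⟩ := exists_sub_apply_mem (hTW _) hβ (fun f hf => hβl f (hmax hf))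
      (fun f g hg => hβr f g (hmax hg)) hcop hmem
    exact ⟨g, orderIdeal_anti (le_max_left k m) hg, hg'⟩
  obtain ⟨φ₁, φ₂, q₁, q₂, rfl, h1, h2, h3, h4⟩ := exists_add_of_mem_dualAnnihilator hSN hφ
  obtain ⟨g₁, hg₁, hg₁'⟩ := key φ₁ q₁ h1 h3
  obtain ⟨g₂, hg₂, hg₂'⟩ := key φ₂ q₂ h2 h4
  refine ⟨g₁, g₂, ?_, hg₁', hg₂'⟩
  rw [map_add, add_sub_add_comm]
  exact Ideal.add_mem _ hg₁ hg₂

end CenterSpace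

/-! ### Topology of the jet algebras -/

section JetTopology

variable {ι : Type*} {𝔨 : Type*} [LieRing 𝔨] [LieAlgebra ℝ 𝔨]

lemma jetCoeff_tmul (n : ι →₀ ℕ) (f : MvPowerSeries ι ℝ) (X : 𝔨) :
    jetCoeff n (f ⊗ₜ[ℝ] X) = MvPowerSeries.coeff n f • X := by
  simp [jetCoeff]

/-- The subspace of jets without terms of degree less than `k`. -/
def jetIdeal (ι : Type*) (𝔨 : Type*) [LieRing 𝔨] [LieAlgebra ℝ 𝔨] (k : ℕ) :
    Submodule ℝ (JetAlg ι 𝔨) :=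
  Submodule.span ℝ {ξ | ∃ f ∈ orderIdeal ι k, ∃ X : 𝔨, f ⊗ₜ[ℝ] X = ξ}

lemma tmul_mem_jetIdeal {k : ℕ} {f : MvPowerSeries ι ℝ} (hf : f ∈ orderIdeal ι k) (X : 𝔨) :
    f ⊗ₜ[ℝ] X ∈ jetIdeal ι 𝔨 k :=
  Submodule.subset_span ⟨f, hf, X, rfl⟩

lemma jetIdeal_anti {j k : ℕ} (h : j ≤ k) : jetIdeal ι 𝔨 k ≤ jetIdeal ι 𝔨 j :=
  Submodule.span_mono fun _ ⟨f, hf, hX⟩ => ⟨f, orderIdeal_anti h hf, hX⟩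

lemma exists_sum_tmul_basis {d : ℕ} (e : Module.Basis (Fin d) ℝ 𝔨) (ξ : JetAlg ι 𝔨) :
    ∃ c : Fin d → MvPowerSeries ι ℝ, ξ = ∑ i, c i ⊗ₜ[ℝ] e i ∧
      ∀ n, jetCoeff n ξ = 0 → ∀ i, MvPowerSeries.coeff n (c i) = 0 := by
  have h : ξ = ∑ i, (TensorProduct.equivFinsuppOfBasisRight e ξ) i ⊗ₜ[ℝ] e i := by
    conv_lhs => rw [← (TensorProduct.equivFinsuppOfBasisRight e).symm_apply_apply ξ]
    rw [TensorProduct.equivFinsuppOfBasisRight_symm_apply, Finsupp.sum_fintype _ _ (by simp)]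
  refine ⟨_, h, fun n hn => ?_⟩
  rw [h, map_sum] at hn
  simp only [jetCoeff_tmul] at hn
  exact Fintype.linearIndependent_iff.mp e.linearIndependent _ hn

lemma mem_jetIdeal_iff [Module.Finite ℝ 𝔨] {k : ℕ} {ξ : JetAlg ι 𝔨} :
    ξ ∈ jetIdeal ι 𝔨 k ↔ ∀ n, n.degree < k → jetCoeff n ξ = 0 := by
  constructor
  · intro h n hn
    induction h using Submodule.span_induction with
    | mem x hx =>
      obtain ⟨f, hf, X, rfl⟩ := hx
      rw [jetCoeff_tmul, mem_orderIdeal_iff.mp hf n hn, zero_smul]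
    | zero => exact map_zero _
    | add x y _ _ hx hy => rw [map_add, hx, hy, add_zero]
    | smul r x _ hx => rw [map_smul, hx, smul_zero]
  · intro h
    obtain ⟨c, hc, hcoeff⟩ := exists_sum_tmul_basis (Module.finBasis ℝ 𝔨) ξ
    rw [hc]
    exact Submodule.sum_mem _ fun i _ =>
      tmul_mem_jetIdeal (mem_orderIdeal_iff.mpr fun n hn => hcoeff n (h n hn) i) _

lemma jet_ext [Module.Finite ℝ 𝔨] {ξ η : JetAlg ι 𝔨} (h : ∀ n, jetCoeff n ξ = jetCoeff n η) :
    ξ = η := by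
  rw [← sub_eq_zero]
  obtain ⟨c, hc, hcoeff⟩ := exists_sum_tmul_basis (Module.finBasis ℝ 𝔨) (ξ - η)
  rw [hc]
  refine Finset.sum_eq_zero fun i _ => ?_
  have : c i = 0 := by
    ext n
    exact hcoeff n (by rw [map_sub, h, sub_self]) i
  rw [this, zero_tmul]

lemma lie_mem_jetIdeal {k : ℕ} {ξ : JetAlg ι 𝔨} (hξ : ξ ∈ jetIdeal ι 𝔨 k) (η : JetAlg ι 𝔨) :
    ⁅ξ, η⁆ ∈ jetIdeal ι 𝔨 k := by
  induction hξ using Submodule.span_induction with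
  | mem x hx =>
    obtain ⟨f, hf, X, rfl⟩ := hx
    induction η using TensorProduct.induction_on with
    | zero => rw [lie_zero (f ⊗ₜ[ℝ] X)]; exact zero_mem _
    | add a b ha hb => rw [lie_add (f ⊗ₜ[ℝ] X) a b]; exact add_mem ha hb
    | tmul g Y =>
      rw [LieAlgebra.ExtendScalars.bracket_tmul]
      exact tmul_mem_jetIdeal (Ideal.mul_mem_right g _ hf) _
  | zero => rw [zero_lie η]; exact zero_mem _
  | add x y _ _ hx hy => rw [add_lie x y η]; exact add_mem hx hy
  | smul r x _ hx => rw [smul_lie r x η]; exact Submodule.smul_mem _ _ hx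

lemma jetDerivation_tmul [Fintype ι] (v : ι → MvPowerSeries ι ℝ) (σ : JetAlg ι 𝔨)
    (f : MvPowerSeries ι ℝ) (X : 𝔨) :
    jetDerivation v σ (f ⊗ₜ[ℝ] X) = - (lieDer v f ⊗ₜ[ℝ] X) + ⁅σ, f ⊗ₜ[ℝ] X⁆ := by
  simp [jetDerivation]

lemma jetDerivation_mem_jetIdeal [Fintype ι] {v : ι → MvPowerSeries ι ℝ}
    (hv : ∀ i, MvPowerSeries.constantCoeff (v i) = 0) (σ : JetAlg ι 𝔨) {k : ℕ} {ξ : JetAlg ι 𝔨}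
    (hξ : ξ ∈ jetIdeal ι 𝔨 k) : jetDerivation v σ ξ ∈ jetIdeal ι 𝔨 k := by
  induction hξ using Submodule.span_induction with
  | mem x hx =>
    obtain ⟨f, hf, X, rfl⟩ := hx
    rw [jetDerivation_tmul]
    refine add_mem (neg_mem (tmul_mem_jetIdeal ?_ X)) ?_
    · exact lieDer_mem_orderIdeal (fun i => mem_orderIdeal_one.mpr (hv i)) hf
    · rw [← lie_skew σ (f ⊗ₜ[ℝ] X)]
      exact neg_mem (lie_mem_jetIdeal (tmul_mem_jetIdeal hf X) σ)
  | zero => rw [map_zero]; exact zero_mem _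
  | add x y _ _ hx hy => rw [map_add]; exact add_mem hx hy
  | smul r x _ hx => rw [map_smul]; exact Submodule.smul_mem _ _ hx

variable [TopologicalSpace 𝔨]

/-- The coefficients of a jet. -/
noncomputable def jetCoords (ι : Type*) (𝔨 : Type*) [LieRing 𝔨] [LieAlgebra ℝ 𝔨] :
    JetAlg ι 𝔨 →ₗ[ℝ] (ι →₀ ℕ) → 𝔨 :=
  LinearMap.pi jetCoeff

lemma isInducing_jetCoords : IsInducing (jetCoords ι 𝔨) := ⟨rfl⟩

lemma continuous_jetCoeff (n : ι →₀ ℕ) : Continuous (jetCoeff n : JetAlg ι 𝔨 → 𝔨) :=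
  (continuous_apply n).comp isInducing_jetCoords.continuous

/-- A neighbourhood in the product topology constrains only finitely many coefficients, and `k + 1`
exceeds the degrees of all of them. -/
lemma exists_jetIdeal_subset [Module.Finite ℝ 𝔨] {U : Set (JetAlg ι 𝔨)} (hU : U ∈ 𝓝 0) :
    ∃ k, (jetIdeal ι 𝔨 k : Set (JetAlg ι 𝔨)) ⊆ U := by
  rw [isInducing_jetCoords.nhds_eq_comap, mem_comap] at hU
  obtain ⟨W, hW, hWU⟩ := hU
  rw [nhds_pi, Filter.mem_pi] at hW
  obtain ⟨I, hI, t, ht, htW⟩ := hW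
  obtain ⟨k, hk⟩ := (hI.image Finsupp.degree).bddAbove
  refine ⟨k + 1, fun ξ hξ => hWU (htW fun n hn => ?_)⟩
  have h1 := mem_jetIdeal_iff.mp hξ n (Nat.lt_succ_of_le (hk ⟨n, hn, rfl⟩))
  have h2 : jetCoords ι 𝔨 ξ n = 0 := h1
  rw [h2]
  have := mem_of_mem_nhds (ht n)
  rwa [map_zero] at this

lemma exists_jetIdeal_map_eq_zero [Module.Finite ℝ 𝔨] {G : Type*} [NormedAddCommGroup G]
    [NormedSpace ℝ G] (f : JetAlg ι 𝔨 →ₗ[ℝ] G) (hf : Continuous f) :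
    ∃ k, ∀ ξ ∈ jetIdeal ι 𝔨 k, f ξ = 0 := by
  have hU : f ⁻¹' Metric.ball 0 1 ∈ 𝓝 0 :=
    hf.continuousAt.preimage_mem_nhds (by rw [map_zero]; exact Metric.ball_mem_nhds 0 one_pos)
  obtain ⟨k, hk⟩ := exists_jetIdeal_subset hU
  refine ⟨k, fun ξ hξ => ?_⟩
  by_contra h0
  -- A linear subspace mapped into the unit ball is mapped to zero: rescaling `ξ` would give an
  -- image of norm one.
  have h1 := hk (Submodule.smul_mem _ (‖f ξ‖⁻¹) hξ)
  rw [Set.mem_preimage, map_smul, mem_ball_zero_iff, norm_smul, norm_inv, norm_norm,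
    inv_mul_cancel₀ (norm_ne_zero_iff.mpr h0)] at h1
  exact lt_irrefl _ h1

variable [Fintype ι] (v : ι → MvPowerSeries ι ℝ) (σ : JetAlg ι 𝔨)

/-- The coefficients of an element of `(R ⊗ 𝔨) ⋊ ℝ`. -/
noncomputable def sharpCoords : JetSharp v σ →ₗ[ℝ] ((ι →₀ ℕ) → 𝔨) × ℝ where
  toFun x := (jetCoords ι 𝔨 x.left, x.right)
  map_add' x y := by simp
  map_smul' r x := by simp

lemma isInducing_sharpCoords : IsInducing (sharpCoords v σ) :=
  (isInducing_jetCoords.prodMap IsInducing.id).comp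
    (⟨rfl⟩ : IsInducing fun x : JetSharp v σ => (x.left, x.right))

lemma continuous_jetIncl : Continuous (jetIncl v σ) := by
  rw [(isInducing_sharpCoords v σ).continuous_iff]
  exact isInducing_jetCoords.continuous.prodMk continuous_const

variable {v σ} (ω : ScalarCocycle (JetSharp v σ))

/-- The coefficients of an element of the central extension of `(R ⊗ 𝔨) ⋊ ℝ`. -/
noncomputable def centralCoords :
    LieAlgebra.ofTwoCocycle ω →ₗ[ℝ] (((ι →₀ ℕ) → 𝔨) × ℝ) × ℝ where
  toFun x := (sharpCoords v σ x.carrier.1, TrivialLieModule.equiv ℝ (JetSharp v σ) ℝ x.carrier.2)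
  map_add' x y := Prod.ext (map_add (sharpCoords v σ) x.carrier.1 y.carrier.1) rfl
  map_smul' r x := Prod.ext (map_smul (sharpCoords v σ) r x.carrier.1) rfl

lemma isInducing_centralCoords : IsInducing (centralCoords ω) :=
  ((isInducing_sharpCoords v σ).prodMap (IsInducing.id (X := ℝ))).comp
    (⟨rfl⟩ : IsInducing fun x : LieAlgebra.ofTwoCocycle ω =>
      (x.carrier.1, TrivialLieModule.equiv ℝ (JetSharp v σ) ℝ x.carrier.2))

/-- The linear embedding of `R ⊗ 𝔨` in the central extension. -/
noncomputable def centralJet : JetAlg ι 𝔨 →ₗ[ℝ] LieAlgebra.ofTwoCocycle ω where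
  toFun ξ := centralMk ω (jetIncl v σ ξ) 0
  map_add' ξ η := by
    simp [centralMk, ← LieAlgebra.of_add]
  map_smul' r ξ := by
    simp [centralMk, ← LieAlgebra.of_smul]

lemma continuous_centralJet : Continuous (centralJet ω) := by
  rw [(isInducing_centralCoords ω).continuous_iff]
  exact ((isInducing_sharpCoords v σ).continuous.comp (continuous_jetIncl v σ)).prodMk
    (continuous_const : Continuous fun _ : JetAlg ι 𝔨 => (0 : ℝ))

variable [IsTopologicalAddGroup 𝔨] [ContinuousSMul ℝ 𝔨]

omit [IsTopologicalAddGroup 𝔨] in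
lemma continuousSMul_jetSharp : ContinuousSMul ℝ (JetSharp v σ) :=
  (isInducing_sharpCoords v σ).continuousSMul continuous_id fun {c x} => map_smul _ c x

omit [ContinuousSMul ℝ 𝔨] in
lemma isTopologicalAddGroup_central : IsTopologicalAddGroup (LieAlgebra.ofTwoCocycle ω) :=
  (isInducing_centralCoords ω).topologicalAddGroup

omit [IsTopologicalAddGroup 𝔨] in
lemma continuousSMul_central : ContinuousSMul ℝ (LieAlgebra.ofTwoCocycle ω) :=
  (isInducing_centralCoords ω).continuousSMul continuous_id fun {c x} => map_smul _ c x

variable [Module.Finite ℝ 𝔨]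

omit [IsTopologicalAddGroup 𝔨] in
-- Joint continuity bounds the cocycle by `1` on a product of neighbourhoods. The first contains a
-- jet ideal, which is stable under scaling, and every `y` can be scaled into the second, so the
-- bound forces the value zero.
lemma exists_jetIdeal_cocycle_eq_zero (hω : IsContinuousCocycle ω) :
    ∃ k, ∀ ξ ∈ jetIdeal ι 𝔨 k, ∀ y, ω.1 (jetIncl v σ ξ) y = 0 := by
  have := continuousSMul_jetSharp (v := v) (σ := σ)
  set B : JetSharp v σ → JetSharp v σ → ℝ := fun x y =>
    TrivialLieModule.equiv ℝ (JetSharp v σ) ℝ (ω.1 x y) with hB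
  have hsmul : ∀ (s t : ℝ) x y, B (s • x) (t • y) = s * (t * B x y) := by
    intro s t x y
    simp only [hB, map_smul, LinearMap.smul_apply, smul_eq_mul]
    ring
  have h0 : B 0 0 = 0 := by simpa using hsmul 0 0 0 0
  have hU : {p : JetSharp v σ × JetSharp v σ | B p.1 p.2 < 1} ∈ 𝓝 ((0, 0) : _ × _) :=
    (hω.tendsto (0, 0)).eventually_lt_const
      (show B 0 0 < 1 from h0.trans_lt one_pos)
  rw [mem_nhds_prod_iff] at hU
  obtain ⟨U, hU, U', hU', hUU⟩ := hU
  obtain ⟨k, hk⟩ := exists_jetIdeal_subset (U := jetIncl v σ ⁻¹' U)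
    ((continuous_jetIncl v σ).continuousAt.preimage_mem_nhds (by rwa [map_zero]))
  refine ⟨k, fun ξ hξ y => ?_⟩
  have hy : Tendsto (fun t : ℝ => t • y) (𝓝[≠] 0) (𝓝 0) := by
    have h : Continuous fun t : ℝ => t • y := continuous_id.smul continuous_const
    simpa only [zero_smul] using (h.tendsto 0).mono_left nhdsWithin_le_nhds
  obtain ⟨t, htU, ht⟩ := ((hy.eventually hU').and self_mem_nhdsWithin).exists
  by_contra hne
  have hne' : B (jetIncl v σ ξ) y ≠ 0 := fun h =>
    hne ((TrivialLieModule.equiv ℝ (JetSharp v σ) ℝ).map_eq_zero_iff.mp h)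
  have ht' : t ≠ 0 := ht
  have h1 := hUU (Set.mk_mem_prod (hk (Submodule.smul_mem _ (t * B (jetIncl v σ ξ) y)⁻¹ hξ)) htU)
  have h2 : B (jetIncl v σ ((t * B (jetIncl v σ ξ) y)⁻¹ • ξ)) (t • y) < 1 := h1
  rw [map_smul, hsmul, inv_mul_cancel₀ (mul_ne_zero ht' hne')] at h2
  exact lt_irrefl _ h2

variable [T2Space 𝔨]

omit [IsTopologicalAddGroup 𝔨] [ContinuousSMul ℝ 𝔨] in
lemma t2Space_central : T2Space (LieAlgebra.ofTwoCocycle ω) := by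
  refine T2Space.of_injective_continuous ?_ (isInducing_centralCoords ω).continuous
  rw [injective_iff_map_eq_zero]
  rintro ⟨⟨⟨ξ, t⟩, z⟩⟩ h
  have hξ : ξ = 0 := jet_ext fun n =>
    (congrFun (congrArg (fun q => q.1.1) h) n).trans (map_zero (jetCoeff n)).symm
  have ht : t = 0 := congrArg (fun q => q.1.2) h
  have hz : z = 0 :=
    (TrivialLieModule.equiv ℝ (JetSharp v σ) ℝ).map_eq_zero_iff.mp (congrArg (fun q => q.2) h)
  subst hξ ht hz
  rfl

lemma hasWeakTopology_central : HasWeakTopology (LieAlgebra.ofTwoCocycle ω) :=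
  (((HasWeakTopology.pi fun _ => hasWeakTopology_of_finite).prod hasWeakTopology_real).prod
    hasWeakTopology_real).of_isInducing (centralCoords ω) (isInducing_centralCoords ω)

omit [TopologicalSpace 𝔨] [IsTopologicalAddGroup 𝔨] [ContinuousSMul ℝ 𝔨] [Module.Finite ℝ 𝔨]
  [T2Space 𝔨] in
-- Vanishing of `v` at the origin makes the derivation preserve the order, and vanishing of `ω`
-- removes the central term, so the jets of order `k` embed as an ideal of the central extension.
lemma lie_central_of_jetIdeal (hv : ∀ i, MvPowerSeries.constantCoeff (v i) = 0) {k : ℕ}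
    (hk : ∀ ξ ∈ jetIdeal ι 𝔨 k, ∀ y, ω.1 (jetIncl v σ ξ) y = 0) {ξ : JetAlg ι 𝔨}
    (hξ : ξ ∈ jetIdeal ι 𝔨 k) (y : LieAlgebra.ofTwoCocycle ω) :
    ∃ η ∈ jetIdeal ι 𝔨 k, ⁅centralJet ω ξ, y⁆ = centralJet ω η := by
  obtain ⟨⟨⟨η, t⟩, z⟩⟩ := y
  refine ⟨⁅ξ, η⁆ - t • jetDerivation v σ ξ, sub_mem (lie_mem_jetIdeal hξ η)
    (Submodule.smul_mem _ _ (jetDerivation_mem_jetIdeal hv σ hξ)), ?_⟩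
  have h1 : ⁅jetIncl v σ ξ, (⟨η, t⟩ : JetSharp v σ)⁆ =
      jetIncl v σ (⁅ξ, η⁆ - t • jetDerivation v σ ξ) := by
    have ht : oneParamAction (jetDerivation v σ) t ξ = t • jetDerivation v σ ξ := rfl
    have h0 : oneParamAction (jetDerivation v σ) 0 η = 0 := by rw [map_zero]; rfl
    change (⟨⁅ξ, η⁆ + oneParamAction (jetDerivation v σ) 0 η - oneParamAction (jetDerivation v σ) t ξ,
      ⁅(0 : ℝ), t⁆⟩ : JetSharp v σ) = ⟨⁅ξ, η⁆ - t • jetDerivation v σ ξ, 0⟩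
    rw [ht, h0, add_zero, zero_lie]
  have h3 : ∀ (x : JetSharp v σ) (z : TrivialLieModule ℝ (JetSharp v σ) ℝ), ⁅x, z⁆ = 0 :=
    fun x z => trivial_lie_zero _ _ x z
  have h2 := hk ξ hξ ⟨η, t⟩
  rw [LieAlgebra.bracket_ofTwoCocycle]
  change LieAlgebra.ofProd ω (⁅jetIncl v σ ξ, (⟨η, t⟩ : JetSharp v σ)⁆,
    ω.1 (jetIncl v σ ξ) ⟨η, t⟩ + ⁅jetIncl v σ ξ, z⁆ - ⁅(⟨η, t⟩ : JetSharp v σ), _⁆) = _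
  rw [h1, h2, h3, h3, add_zero, sub_zero]
  rfl

/-- The coefficients of degree less than `k` of an element of the central extension. -/
noncomputable def centralTrunc (k : ℕ) :
    LieAlgebra.ofTwoCocycle ω →L[ℝ] (({n : ι →₀ ℕ // n.degree < k} → 𝔨) × ℝ) × ℝ where
  toLinearMap := ((LinearMap.funLeft ℝ 𝔨 Subtype.val).prodMap .id).prodMap .id ∘ₗ centralCoords ω
  cont := (((continuous_pi fun _ => continuous_apply _).prodMap continuous_id).prodMap
    continuous_id).comp (isInducing_centralCoords ω).continuous

omit [IsTopologicalAddGroup 𝔨] [ContinuousSMul ℝ 𝔨] [T2Space 𝔨] in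
lemma centralTrunc_eq_zero_iff {k : ℕ} {x : LieAlgebra.ofTwoCocycle ω} :
    centralTrunc ω k x = 0 ↔ ∃ ξ ∈ jetIdeal ι 𝔨 k, x = centralJet ω ξ := by
  constructor
  · obtain ⟨⟨⟨ξ, t⟩, z⟩⟩ := x
    intro h
    have hξ : ξ ∈ jetIdeal ι 𝔨 k := mem_jetIdeal_iff.mpr fun n hn =>
      congrFun (congrArg (fun q => q.1.1) h) ⟨n, hn⟩
    have ht : t = 0 := congrArg (fun q => q.1.2) h
    have hz : z = 0 :=
      (TrivialLieModule.equiv ℝ (JetSharp v σ) ℝ).map_eq_zero_iff.mp (congrArg (fun q => q.2) h)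
    subst ht hz
    exact ⟨ξ, hξ, rfl⟩
  · rintro ⟨ξ, hξ, rfl⟩
    exact Prod.ext (Prod.ext (funext fun n => mem_jetIdeal_iff.mp hξ n n.2) rfl) rfl

/-- For `k` large enough for both the cocycle and the functional, truncation below degree `k` has
finite-dimensional target, and its kernel is an ideal on which `l` vanishes. -/
lemma hasFiniteFactor_central (hv : ∀ i, MvPowerSeries.constantCoeff (v i) = 0)
    (hω : IsContinuousCocycle ω) (l : LieAlgebra.ofTwoCocycle ω →L[ℝ] ℝ) : HasFiniteFactor l := by
  obtain ⟨k₁, hk₁⟩ := exists_jetIdeal_cocycle_eq_zero ω hω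
  obtain ⟨k₂, hk₂⟩ := exists_jetIdeal_map_eq_zero (l.toLinearMap ∘ₗ centralJet ω)
    (l.continuous.comp (continuous_centralJet ω))
  set k := max k₁ k₂
  have : Finite {n : ι →₀ ℕ // n.degree < k} :=
    ((Finsupp.finite_of_degree_le k).subset fun n (hn : n.degree < k) => hn.le).to_subtype
  have : Fintype {n : ι →₀ ℕ // n.degree < k} := Fintype.ofFinite _
  let e : ((({n : ι →₀ ℕ // n.degree < k} → 𝔨) × ℝ) × ℝ) ≃L[ℝ]
      (Fin (Module.finrank ℝ ((({n : ι →₀ ℕ // n.degree < k} → 𝔨) × ℝ) × ℝ)) → ℝ) :=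
    ContinuousLinearEquiv.ofFinrankEq (by rw [Module.finrank_fin_fun])
  have he : ∀ x, e (centralTrunc ω k x) = 0 ↔ ∃ ξ ∈ jetIdeal ι 𝔨 k, x = centralJet ω ξ := fun x =>
    e.map_eq_zero_iff.trans (centralTrunc_eq_zero_iff ω)
  refine ⟨_, e.toContinuousLinearMap.comp (centralTrunc ω k), fun x y hx => (he _).mpr ?_,
    fun x hx => ?_⟩
  · obtain ⟨ξ, hξ, rfl⟩ := (he x).mp hx
    exact lie_central_of_jetIdeal ω hv
      (fun ξ hξ => hk₁ ξ (jetIdeal_anti (le_max_left _ _) hξ)) hξ y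
  · obtain ⟨ξ, hξ, rfl⟩ := (he x).mp hx
    exact hk₂ ξ (jetIdeal_anti (le_max_right _ _) hξ)

end JetTopology

/-! ### The kernel of a projective representation of positive energy -/

section Projective

variable {𝓓 : Type*} [NormedAddCommGroup 𝓓] [InnerProductSpace ℂ 𝓓]

/-- An operator for which every vector is an eigenvector is a scalar, and a skew scalar is
imaginary. -/
lemma projSkewOps_eq_zero {x : projSkewOps 𝓓} (h : ∀ ψ ≠ 0, rayAction ψ x = 0) : x = 0 := by
  obtain ⟨X, rfl⟩ := Submodule.Quotient.mk_surjective _ x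
  have hX : ∀ ψ : 𝓓, ∃ c : ℂ, c • ψ = (X : Module.End ℂ 𝓓) ψ := by
    intro ψ
    by_cases hψ : ψ = 0
    · exact ⟨0, by simp [hψ]⟩
    · have h1 : (ℂ ∙ ψ).mkQ ((X : Module.End ℂ 𝓓) ψ) = 0 := h ψ hψ
      rw [Submodule.mkQ_apply, Submodule.Quotient.mk_eq_zero] at h1
      exact Submodule.mem_span_singleton.mp h1
  obtain ⟨c, hc⟩ := LinearMap.exists_eq_smul_id_of_forall_notLinearIndependent
    (f := (X : Module.End ℂ 𝓓)) fun ψ hψ => by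
      obtain ⟨c, hc⟩ := hX ψ
      have := LinearIndependent.pair_iff.mp hψ c (-1) (by rw [hc, neg_one_smul, add_neg_cancel])
      exact one_ne_zero (neg_eq_zero.mp this.2)
  by_cases h𝓓 : ∃ ψ : 𝓓, ψ ≠ 0
  · obtain ⟨ψ, hψ⟩ := h𝓓
    have h1 := X.2 ψ ψ
    rw [hc, LinearMap.smul_apply, Module.End.one_apply, inner_smul_left, inner_smul_right,
      ← neg_mul] at h1
    have h2 := mul_right_cancel₀ (inner_self_ne_zero.mpr hψ) h1
    have h3 : c.re = 0 := by
      have := congrArg Complex.re h2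
      rw [Complex.conj_re, Complex.neg_re] at this
      linarith
    refine (Submodule.Quotient.mk_eq_zero _).mpr ⟨c.im, ?_⟩
    rw [hc]
    congr 1
    exact Complex.ext (by simp [h3]) (by simp)
  · push Not at h𝓓
    refine (Submodule.Quotient.mk_eq_zero _).mpr ⟨0, LinearMap.ext fun ψ => ?_⟩
    rw [h𝓓 ψ, map_zero, map_zero]

end Projective

section Simple

variable {𝔨 : Type*} [LieRing 𝔨] [LieAlgebra ℝ 𝔨]

/-- Otherwise the abelian line spanned by any nonzero `X` would be strictly larger. -/
lemma exists_ne_zero_mem_of_maximal [Nontrivial 𝔨] {𝔱 : LieSubalgebra ℝ 𝔨}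
    (h𝔱 : Maximal (fun s : LieSubalgebra ℝ 𝔨 => IsLieAbelian s) 𝔱) : ∃ H ∈ 𝔱, H ≠ 0 := by
  obtain ⟨X, hX⟩ := exists_ne (0 : 𝔨)
  have hlie : ∀ {x y : 𝔨}, x ∈ ℝ ∙ X → y ∈ ℝ ∙ X → ⁅x, y⁆ = 0 := by
    intro x y hx hy
    obtain ⟨a, rfl⟩ := Submodule.mem_span_singleton.mp hx
    obtain ⟨b, rfl⟩ := Submodule.mem_span_singleton.mp hy
    rw [smul_lie, lie_smul, lie_self, smul_zero, smul_zero]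
  let s : LieSubalgebra ℝ 𝔨 :=
    { ℝ ∙ X with lie_mem' := fun hx hy => by rw [hlie hx hy]; exact zero_mem (ℝ ∙ X) }
  have hs : IsLieAbelian s := ⟨fun x y => Subtype.ext (hlie x.2 y.2)⟩
  by_contra! h
  have hle : 𝔱 ≤ s := fun x hx => by rw [h x hx]; exact zero_mem s
  exact hX (h X (h𝔱.le_of_ge hs hle (Submodule.mem_span_singleton_self X)))

variable {ι : Type*}

lemma lie_tmul_eq_zero {𝔱 : LieSubalgebra ℝ 𝔨} (h𝔱 : IsLieAbelian 𝔱) {σ : JetAlg ι 𝔨}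
    (hσ : σ ∈ LinearMap.range
      (LinearMap.lTensor (MvPowerSeries ι ℝ) 𝔱.toSubmodule.subtype)) {H : 𝔨} (hH : H ∈ 𝔱)
    (f : MvPowerSeries ι ℝ) : ⁅σ, f ⊗ₜ[ℝ] H⁆ = 0 := by
  obtain ⟨τ, rfl⟩ := hσ
  induction τ using TensorProduct.induction_on with
  | zero => rw [map_zero]; exact zero_lie (f ⊗ₜ[ℝ] H)
  | add a b ha hb =>
    rw [map_add]
    exact (add_lie _ _ (f ⊗ₜ[ℝ] H)).trans (by rw [ha, hb, add_zero])
  | tmul g Y =>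
    have h : ⁅(Y : 𝔨), H⁆ = 0 := congrArg Subtype.val (h𝔱.trivial Y ⟨H, hH⟩)
    rw [LinearMap.lTensor_tmul, LieAlgebra.ExtendScalars.bracket_tmul]
    change _ ⊗ₜ[ℝ] ⁅(Y : 𝔨), H⁆ = 0
    rw [h, tmul_zero]

end Simple

section Kernel

variable {n : ℕ} {𝔨 : Type*} [LieRing 𝔨] [LieAlgebra ℝ 𝔨] [TopologicalSpace 𝔨]
  [Module.Finite ℝ 𝔨]
  {v : Fin n → MvPowerSeries (Fin n) ℝ} {σ : JetAlg (Fin n) 𝔨}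
  {𝓓 : Type*} [NormedAddCommGroup 𝓓] [InnerProductSpace ℂ 𝓓]
  {πbar : JetSharp v σ →ₗ⁅ℝ⁆ projSkewOps 𝓓}

/-- For each ray the continuous map to `𝓓 / ℂψ` sees only finitely many coefficients, so an
approximation of high enough order gives exact vanishing; the order may depend on `ψ`. -/
lemma map_jetIncl_eq_zero_of_approximation (hcont : IsContinuousProjRep πbar)
    {ξ : JetAlg (Fin n) 𝔨}
    (h : ∀ k, ∃ η, ξ - η ∈ jetIdeal (Fin n) 𝔨 k ∧ πbar (jetIncl v σ η) = 0) :
    πbar (jetIncl v σ ξ) = 0 := by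
  refine projSkewOps_eq_zero fun ψ hψ => ?_
  -- Closedness of the line makes the quotient a normed space.
  have : IsClosed ((ℂ ∙ ψ : Submodule ℂ 𝓓) : Set 𝓓) := Submodule.closed_of_finiteDimensional _
  let F : JetAlg (Fin n) 𝔨 →ₗ[ℝ] 𝓓 ⧸ (ℂ ∙ ψ) :=
    (rayAction ψ).comp ((πbar : JetSharp v σ →ₗ[ℝ] projSkewOps 𝓓).comp
      (jetIncl v σ : JetAlg (Fin n) 𝔨 →ₗ[ℝ] JetSharp v σ))
  have hF : Continuous F := (hcont ψ hψ).comp (continuous_jetIncl v σ)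
  obtain ⟨k, hk⟩ := exists_jetIdeal_map_eq_zero F hF
  obtain ⟨η, hη, h0⟩ := h k
  have h1 := hk _ hη
  rw [map_sub, sub_eq_zero] at h1
  refine Eq.trans h1 ?_
  change rayAction ψ (πbar (jetIncl v σ η)) = 0
  rw [h0, map_zero]

end Kernel

/-! ### Brackets with the generator and the form defined by the cocycle. -/

section Commutator

variable {𝔥 : Type*} [LieRing 𝔥] [LieAlgebra ℝ 𝔥]

lemma lie_centralMk (ω : ScalarCocycle 𝔥) (x y : 𝔥) (a b : ℝ) :
    ⁅centralMk ω x a, centralMk ω y b⁆ =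
      centralMk ω ⁅x, y⁆ (TrivialLieModule.equiv ℝ 𝔥 ℝ (ω.1 x y)) := by
  have h : ∀ (x : 𝔥) (z : TrivialLieModule ℝ 𝔥 ℝ), ⁅x, z⁆ = 0 := fun x z => trivial_lie_zero _ _ x z
  rw [LieAlgebra.bracket_ofTwoCocycle]
  change LieAlgebra.ofProd ω (⁅x, y⁆, ω.1 x y + ⁅x, _⁆ - ⁅y, _⁆) = _
  rw [h, h, add_zero, sub_zero]
  rfl

lemma centralMk_zero (ω : ScalarCocycle 𝔥) : centralMk ω 0 0 = 0 := by
  rw [centralMk, map_zero]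
  rfl

variable {ι : Type*} [Fintype ι] {𝔨 : Type*} [LieRing 𝔨] [LieAlgebra ℝ 𝔨]
  {v : ι → MvPowerSeries ι ℝ} {σ : JetAlg ι 𝔨}

lemma lie_jetIncl_jetGenerator (ξ : JetAlg ι 𝔨) :
    ⁅jetIncl v σ ξ, jetGenerator v σ⁆ = jetIncl v σ (- jetDerivation v σ ξ) := by
  have h1 : oneParamAction (jetDerivation v σ) 1 ξ = jetDerivation v σ ξ := one_smul ℝ _
  have h0 : oneParamAction (jetDerivation v σ) 0 (0 : JetAlg ι 𝔨) = 0 := map_zero _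
  change (⟨⁅ξ, (0 : JetAlg ι 𝔨)⁆ + oneParamAction (jetDerivation v σ) 0 0 -
    oneParamAction (jetDerivation v σ) 1 ξ, ⁅(0 : ℝ), (1 : ℝ)⁆⟩ : JetSharp v σ) =
      ⟨- jetDerivation v σ ξ, 0⟩
  rw [h1, h0, lie_zero ξ, zero_lie, add_zero, zero_sub]

variable {H : 𝔨} (hH : ∀ f : MvPowerSeries ι ℝ, ⁅σ, f ⊗ₜ[ℝ] H⁆ = 0)

include hH in
lemma lie_jetIncl_tmul_jetGenerator (f : MvPowerSeries ι ℝ) :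
    ⁅jetIncl v σ (f ⊗ₜ[ℝ] H), jetGenerator v σ⁆ = jetIncl v σ (lieDer v f ⊗ₜ[ℝ] H) := by
  rw [lie_jetIncl_jetGenerator, jetDerivation_tmul, hH, add_zero, neg_neg]

lemma lie_jetIncl_tmul_self (f g : MvPowerSeries ι ℝ) (H : 𝔨) :
    ⁅jetIncl v σ (f ⊗ₜ[ℝ] H), jetIncl v σ (g ⊗ₜ[ℝ] H)⁆ = 0 := by
  rw [← LieHom.map_lie, LieAlgebra.ExtendScalars.bracket_tmul, lie_self, tmul_zero, map_zero]

/-- The bilinear form `(f, g) ↦ ω (f ⊗ H, g ⊗ H)` on power series. -/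
noncomputable def cocycleForm (ω : ScalarCocycle (JetSharp v σ)) (H : 𝔨) :
    MvPowerSeries ι ℝ →ₗ[ℝ] MvPowerSeries ι ℝ →ₗ[ℝ] ℝ :=
  LinearMap.mk₂ ℝ (fun f g => TrivialLieModule.equiv ℝ (JetSharp v σ) ℝ
      (ω.1 (jetIncl v σ (f ⊗ₜ[ℝ] H)) (jetIncl v σ (g ⊗ₜ[ℝ] H))))
    (fun f₁ f₂ g => by simp only [add_tmul, map_add, LinearMap.add_apply])
    (fun r f g => by simp only [← smul_tmul', map_smul, LinearMap.smul_apply])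
    (fun f g₁ g₂ => by simp only [add_tmul, map_add])
    (fun r f g => by simp only [← smul_tmul', map_smul])

lemma cocycleForm_apply (ω : ScalarCocycle (JetSharp v σ)) (H : 𝔨) (f g : MvPowerSeries ι ℝ) :
    cocycleForm ω H f g = TrivialLieModule.equiv ℝ (JetSharp v σ) ℝ
      (ω.1 (jetIncl v σ (f ⊗ₜ[ℝ] H)) (jetIncl v σ (g ⊗ₜ[ℝ] H))) := rfl

include hH in
-- This is the cocycle identity for `f ⊗ H`, `g ⊗ H` and `d`; the bracket of the first two vanishes
-- because both lie along the same `H`.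
lemma cocycleForm_lieDer (ω : ScalarCocycle (JetSharp v σ)) (f g : MvPowerSeries ι ℝ) :
    cocycleForm ω H (lieDer v f) g = - cocycleForm ω H f (lieDer v g) := by
  have h := (LieModule.Cohomology.mem_twoCocycle_iff_of_trivial _ _ _ ω.1).mp ω.2
    (jetIncl v σ (f ⊗ₜ[ℝ] H)) (jetIncl v σ (g ⊗ₜ[ℝ] H)) (jetGenerator v σ)
  rw [lie_jetIncl_tmul_self, map_zero, LinearMap.zero_apply, zero_add,
    lie_jetIncl_tmul_jetGenerator hH, lie_jetIncl_tmul_jetGenerator hH] at h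
  rw [cocycleForm_apply, cocycleForm_apply, h, ← LieModule.Cohomology.twoCochain_skew, map_neg]

end Commutator

/-! ### Spreading the kernel by simplicity of `𝔨`. -/

section Perfect

variable {𝔨 : Type*} [LieRing 𝔨] [LieAlgebra ℝ 𝔨]

lemma span_lie_eq_top [LieAlgebra.IsSimple ℝ 𝔨] :
    Submodule.span ℝ {Z : 𝔨 | ∃ X Y : 𝔨, ⁅X, Y⁆ = Z} = ⊤ := by
  let I : LieIdeal ℝ 𝔨 :=
    { Submodule.span ℝ {Z : 𝔨 | ∃ X Y : 𝔨, ⁅X, Y⁆ = Z} with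
      lie_mem := fun {x m} _ => Submodule.subset_span ⟨x, m, rfl⟩ }
  have hI : I = ⊤ := (LieAlgebra.IsSimple.eq_bot_or_eq_top I).resolve_left fun h =>
    LieAlgebra.IsSimple.non_abelian (R := ℝ) (L := 𝔨) ⟨fun x y => by
      have hxy : ⁅x, y⁆ ∈ I := Submodule.subset_span ⟨x, y, rfl⟩
      rwa [h, LieSubmodule.mem_bot] at hxy⟩
  exact congrArg LieSubmodule.toSubmodule hI

variable {ι : Type*} {𝔭 : Type*} [LieRing 𝔭] [LieAlgebra ℝ 𝔭]

/-- The ideal of power series `f` such that `f ⊗ X` is in the kernel of `ρ` for all `X`. -/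
noncomputable def kernelIdeal [LieAlgebra.IsSimple ℝ 𝔨] (ρ : JetAlg ι 𝔨 →ₗ⁅ℝ⁆ 𝔭) :
    Ideal (MvPowerSeries ι ℝ) where
  carrier := {f | ∀ X, ρ (f ⊗ₜ[ℝ] X) = 0}
  zero_mem' X := by rw [zero_tmul, map_zero]
  add_mem' {f g} hf hg X := by rw [add_tmul, map_add, hf X, hg X, add_zero]
  smul_mem' g f hf X := by
    have hX : X ∈ Submodule.span ℝ {Z : 𝔨 | ∃ X Y : 𝔨, ⁅X, Y⁆ = Z} :=
      by rw [span_lie_eq_top]; exact Submodule.mem_top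
    induction hX using Submodule.span_induction with
    | mem x hx =>
      obtain ⟨Y, Z, rfl⟩ := hx
      -- Since `𝔨` is perfect it suffices to treat `g f ⊗ ⁅Y, Z⁆ = ⁅g ⊗ Y, f ⊗ Z⁆`.
      rw [smul_eq_mul, ← LieAlgebra.ExtendScalars.bracket_tmul, LieHom.map_lie, hf Z, lie_zero]
    | zero => rw [tmul_zero, map_zero]
    | add x y _ _ hx hy => rw [tmul_add, map_add, hx, hy, add_zero]
    | smul r x _ hx => rw [tmul_smul, map_smul, hx, smul_zero]

/-- Because `f ⊗ ⁅Y, X⁆ = ⁅1 ⊗ Y, f ⊗ X⁆`, the elements `X` with `f ⊗ X` in the kernel form an ideal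
of `𝔨`; a single nonzero one makes it everything. -/
lemma mem_kernelIdeal_of_tmul [LieAlgebra.IsSimple ℝ 𝔨] (ρ : JetAlg ι 𝔨 →ₗ⁅ℝ⁆ 𝔭)
    {f : MvPowerSeries ι ℝ} {H : 𝔨} (hH : H ≠ 0) (hf : ρ (f ⊗ₜ[ℝ] H) = 0) :
    f ∈ kernelIdeal ρ := by
  let I : LieIdeal ℝ 𝔨 :=
    { carrier := {X | ρ (f ⊗ₜ[ℝ] X) = 0}
      zero_mem' := by simp
      add_mem' := fun {X Y} hX hY => by
        change ρ (f ⊗ₜ[ℝ] (X + Y)) = 0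
        rw [tmul_add, map_add, hX, hY, add_zero]
      smul_mem' := fun r X hX => by
        change ρ (f ⊗ₜ[ℝ] (r • X)) = 0
        rw [tmul_smul, map_smul, hX, smul_zero]
      lie_mem := fun {Y X} hX => by
        change ρ (f ⊗ₜ[ℝ] ⁅Y, X⁆) = 0
        rw [← one_mul f, ← LieAlgebra.ExtendScalars.bracket_tmul, LieHom.map_lie, hX, lie_zero] }
  have hI : I = ⊤ := (LieAlgebra.IsSimple.eq_bot_or_eq_top I).resolve_left fun h =>
    hH (LieSubmodule.mem_bot (R := ℝ) (L := 𝔨) H |>.mp (h ▸ hf : H ∈ (⊥ : LieIdeal ℝ 𝔨)))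
  intro X
  exact (hI ▸ LieSubmodule.mem_top X : X ∈ I)

end Perfect

/-! ### Positive energy applied to the jet algebra. -/

section Main

variable {V : Type*} [AddCommGroup V] [Module ℝ V] {n : ℕ} (b : Module.Basis (Fin n) ℝ V)
  {𝔨 : Type u} [LieRing 𝔨] [LieAlgebra ℝ 𝔨] [TopologicalSpace 𝔨] [T2Space 𝔨]
  [IsTopologicalAddGroup 𝔨] [ContinuousSMul ℝ 𝔨] [Module.Finite ℝ 𝔨]
  {v : Fin n → MvPowerSeries (Fin n) ℝ} (hv : ∀ i, MvPowerSeries.constantCoeff (v i) = 0)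
  {σ : JetAlg (Fin n) 𝔨} {H : 𝔨} (hH : ∀ f : MvPowerSeries (Fin n) ℝ, ⁅σ, f ⊗ₜ[ℝ] H⁆ = 0)
  {𝓓 : Type v} [NormedAddCommGroup 𝓓] [InnerProductSpace ℂ 𝓓]
  {πbar : JetSharp v σ →ₗ⁅ℝ⁆ projSkewOps 𝓓}

include hv hH in
-- With `x` over `g ⊗ H` and `y` over the generator, `⁅x, ⁅x, y⁆⁆` has no component in the jet
-- algebra, and its central component is `hg`.
lemma map_lieDer_tmul_eq_zero {ω : ScalarCocycle (JetSharp v σ)}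
    {π : LieAlgebra.ofTwoCocycle ω →ₗ⁅ℝ⁆ skewOps 𝓓} {z : ℝ} (hπ : IsLift πbar ω π)
    (hgpe : IsGPE.{_, _, w} π (centralMk ω (jetGenerator v σ) z)) {g : MvPowerSeries (Fin n) ℝ}
    (hg : cocycleForm ω H g (lieDer v g) = 0) :
    πbar (jetIncl v σ (lieDer v g ⊗ₜ[ℝ] H)) = 0 := by
  have := isTopologicalAddGroup_central ω
  have := continuousSMul_central ω
  have := t2Space_central ω
  have hxy : ⁅centralMk ω (jetIncl v σ (g ⊗ₜ[ℝ] H)) 0, centralMk ω (jetGenerator v σ) z⁆ =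
      centralMk ω (jetIncl v σ (lieDer v g ⊗ₜ[ℝ] H)) (TrivialLieModule.equiv ℝ (JetSharp v σ) ℝ
        (ω.1 (jetIncl v σ (g ⊗ₜ[ℝ] H)) (jetGenerator v σ))) := by
    rw [lie_centralMk, lie_jetIncl_tmul_jetGenerator hH]
  rw [← hπ.covers _ (TrivialLieModule.equiv ℝ (JetSharp v σ) ℝ
    (ω.1 (jetIncl v σ (g ⊗ₜ[ℝ] H)) (jetGenerator v σ))), ← hxy, IsGPE.map_lie_eq_zero (hasWeakTopology_central ω)
    (hasFiniteFactor_central ω hv hπ.continuous_cocycle) hπ.continuous_rep hgpe]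
  · rfl
  · rw [hxy, lie_centralMk, lie_jetIncl_tmul_self, ← cocycleForm_apply, hg, centralMk_zero]

include hv hH in
lemma annihilatorIdeal_le_kernelIdeal [LieAlgebra.IsSimple ℝ 𝔨] (hH0 : H ≠ 0)
    {S N : Module.End ℝ V} (hSN : IsJordanDecomposition (linearPart b v) S N)
    (hcomm : ⁅lieDer (linearField b S), lieDer (higherOrderPart b v)⁆ = 0)
    (hcont : IsContinuousProjRep πbar) (hgpe : IsProjGPE.{_, _, w} πbar (jetGenerator v σ)) :
    annihilatorIdeal b (centerSpace (linearPart b v)) ≤ kernelIdeal (πbar.comp (jetIncl v σ)) := by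
  obtain ⟨ω, π, z, hπ, hg⟩ := hgpe
  obtain ⟨m, hm⟩ := exists_jetIdeal_cocycle_eq_zero ω hπ.continuous_cocycle
  refine Ideal.span_le.mpr ?_
  rintro _ ⟨φ, hφ, rfl⟩
  refine mem_kernelIdeal_of_tmul _ hH0 (map_jetIncl_eq_zero_of_approximation hcont fun k => ?_)
  have hβl : ∀ f ∈ orderIdeal (Fin n) m, ∀ g, cocycleForm ω H f g = 0 := fun f hf g => by
    rw [cocycleForm_apply, hm _ (tmul_mem_jetIdeal hf H), map_zero]
  obtain ⟨g₁, g₂, h, h₁, h₂⟩ := exists_lieDer_approximation b hv hSN hcomm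
    (cocycleForm_lieDer hH ω) hβl (fun f g hg => by
      rw [cocycleForm_apply, ← LieModule.Cohomology.twoCochain_skew,
        hm _ (tmul_mem_jetIdeal hg H), neg_zero, map_zero]) hφ k
  refine ⟨(lieDer v g₁ + lieDer v g₂) ⊗ₜ[ℝ] H, ?_, ?_⟩
  · rw [← sub_tmul]
    exact tmul_mem_jetIdeal h H
  · rw [add_tmul, map_add, map_add, map_lieDer_tmul_eq_zero hv hH hπ hg h₁,
      map_lieDer_tmul_eq_zero hv hH hπ hg h₂, add_zero]

end Main

/-! ### Restriction to a subspace -/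

section Substitution

variable {ι κ : Type*}

lemma substAlgHom_mem_orderIdeal {a : ι → MvPowerSeries κ ℝ} (ha : MvPowerSeries.HasSubst a)
    (ha0 : ∀ i, MvPowerSeries.constantCoeff (a i) = 0) {k : ℕ} {f : MvPowerSeries ι ℝ}
    (hf : f ∈ orderIdeal ι k) :
    (MvPowerSeries.substAlgHom ha : MvPowerSeries ι ℝ →ₐ[ℝ] MvPowerSeries κ ℝ) f ∈
      orderIdeal κ k := by
  rw [mem_orderIdeal_iff_le] at hf ⊢
  rw [MvPowerSeries.substAlgHom_apply]
  have h1 : 1 ≤ ⨅ i, (a i).order := le_iInf fun i => by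
    have := mem_orderIdeal_iff_le.mp (mem_orderIdeal_one.mpr (ha0 i))
    exact_mod_cast this
  calc (k : ℕ∞) ≤ 1 * f.order := by rwa [one_mul]
    _ ≤ (⨅ i, (a i).order) * f.order := mul_le_mul_left h1 _
    _ ≤ _ := MvPowerSeries.le_order_subst ha f

variable {𝔨 : Type*} [LieRing 𝔨] [LieAlgebra ℝ 𝔨]

/-- An algebra homomorphism of power series rings that preserves the order filtration acts
continuously on jets. -/
lemma continuous_map_jet [Finite ι] [TopologicalSpace 𝔨] [IsTopologicalAddGroup 𝔨]
    [ContinuousSMul ℝ 𝔨] (θ : MvPowerSeries ι ℝ →ₐ[ℝ] MvPowerSeries κ ℝ)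
    (hθ : ∀ k, ∀ f ∈ orderIdeal ι k, θ f ∈ orderIdeal κ k) :
    Continuous (LieAlgebra.ExtendScalars.map θ (LieHom.id : 𝔨 →ₗ⁅ℝ⁆ 𝔨)) := by
  rw [isInducing_jetCoords.continuous_iff, continuous_pi_iff]
  intro n
  set s := (Finsupp.finite_of_degree_le (σ := ι) n.degree).toFinset
  have h : ∀ ξ : JetAlg ι 𝔨,
      jetCoeff n (LieAlgebra.ExtendScalars.map θ (LieHom.id : 𝔨 →ₗ⁅ℝ⁆ 𝔨) ξ) =
        ∑ d ∈ s, MvPowerSeries.coeff n (θ (MvPowerSeries.monomial d 1)) • jetCoeff d ξ := by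
    intro ξ
    induction ξ using TensorProduct.induction_on with
    | zero => simp
    | add x y hx hy => simp only [map_add, hx, hy, smul_add, Finset.sum_add_distrib]
    | tmul f X =>
      obtain ⟨g, hg, hf⟩ := exists_sum_monomial_add n.degree f
      have h0 : MvPowerSeries.coeff n (θ g) = 0 :=
        mem_orderIdeal_iff.mp (hθ _ g hg) n (Nat.lt_succ_self _)
      have h1 : MvPowerSeries.coeff n (θ f) =
          ∑ d ∈ s, MvPowerSeries.coeff n (θ (MvPowerSeries.monomial d 1)) *
            MvPowerSeries.coeff d f := by
        conv_lhs => rw [hf]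
        rw [map_add, map_add, h0, add_zero, map_sum, map_sum]
        exact Finset.sum_congr rfl fun d _ => by
          rw [map_smul, map_smul, smul_eq_mul, mul_comm]
      change jetCoeff n (θ f ⊗ₜ[ℝ] X) = _
      simp only [jetCoeff_tmul, h1, Finset.sum_smul, smul_smul]
  refine (continuous_finsetSum s fun d _ => (continuous_jetCoeff d).const_smul
    (MvPowerSeries.coeff n (θ (MvPowerSeries.monomial d 1)))).congr fun ξ => (h ξ).symm

end Substitution

section Restriction

variable {V : Type*} [AddCommGroup V] [Module ℝ V] {ι κ : Type*} [Fintype ι] [Fintype κ]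
  (b : Module.Basis ι ℝ V) {W : Submodule ℝ V} (c : Module.Basis κ ℝ W)

lemma constantCoeff_linearSeries (φ : Module.Dual ℝ V) :
    MvPowerSeries.constantCoeff (linearSeries b φ) = 0 := by
  simp [linearSeries]

lemma restrictSeries_mem_orderIdeal {k : ℕ} {f : MvPowerSeries ι ℝ} (hf : f ∈ orderIdeal ι k) :
    restrictSeries b c f ∈ orderIdeal κ k :=
  substAlgHom_mem_orderIdeal _ (fun _ => constantCoeff_linearSeries _ _) hf

/-- Extension of power series from `W` to `V` along a projection `P`. -/
noncomputable def extendSeries (P : V →ₗ[ℝ] W) : MvPowerSeries κ ℝ →ₐ[ℝ] MvPowerSeries ι ℝ :=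
  MvPowerSeries.substAlgHom (a := fun j => linearSeries b (c.coord j ∘ₗ P))
    (MvPowerSeries.hasSubst_of_constantCoeff_zero fun _ => constantCoeff_linearSeries _ _)

lemma extendSeries_mem_orderIdeal (P : V →ₗ[ℝ] W) {k : ℕ} {f : MvPowerSeries κ ℝ}
    (hf : f ∈ orderIdeal κ k) : extendSeries b c P f ∈ orderIdeal ι k :=
  substAlgHom_mem_orderIdeal _ (fun _ => constantCoeff_linearSeries _ _) hf

lemma extendSeries_linearSeries (P : V →ₗ[ℝ] W) (φ : Module.Dual ℝ W) :
    extendSeries b c P (linearSeries c φ) = linearSeries b (φ ∘ₗ P) := by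
  have h : φ ∘ₗ P = ∑ j, φ (c j) • (c.coord j ∘ₗ P) := by
    ext x
    have := congrArg φ (c.sum_repr (P x))
    rw [map_sum] at this
    simpa [mul_comm] using this.symm
  rw [h, map_sum]
  change extendSeries b c P (∑ j, φ (c j) • MvPowerSeries.X j) = _
  rw [map_sum]
  refine Finset.sum_congr rfl fun j _ => ?_
  rw [map_smul, map_smul, extendSeries, MvPowerSeries.substAlgHom_X]

variable {P : V →ₗ[ℝ] W} (hP : ∀ x : W, P x = x)

include hP in
lemma sub_extendSeries_restrictSeries_X_mem (i : ι) :
    MvPowerSeries.X i - extendSeries b c P (restrictSeries b c (MvPowerSeries.X i)) ∈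
      annihilatorIdeal b W := by
  rw [restrictSeries, MvPowerSeries.substAlgHom_X, restrictedCoordinate, extendSeries_linearSeries,
    ← linearSeries_coord b, ← map_sub]
  refine Ideal.subset_span ⟨_, ?_, rfl⟩
  rw [SetLike.mem_coe, Submodule.mem_dualAnnihilator]
  intro x hx
  have := hP ⟨x, hx⟩
  simp [this]

include hP in
-- Modulo the annihilator ideal, restricting and extending back fixes the coordinates. Two algebra
-- homomorphisms on polynomials that agree on the variables are equal; this does not apply directly
-- to power series.
lemma sub_extendSeries_restrictSeries_monomial_mem (d : ι →₀ ℕ) :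
    MvPowerSeries.monomial d 1 -
        extendSeries b c P (restrictSeries b c (MvPowerSeries.monomial d 1)) ∈
      annihilatorIdeal b W := by
  let q := Ideal.Quotient.mkₐ ℝ (annihilatorIdeal b W)
  have h : (q.comp ((extendSeries b c P).comp (restrictSeries b c))).comp
      (MvPolynomial.coeToMvPowerSeries.algHom (σ := ι) (R := ℝ) ℝ) =
        q.comp (MvPolynomial.coeToMvPowerSeries.algHom (σ := ι) (R := ℝ) ℝ) := by
    refine MvPolynomial.algHom_ext fun i => ?_
    have := Ideal.Quotient.eq.mpr (sub_extendSeries_restrictSeries_X_mem b c hP i)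
    simpa [q] using this.symm
  have := congrArg (fun f => f (MvPolynomial.monomial d 1)) h
  refine Ideal.Quotient.eq.mp ?_
  simpa [q] using this.symm

include hP in
-- The Taylor polynomial of `f` is handled monomial by monomial and the remainder has high order. An
-- approximate statement is enough, since continuity of the representation absorbs the remainder.
lemma exists_mem_annihilatorIdeal_sub_mem (f : MvPowerSeries ι ℝ) (k : ℕ) :
    ∃ g ∈ annihilatorIdeal b W,
      f - extendSeries b c P (restrictSeries b c f) - g ∈ orderIdeal ι k := by
  obtain ⟨g, hg, hf⟩ := exists_sum_monomial_add k f
  set s := (Finsupp.finite_of_degree_le (σ := ι) k).toFinset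
  refine ⟨∑ d ∈ s, MvPowerSeries.coeff d f • (MvPowerSeries.monomial d 1 -
    extendSeries b c P (restrictSeries b c (MvPowerSeries.monomial d 1))), ?_, ?_⟩
  · exact sum_mem fun d _ => Submodule.smul_of_tower_mem _ _
      (sub_extendSeries_restrictSeries_monomial_mem b c hP d)
  · have h : f - extendSeries b c P (restrictSeries b c f) -
        ∑ d ∈ s, MvPowerSeries.coeff d f • (MvPowerSeries.monomial d 1 -
          extendSeries b c P (restrictSeries b c (MvPowerSeries.monomial d 1))) =
        g - extendSeries b c P (restrictSeries b c g) := by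
      have hg' : g = f - ∑ d ∈ s, MvPowerSeries.coeff d f • MvPowerSeries.monomial d 1 :=
        eq_sub_of_add_eq' hf.symm
      rw [hg']
      simp only [map_sub, map_sum, map_smul, smul_sub, Finset.sum_sub_distrib]
      abel
    rw [h]
    refine orderIdeal_anti (Nat.le_succ k) (sub_mem hg ?_)
    exact extendSeries_mem_orderIdeal b c P (restrictSeries_mem_orderIdeal b c hg)

lemma restrictJet_of_isEmpty [IsEmpty κ] {𝔨 : Type*} [LieRing 𝔨] [LieAlgebra ℝ 𝔨]
    (ξ : JetAlg ι 𝔨) : restrictJet b c 𝔨 ξ = 1 ⊗ₜ[ℝ] jetEval ξ := by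
  induction ξ using TensorProduct.induction_on with
  | zero => rw [map_zero, map_zero, tmul_zero]
  | add x y hx hy => rw [map_add, map_add, hx, hy, tmul_add]
  | tmul f X =>
    have h1 : jetEval (f ⊗ₜ[ℝ] X) = MvPowerSeries.constantCoeff f • X := jetCoeff_tmul 0 f X
    have h2 : restrictSeries b c f = MvPowerSeries.constantCoeff f • 1 := by
      have h0 := restrictSeries_mem_orderIdeal b c
        (f := f - algebraMap ℝ _ (MvPowerSeries.constantCoeff f)) (k := 1)
        (mem_orderIdeal_one.mpr (by simp [MvPowerSeries.algebraMap_apply]))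
      rw [map_sub, AlgHom.commutes, Algebra.algebraMap_eq_smul_one, mem_orderIdeal_one] at h0
      rw [← sub_eq_zero]
      ext n
      rw [Subsingleton.elim n 0, map_zero]
      exact h0
    change restrictSeries b c f ⊗ₜ[ℝ] X = _
    rw [h1, h2, smul_tmul]

end Restriction

/-! ### Factorization through the center space and the origin. -/

section Factorization

variable {V : Type*} [AddCommGroup V] [Module ℝ V] {n m : ℕ} (b : Module.Basis (Fin n) ℝ V)
  {W : Submodule ℝ V} (c : Module.Basis (Fin m) ℝ W)
  {𝔨 : Type*} [LieRing 𝔨] [LieAlgebra ℝ 𝔨] [TopologicalSpace 𝔨]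
  [IsTopologicalAddGroup 𝔨] [ContinuousSMul ℝ 𝔨] [Module.Finite ℝ 𝔨] [LieAlgebra.IsSimple ℝ 𝔨]
  {v : Fin n → MvPowerSeries (Fin n) ℝ} {σ : JetAlg (Fin n) 𝔨}
  {𝓓 : Type*} [NormedAddCommGroup 𝓓] [InnerProductSpace ℂ 𝓓]
  {πbar : JetSharp v σ →ₗ⁅ℝ⁆ projSkewOps 𝓓}

/-- `πc` is the representation precomposed with extension of jets along a linear projection `P` onto
`W`. Extending after restricting changes a jet only by elements approximated by the kernel. -/
lemma exists_factor_restrictJet (hcont : IsContinuousProjRep πbar)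
    (hW : annihilatorIdeal b W ≤ kernelIdeal (πbar.comp (jetIncl v σ))) :
    ∃ πc : JetAlg (Fin m) 𝔨 →ₗ⁅ℝ⁆ projSkewOps 𝓓, IsContinuousProjRep πc ∧
      ∀ ξ : JetAlg (Fin n) 𝔨, πbar (jetIncl v σ ξ) = πc (restrictJet b c 𝔨 ξ) := by
  obtain ⟨P, hP⟩ := W.subtype.exists_leftInverse_of_injective W.ker_subtype
  have hP' : ∀ x : W, P x = x := fun x => LinearMap.congr_fun hP x
  refine ⟨(πbar.comp (jetIncl v σ)).comp
    (LieAlgebra.ExtendScalars.map (extendSeries b c P) LieHom.id), fun ψ hψ => ?_, fun ξ => ?_⟩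
  · exact (hcont ψ hψ).comp ((continuous_jetIncl v σ).comp (continuous_map_jet _
      fun _ _ => extendSeries_mem_orderIdeal b c P))
  · induction ξ using TensorProduct.induction_on with
    | zero => simp only [map_zero]
    | add x y hx hy => simp only [map_add, hx, hy]
    | tmul f X =>
      change πbar (jetIncl v σ (f ⊗ₜ[ℝ] X)) =
        πbar (jetIncl v σ (extendSeries b c P (restrictSeries b c f) ⊗ₜ[ℝ] X))
      rw [← sub_eq_zero, ← map_sub, ← map_sub, ← sub_tmul]
      refine map_jetIncl_eq_zero_of_approximation hcont fun k => ?_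
      obtain ⟨g, hg, h⟩ := exists_mem_annihilatorIdeal_sub_mem b c hP' f k
      exact ⟨g ⊗ₜ[ℝ] X, by rw [← sub_tmul]; exact tmul_mem_jetIdeal h X, hW hg X⟩

omit [Module.Finite ℝ 𝔨] [LieAlgebra.IsSimple ℝ 𝔨] [IsTopologicalAddGroup 𝔨] in
lemma exists_factor_jetEval {c : Module.Basis (Fin 0) ℝ W}
    {πc : JetAlg (Fin 0) 𝔨 →ₗ⁅ℝ⁆ projSkewOps 𝓓} (hcont : IsContinuousProjRep πc) :
    ∃ π₀ : 𝔨 →ₗ⁅ℝ⁆ projSkewOps 𝓓, IsContinuousProjRep π₀ ∧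
      ∀ ξ : JetAlg (Fin n) 𝔨, πc (restrictJet b c 𝔨 ξ) = π₀ (jetEval ξ) := by
  let j : 𝔨 →ₗ⁅ℝ⁆ JetAlg (Fin 0) 𝔨 :=
    { TensorProduct.mk ℝ (MvPowerSeries (Fin 0) ℝ) 𝔨 1 with
      map_lie' := fun {X Y} => by
        change 1 ⊗ₜ[ℝ] ⁅X, Y⁆ = ⁅1 ⊗ₜ[ℝ] X, 1 ⊗ₜ[ℝ] Y⁆
        rw [LieAlgebra.ExtendScalars.bracket_tmul, one_mul] }
  have hj : Continuous j := by
    rw [isInducing_jetCoords.continuous_iff, continuous_pi_iff]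
    intro d
    refine (continuous_const_smul (MvPowerSeries.coeff d (1 : MvPowerSeries (Fin 0) ℝ))).congr
      fun X => (jetCoeff_tmul d 1 X).symm
  exact ⟨πc.comp j, fun ψ hψ => (hcont ψ hψ).comp hj, fun ξ =>
    congrArg πc (restrictJet_of_isEmpty b c ξ)⟩

end Factorization

end JetGPE

theorem mainTheorem6
    {V : Type*} [AddCommGroup V] [Module ℝ V] {n : ℕ} (b : Module.Basis (Fin n) ℝ V)
    {𝔨 : Type*} [LieRing 𝔨] [LieAlgebra ℝ 𝔨] [TopologicalSpace 𝔨] [T2Space 𝔨]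
    [IsTopologicalAddGroup 𝔨] [ContinuousSMul ℝ 𝔨] (h𝔨 : JetGPE.IsCompactSimple 𝔨)
    -- a formal vector field `v` vanishing at the origin and a vertical twist `σ`
    (v : Fin n → MvPowerSeries (Fin n) ℝ) (hv : ∀ i, MvPowerSeries.constantCoeff (v i) = 0)
    (σ : JetGPE.JetAlg (Fin n) 𝔨)
    -- `σ ∈ R ⊗ 𝔱` for a maximal abelian subalgebra `𝔱`
    (𝔱 : LieSubalgebra ℝ 𝔨) (h𝔱 : Maximal (fun s : LieSubalgebra ℝ 𝔨 => IsLieAbelian s) 𝔱)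
    (hσ : σ ∈ LinearMap.range
      (LinearMap.lTensor (MvPowerSeries (Fin n) ℝ) 𝔱.toSubmodule.subtype))
    -- the semisimple part of the linearization of `v` commutes with the higher order part of `v`
    (S N : Module.End ℝ V) (hSN : JetGPE.IsJordanDecomposition (JetGPE.linearPart b v) S N)
    (hcomm : ⁅JetGPE.lieDer (JetGPE.linearField b S),
      JetGPE.lieDer (JetGPE.higherOrderPart b v)⁆ = 0)
    -- a continuous projective unitary representation of generalized positive energy at `d`
    {𝓓 : Type*} [NormedAddCommGroup 𝓓] [InnerProductSpace ℂ 𝓓]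
    (πbar : JetGPE.JetSharp v σ →ₗ⁅ℝ⁆ JetGPE.projSkewOps 𝓓)
    (hcont : JetGPE.IsContinuousProjRep πbar)
    (hgpe : JetGPE.IsProjGPE.{_, _, w} πbar (JetGPE.jetGenerator v σ)) :
    (∀ f ∈ JetGPE.annihilatorIdeal b (JetGPE.centerSpace (JetGPE.linearPart b v)), ∀ X : 𝔨,
      πbar (JetGPE.jetIncl v σ (f ⊗ₜ[ℝ] X)) = 0) ∧
    (∀ (m : ℕ) (c : Module.Basis (Fin m) ℝ (JetGPE.centerSpace (JetGPE.linearPart b v))),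
      ∃ πc : JetGPE.JetAlg (Fin m) 𝔨 →ₗ⁅ℝ⁆ JetGPE.projSkewOps 𝓓,
        JetGPE.IsContinuousProjRep πc ∧
        ∀ ξ : JetGPE.JetAlg (Fin n) 𝔨,
          πbar (JetGPE.jetIncl v σ ξ) = πc (JetGPE.restrictJet b c 𝔨 ξ)) ∧
    (JetGPE.centerSpace (JetGPE.linearPart b v) = ⊥ →
      ∃ π₀ : 𝔨 →ₗ⁅ℝ⁆ JetGPE.projSkewOps 𝓓,
        JetGPE.IsContinuousProjRep π₀ ∧
        ∀ ξ : JetGPE.JetAlg (Fin n) 𝔨,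
          πbar (JetGPE.jetIncl v σ ξ) = π₀ (JetGPE.jetEval ξ)) := by
  have := h𝔨.finite
  have := h𝔨.simple
  have : Nontrivial 𝔨 := by
    by_contra h
    rw [not_nontrivial_iff_subsingleton] at h
    exact LieAlgebra.IsSimple.non_abelian (R := ℝ) (L := 𝔨) ⟨fun x y => Subsingleton.elim _ _⟩
  -- One nonzero `H` that commutes with `σ` is enough: the rest of `𝔨` is reached by simplicity.
  obtain ⟨H, hHt, hH0⟩ := JetGPE.exists_ne_zero_mem_of_maximal h𝔱
  have hker := JetGPE.annihilatorIdeal_le_kernelIdeal b hv (JetGPE.lie_tmul_eq_zero h𝔱.prop hσ hHt)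
    hH0 hSN hcomm hcont hgpe
  refine ⟨fun f hf X => hker hf X, fun m c => JetGPE.exists_factor_restrictJet b c hcont hker,
    fun hbot => ?_⟩
  have : Subsingleton (JetGPE.centerSpace (JetGPE.linearPart b v)) :=
    Submodule.subsingleton_iff_eq_bot.mpr hbot
  obtain ⟨πc, hπc, h⟩ := JetGPE.exists_factor_restrictJet b (Module.Basis.empty
    (ι := Fin 0) (JetGPE.centerSpace (JetGPE.linearPart b v))) hcont hker
  obtain ⟨π₀, hπ₀, h₀⟩ := JetGPE.exists_factor_jetEval b hπc
  exact ⟨π₀, hπ₀, fun ξ => (h ξ).trans (h₀ ξ)⟩
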